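/- Let $q\in\mathbb R$, $0<|q|<1$. Let $C(SU_q(2))$ be the universal unital $C^*$-algebra generated by the entries of a $2\times 2$ unitary matrix $u=(u_{ij})$ subject to $$u_{11}u_{22}-q\,u_{12}u_{21}=1,\quad u_{21}u_{12}-q\,u_{22}u_{11}=-q,\quad u_{11}u_{12}=q\,u_{12}u_{11},\quad u_{21}u_{22}=q\,u_{22}u_{21},$$ with comultiplication $\Delta(u_{ij})=\sum_k u_{ik}\otimes u_{kj}$. Let $C(S^2_{q0})$ be the universal unital $C^*$-algebra generated by $\xi,\eta$ with $$\xi^*=\xi,\quad \eta^*\eta=\xi-\xi^2,\quad \eta\xi=q^2\xi\eta,\quad \eta\eta^*=q^2\xi-q^4\xi^2 .$$ Embed $C(S^2_{q0})$ into $C(SU_q(2))$ by $\psi(\xi)=-q^{-1}u_{12}u_{21}$, $\psi(\eta)=u_{11}u_{21}$, and let $\tau:C(S^2_{q0})\to C(S^2_{q0})\otimes C(SU_q(2))$ be the action of $SU_q(2)$ with $(\psi\otimes\mathrm{id})\tau=\Delta\psi$. Let $A(SU_q(2))$ be the $*$-algebra generated by the matrix entries of the irreducible unitary representations of $SU_q(2)$,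 and $\mathcal A=\{a\in C(S^2_{q0}):\tau(a)\in C(S^2_{q0})\otimes_{\rm alg}A(SU_q(2))\}$. There is exactly one state $\rho$ of $C(S^2_{q0})$ with $(\rho\otimes\mathrm{id})\tau(a)=\rho(a)1$ for all $a$. Let $\pi$ be its GNS representation on $\mathcal H_\rho$, with canonical map $\Lambda:C(S^2_{q0})\to\mathcal H_\rho$, and let $u_\tau$ be the unitary representation of $SU_q(2)$ on $\mathcal H_\rho$ induced by $\tau$, i.e. $(\mathrm{id}\otimes\omega)(u_\tau)\Lambda(a)=\Lambda((\mathrm{id}\otimes\omega)\tau(a))$ for all $\omega\in C(SU_q(2))^*$. A self-adjoint operator $D$ on $\mathcal H_\rho$ is called *equivariant* if $D\otimes 1$ commutes with $u_\tau$, i.e. $UD\subseteq DU$ for all $U=(\mathrm{id}\otimes\omega)(u_\tau)$. We say that $[D,T]$ is bounded ($T$ a bounded operator) if $T$ maps the domain of $D$ into itself and $DT-TD$ is bounded there. $D$ *gives an equivariant spectral triple* if it is self-adjoint, equivariant, has compact resolvent, and $[D,\pi(a)]$ is bounded for all $a\in\mathcal A$; it is *$p$-summable* if $(1+D^2)^{-p/2}$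 is of trace class. The *spectral dimension* is the infimum of all $p>0$ for which there is a $p$-summable $D$ that gives an equivariant spectral triple. Then: 1. $\mathcal H_\rho$ is the Hilbert space direct sum of subspaces $\mathcal H_k$, $k=0,1,2,\dots$ (the spin-$k$ blocks), where $\dim\mathcal H_k=2k+1$ and $\mathcal H_k$ carries the irreducible representation of $SU_q(2)$ of dimension $2k+1$, and is the whole isotypic component of that representation. 2. For every real sequence $d$ there is exactly one self-adjoint operator $D_d$ on $\mathcal H_\rho$ with $D_dx=d(k)x$ for all $x\in\mathcal H_k$, $k\ge 0$. A self-adjoint operator on $\mathcal H_\rho$ is equivariant if and only if it equals $D_d$ for some real sequence $d$. 3. For every real sequence $d$ the following are equivalent: (a) $[D_d,\pi(\xi)]$ and $[D_d,\pi(\eta)]$ are bounded; (b) $[D_d,\pi(a)]$ is bounded for all $a\in\mathcal A$; (c) $|d(k)-d(k+1)|=O(|q|^{-k})$ as $k\to\infty$. 4. For $d(k)=q^{-k}$, the operator $D_d$ gives an equivariant spectral triple that is $p$-summable for every $p>0$. 5. Consequently the spectral dimension of $(C(S^2_{q0}),SU_q(2),\tau)$ is $0$. -/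

import Mathlib

open scoped BoundedContinuousFunction ENNReal InnerProductSpace ComplexOrder Matrix

noncomputable section

namespace Podles

/-! ### Universal unital C⋆-algebras given by generators and relations -/

/-- The separable infinite-dimensional Hilbert space `ℓ²(ℕ)`. -/
abbrev SepHilbert : Type := lp (fun _ : ℕ => ℂ) 2

/-- The bounded operators on `ℓ²(ℕ)`. -/
def BddOp : Type := SepHilbert →L[ℂ] SepHilbert

instance : CStarAlgebra BddOp := inferInstanceAs (CStarAlgebra (SepHilbert →L[ℂ] SepHilbert))

/-- Generators (indexed by `ι`) and relations: `reps` is the set of all families of operators on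
`ℓ²(ℕ)` that satisfy the relations, which have to force the generators to be contractions. -/
structure Presentation (ι : Type) where
  reps : Set (ι → BddOp)
  norm_le : ∀ x ∈ reps, ∀ i, ‖x i‖ ≤ 1

namespace Presentation

variable {ι κ : Type}

/-- The `i`-th generator, as a function of the representation. -/
def genFun (P : Presentation ι) (i : ι) : P.reps →ᵇ BddOp :=
  BoundedContinuousFunction.ofNormedAddCommGroup (fun x => x.1 i)
    ((continuous_apply i).comp continuous_subtype_val) 1 (fun x => P.norm_le x.1 x.2 i)

/-- The norm closed unital `⋆`-algebra generated by the generators, for the norm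
`‖a‖ = sup {‖a(x)‖ : x a representation on ℓ²(ℕ)}`. -/
def alg (P : Presentation ι) : StarSubalgebra ℂ (P.reps →ᵇ BddOp) :=
  (StarAlgebra.adjoin ℂ (Set.range P.genFun)).topologicalClosure

/-- The universal unital C⋆-algebra of the presentation. (For countably many generators it is
separable, so that the unital representations on `ℓ²(ℕ)` compute the universal norm.) -/
def CStar (P : Presentation ι) : Type := P.alg

instance (P : Presentation ι) : IsClosed (P.alg : Set (P.reps →ᵇ BddOp)) :=
  StarSubalgebra.isClosed_topologicalClosure _

instance (P : Presentation ι) : CStarAlgebra P.CStar :=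
  inferInstanceAs (CStarAlgebra P.alg)

/-- `a ≤ b` if and only if `b - a` is selfadjoint with spectrum in `[0, ∞)`. -/
instance (P : Presentation ι) : PartialOrder P.CStar := CStarAlgebra.spectralOrder _

instance (P : Presentation ι) : StarOrderedRing P.CStar := CStarAlgebra.spectralOrderedRing _

theorem genFun_mem (P : Presentation ι) (i : ι) : P.genFun i ∈ P.alg :=
  StarSubalgebra.le_topologicalClosure _ (StarAlgebra.subset_adjoin ℂ _ ⟨i, rfl⟩)

/-- The `i`-th generator of the universal C⋆-algebra. -/
def gen (P : Presentation ι) (i : ι) : P.CStar := ⟨P.genFun i, P.genFun_mem i⟩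

/-- Composition with a continuous map between spaces of representations. -/
def compHom {X Y : Type} [TopologicalSpace X] [TopologicalSpace Y] (f : C(Y, X)) :
    (X →ᵇ BddOp) →⋆ₐ[ℂ] (Y →ᵇ BddOp) where
  toFun a := a.compContinuous f
  map_one' := rfl
  map_mul' _ _ := rfl
  map_zero' := rfl
  map_add' _ _ := rfl
  commutes' _ := rfl
  map_star' _ := rfl

theorem compHom_mem (P : Presentation ι) (Q : Presentation κ) (f : C(Q.reps, P.reps))
    (hf : ∀ i, (P.genFun i).compContinuous f ∈ Q.alg) (a : P.reps →ᵇ BddOp) (ha : a ∈ P.alg) :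
    compHom f a ∈ Q.alg := by
  have hcl : IsClosed (Q.alg.comap (compHom f) : Set (P.reps →ᵇ BddOp)) :=
    (StarSubalgebra.isClosed_topologicalClosure _).preimage
      (BoundedContinuousFunction.continuous_compContinuous f)
  have hle : P.alg ≤ Q.alg.comap (compHom f) := by
    refine StarSubalgebra.topologicalClosure_minimal (StarAlgebra.adjoin_le ?_) hcl
    rintro _ ⟨i, rfl⟩
    exact hf i
  exact hle ha

/-- The `⋆`-homomorphism `a ↦ a ∘ f`. Here `f` turns families satisfying the relations of `Q` into
families satisfying the relations of `P`, by a formula `w i` for the `i`-th member: this is the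
`⋆`-homomorphism that sends the `i`-th generator to `w i`. -/
def lift (P : Presentation ι) (Q : Presentation κ) (w : ι → Q.CStar) (f : Q.reps → P.reps)
    (hf : ∀ i x, (f x).1 i = (w i).1 x) : P.CStar →⋆ₐ[ℂ] Q.CStar :=
  have hc : Continuous f := by
    refine Continuous.subtype_mk (f := fun x => (f x).1) (continuous_pi fun i => ?_) _
    simp only [hf]
    exact (w i).1.continuous
  (((compHom ⟨f, hc⟩).comp P.alg.subtype).codRestrict Q.alg
    (fun a => compHom_mem P Q ⟨f, hc⟩ (fun i => by
      have : (P.genFun i).compContinuous ⟨f, hc⟩ = (w i).1 := by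
        ext1 x; exact hf i x
      rw [this]; exact (w i).2) a.1 a.2) : P.alg →⋆ₐ[ℂ] Q.alg)

theorem lift_gen (P : Presentation ι) (Q : Presentation κ) (w : ι → Q.CStar) (f : Q.reps → P.reps)
    (hf : ∀ i x, (f x).1 i = (w i).1 x) (i : ι) : lift P Q w f hf (P.gen i) = w i := by
  apply Subtype.ext
  ext1 x
  exact hf i x

/-- The C⋆-tensor product: the universal C⋆-algebra generated by commuting copies of the two
C⋆-algebras (that is, the maximal tensor product; the C⋆-algebras to which it is applied below are
of type I, hence nuclear, so that all C⋆-tensor products with them coincide). -/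
def tensor (P : Presentation ι) (Q : Presentation κ) : Presentation (ι ⊕ κ) where
  reps := {x | (fun i => x (Sum.inl i)) ∈ P.reps ∧ (fun j => x (Sum.inr j)) ∈ Q.reps ∧
    ∀ i j, Commute (x (Sum.inl i)) (x (Sum.inr j)) ∧
      Commute (x (Sum.inl i)) (star (x (Sum.inr j)))}
  norm_le := by
    rintro x ⟨h1, h2, -⟩ (i | j)
    · exact P.norm_le _ h1 i
    · exact Q.norm_le _ h2 j

/-- The embedding `a ↦ a ⊗ 1`. -/
def inl (P : Presentation ι) (Q : Presentation κ) : P.CStar →⋆ₐ[ℂ] (P.tensor Q).CStar :=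
  lift P (P.tensor Q) (fun i => (P.tensor Q).gen (Sum.inl i))
    (fun x => ⟨fun i => x.1 (Sum.inl i), x.2.1⟩) (fun _ _ => rfl)

/-- The embedding `b ↦ 1 ⊗ b`. -/
def inr (P : Presentation ι) (Q : Presentation κ) : Q.CStar →⋆ₐ[ℂ] (P.tensor Q).CStar :=
  lift Q (P.tensor Q) (fun j => (P.tensor Q).gen (Sum.inr j))
    (fun x => ⟨fun j => x.1 (Sum.inr j), x.2.2.1⟩) (fun _ _ => rfl)

end Presentation

/-! ### Unbounded operators and spectral triples -/

section Operators

variable {H : Type} [NormedAddCommGroup H] [InnerProductSpace ℂ H] [CompleteSpace H]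

/-- `U D ⊆ D U` for a bounded operator `U`. -/
def CommutesWith (D : H →ₗ.[ℂ] H) (U : H →L[ℂ] H) : Prop :=
  ∀ x : D.domain, ∃ h : U x ∈ D.domain, D ⟨U x, h⟩ = U (D x)

/-- `T` preserves the domain of `D`, and `[D, T]` is bounded. -/
def HasBoundedCommutator (D : H →ₗ.[ℂ] H) (T : H →L[ℂ] H) : Prop :=
  ∃ C : ℝ, ∀ x : D.domain, ∃ h : T x ∈ D.domain, ‖D ⟨T x, h⟩ - T (D x)‖ ≤ C * ‖(x : H)‖

/-- `(D - z)⁻¹` exists as a compact operator for some `z`. -/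
def HasCompactResolvent (D : H →ₗ.[ℂ] H) : Prop :=
  ∃ (z : ℂ) (R : H →L[ℂ] H), IsCompactOperator R ∧
    (∀ x : H, ∃ h : R x ∈ D.domain, D ⟨R x, h⟩ - z • R x = x) ∧
    ∀ x : D.domain, R (D x - z • (x : H)) = x

/-- `(H, D)` is a spectral triple for a `⋆`-algebra represented on `H` with image `ops`. -/
structure IsSpectralTriple (ops : Set (H →L[ℂ] H)) (D : H →ₗ.[ℂ] H) : Prop where
  selfAdjoint : IsSelfAdjoint D
  compactResolvent : HasCompactResolvent D
  boundedCommutator : ∀ T ∈ ops, HasBoundedCommutator D T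

/-- A positive operator of trace class: `∑ ⟪e, T e⟫ < ∞` for an orthonormal basis `e` (the sum does
not depend on the basis). -/
def IsPositiveTraceClass (T : H →L[ℂ] H) : Prop :=
  T.IsPositive ∧ ∃ (s : Set H) (e : HilbertBasis s ℂ H), Summable fun i => (⟪e i, T (e i)⟫_ℂ).re

/-- `(1 + D²)^{-p/2}` is of trace class; here `R = (1 + D²)⁻¹`. -/
def IsPSummable (D : H →ₗ.[ℂ] H) (p : ℝ) : Prop :=
  ∃ R : H →L[ℂ] H,
    (∀ x : H, ∃ (h : R x ∈ D.domain) (h' : D ⟨R x, h⟩ ∈ D.domain), R x + D ⟨D ⟨R x, h⟩, h'⟩ = x) ∧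
    IsPositiveTraceClass (R ^ (p / 2))

end Operators

/-! ### The quantum group `SU_q(2)` -/

section Relations

set_option linter.unusedSimpArgs false

variable {B : Type} [Ring B] [StarRing B] [Algebra ℂ B]

/-- The defining relations of `C(SU_q(2))`; the indices `0, 1` stand for `1, 2`. -/
structure IsSUq2 (q : ℝ) (u : Matrix (Fin 2) (Fin 2) B) : Prop where
  unitary_left : uᴴ * u = 1
  unitary_right : u * uᴴ = 1
  det01 : u 0 0 * u 1 1 - (q : ℂ) • (u 0 1 * u 1 0) = 1
  det10 : u 1 0 * u 0 1 - (q : ℂ) • (u 1 1 * u 0 0) = -(q : ℂ) • (1 : B)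
  det00 : u 0 0 * u 0 1 - (q : ℂ) • (u 0 1 * u 0 0) = 0
  det11 : u 1 0 * u 1 1 - (q : ℂ) • (u 1 1 * u 1 0) = 0

/-- The defining relations of `C(S²_{q0})`, with generators `ξ` and `η`. -/
structure IsPodles (q : ℝ) (ξ η : B) : Prop where
  star_xi : star ξ = ξ
  star_eta_mul : star η * η = ξ - ξ ^ 2
  eta_xi : η * ξ = ((q : ℂ) ^ 2) • (ξ * η)
  eta_mul_star : η * star η = ((q : ℂ) ^ 2) • ξ - ((q : ℂ) ^ 4) • ξ ^ 2

variable {q : ℝ}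

theorem IsSUq2.adjugate [NeZero q] {u : Matrix (Fin 2) (Fin 2) B} (h : IsSUq2 q u) :
    uᴴ = !![u 1 1, -(q : ℂ)⁻¹ • u 0 1; -(q : ℂ) • u 1 0, u 0 0] := by
  have hq : (q : ℂ) ≠ 0 := by exact_mod_cast NeZero.ne q
  have hV : u * !![u 1 1, -(q : ℂ)⁻¹ • u 0 1; -(q : ℂ) • u 1 0, u 0 0] = 1 := by
    have h1 := h.det01
    have h2 : u 0 1 * u 0 0 = (q : ℂ)⁻¹ • (u 0 0 * u 0 1) := by
      rw [sub_eq_zero.1 h.det00, smul_smul, inv_mul_cancel₀ hq, one_smul]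
    have h3 := sub_eq_zero.1 h.det11
    have h4 : u 1 1 * u 0 0 = 1 + (q : ℂ)⁻¹ • (u 1 0 * u 0 1) := by
      have := congrArg (fun z => (q : ℂ)⁻¹ • z) h.det10
      simp only [smul_sub, smul_smul, inv_mul_cancel₀ hq, one_smul, mul_neg] at this
      rw [sub_eq_iff_eq_add] at this
      rw [this]; module
    ext i j
    fin_cases i <;> fin_cases j <;>
      simp [Matrix.mul_apply, Fin.sum_univ_two, h2, h3, h4, ← h1, sub_eq_add_neg]
  calc uᴴ = uᴴ * (u * _) := by rw [hV, mul_one]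
    _ = _ := by rw [← mul_assoc, h.unitary_left, one_mul]

theorem IsSUq2.of_adjugate [NeZero q] {u : Matrix (Fin 2) (Fin 2) B}
    (h1 : uᴴ * u = 1) (h2 : u * uᴴ = 1)
    (h : uᴴ = !![u 1 1, -(q : ℂ)⁻¹ • u 0 1; -(q : ℂ) • u 1 0, u 0 0]) : IsSUq2 q u := by
  have hq : (q : ℂ) ≠ 0 := by exact_mod_cast NeZero.ne q
  have h3 := h2
  rw [h] at h3
  have e00 := congrFun (congrFun h3 0) 0
  have e01 := congrFun (congrFun h3 0) 1
  have e10 := congrFun (congrFun h3 1) 0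
  have e11 := congrFun (congrFun h3 1) 1
  simp [Matrix.mul_apply, Fin.sum_univ_two, -Complex.coe_smul] at e00 e01 e10 e11
  refine ⟨h1, h2, ?_, ?_, ?_, ?_⟩
  · rw [← e00]; module
  · rw [← e11, smul_add, smul_neg, smul_smul, neg_mul, mul_inv_cancel₀ hq]; module
  · have := congrArg (fun z => -(q : ℂ) • z) e01
    rw [smul_add, smul_neg, smul_smul, neg_mul, mul_inv_cancel₀ hq, smul_zero] at this
    rw [← this]; module
  · rw [← e10]; module

/-- `(Δ u)ᵢⱼ = ∑ₖ uᵢₖ ⊗ uₖⱼ` satisfies the relations again. -/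
theorem IsSUq2.mul [StarModule ℂ B] [NeZero q] {u v : Matrix (Fin 2) (Fin 2) B} (hu : IsSUq2 q u)
    (hv : IsSUq2 q v) (hc : ∀ i j k l, Commute (u i j) (v k l)) : IsSUq2 q (u * v) := by
  refine IsSUq2.of_adjugate ?_ ?_ ?_
  · rw [Matrix.conjTranspose_mul, mul_assoc, ← mul_assoc _ u v, hu.unitary_left, one_mul, hv.unitary_left]
  · rw [Matrix.conjTranspose_mul, mul_assoc, ← mul_assoc v, hv.unitary_right, one_mul, hu.unitary_right]
  · have hq : (q : ℂ) ≠ 0 := by exact_mod_cast NeZero.ne q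
    rw [Matrix.conjTranspose_mul, hu.adjugate, hv.adjugate]
    ext i j
    fin_cases i <;> fin_cases j <;>
      simp [Matrix.mul_apply, Fin.sum_univ_two, smul_smul, hq, -Complex.coe_smul,
        fun i j k l => (hc i j k l).eq] <;>
      abel

/-- The relations of the sphere say that this matrix is a selfadjoint idempotent. -/
theorem isPodles_of_mul_self {ξ η : B} (hs : star ξ = ξ)
    (h : !![1 - ξ, -star η; -η, ((q : ℂ) ^ 2) • ξ] * !![1 - ξ, -star η; -η, ((q : ℂ) ^ 2) • ξ] =
      !![1 - ξ, -star η; -η, ((q : ℂ) ^ 2) • ξ]) : IsPodles q ξ η := by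
  have e00 := congrFun (congrFun h 0) 0
  have e10 := congrFun (congrFun h 1) 0
  have e11 := congrFun (congrFun h 1) 1
  simp [Matrix.mul_apply, Fin.sum_univ_two, mul_sub, sub_mul, -Complex.coe_smul] at e00 e10 e11
  refine ⟨hs, ?_, ?_, ?_⟩
  · rw [pow_two]
    have : star η * η = (1 - ξ - (ξ - ξ * ξ) + star η * η) - (1 - ξ) + (ξ - ξ * ξ) := by abel
    rw [this, e00]; abel
  · have : η * ξ = (-η + η * ξ + -((q : ℂ) ^ 2 • (ξ * η))) + η + (q : ℂ) ^ 2 • (ξ * η) := by abel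
    rw [this, e10]; abel
  · rw [← e11, pow_two ξ]; module

theorem IsPodles.mul_self [StarModule ℂ B] {ξ η : B} (h : IsPodles q ξ η) :
    !![1 - ξ, -star η; -η, ((q : ℂ) ^ 2) • ξ] * !![1 - ξ, -star η; -η, ((q : ℂ) ^ 2) • ξ] =
      !![1 - ξ, -star η; -η, ((q : ℂ) ^ 2) • ξ] := by
  have h3 : ξ * star η = ((q : ℂ) ^ 2) • (star η * ξ) := by
    have := congrArg star h.eta_xi
    simpa [h.star_xi, -Complex.coe_smul] using this
  ext i j
  fin_cases i <;> fin_cases j <;>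
    simp [Matrix.mul_apply, Fin.sum_univ_two, mul_sub, sub_mul, h.star_eta_mul, h.eta_mul_star,
      h.eta_xi, h3, pow_two, smul_smul, -Complex.coe_smul]
  all_goals module

/-- The image of `ξ` under the coaction. -/
def actXi (q : ℝ) (ξ η : B) (u : Matrix (Fin 2) (Fin 2) B) : B :=
  -(q : ℂ)⁻¹ • (η * (u 0 1 * u 0 0) + (1 - ((q : ℂ) ^ 2) • ξ) * (u 0 1 * u 1 0)
    - (q : ℂ) • (ξ * (u 1 1 * u 0 0)) - (q : ℂ) • (star η * (u 1 1 * u 1 0)))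

/-- The image of `η` under the coaction. -/
def actEta (q : ℝ) (ξ η : B) (u : Matrix (Fin 2) (Fin 2) B) : B :=
  η * (u 0 0 * u 0 0) + (1 - ((q : ℂ) ^ 2) • ξ) * (u 0 0 * u 1 0)
    - (q : ℂ) • (ξ * (u 1 0 * u 0 0)) - (q : ℂ) • (star η * (u 1 0 * u 1 0))

theorem IsSUq2.facts [StarModule ℂ B] [NeZero q] {u : Matrix (Fin 2) (Fin 2) B}
    (h : IsSUq2 q u) :
    u 1 1 = star (u 0 0) ∧ u 0 1 = -(q : ℂ) • star (u 1 0) ∧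
    star (u 0 0) * u 0 0 = 1 - star (u 1 0) * u 1 0 ∧
    u 0 0 * star (u 0 0) = 1 - ((q : ℂ) ^ 2) • (star (u 1 0) * u 1 0) ∧
    u 0 0 * u 1 0 = (q : ℂ) • (u 1 0 * u 0 0) ∧
    u 0 0 * star (u 1 0) = (q : ℂ) • (star (u 1 0) * u 0 0) ∧
    u 1 0 * star (u 0 0) = (q : ℂ) • (star (u 0 0) * u 1 0) ∧
    u 1 0 * star (u 1 0) = star (u 1 0) * u 1 0 := by
  have hq : (q : ℂ) ≠ 0 := by exact_mod_cast NeZero.ne q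
  have hinv : ∀ {x y : B} (z : ℂ), z ≠ 0 → z • x = z • y → x = y := by
    intro x y z hz h
    rw [← one_smul ℂ x, ← one_smul ℂ y, ← inv_mul_cancel₀ hz, mul_smul, mul_smul, h]
  have hd : u 1 1 = star (u 0 0) := by
    simpa using (congrFun (congrFun h.adjugate 0) 0).symm
  have hb : u 0 1 = -(q : ℂ) • star (u 1 0) := by
    have := congrFun (congrFun h.adjugate 0) 1
    simp [-Complex.coe_smul] at this
    rw [this, smul_neg, smul_smul, neg_mul, mul_inv_cancel₀ hq]; module
  have e1 : star (u 0 0) * u 0 0 = 1 - star (u 1 0) * u 1 0 := by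
    have := congrFun (congrFun h.unitary_left 0) 0
    simp [Matrix.mul_apply, Fin.sum_univ_two] at this
    rw [← this]; abel
  have e2 : u 1 0 * star (u 0 0) = (q : ℂ) • (star (u 0 0) * u 1 0) := by
    rw [← hd]; exact sub_eq_zero.1 h.det11
  have e3 : u 0 0 * star (u 1 0) = (q : ℂ) • (star (u 1 0) * u 0 0) := by
    simpa [-Complex.coe_smul] using congrArg star e2
  have e4 : u 0 0 * star (u 0 0) = 1 - ((q : ℂ) ^ 2) • (star (u 1 0) * u 1 0) := by
    have := congrFun (congrFun h.unitary_right 0) 0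
    simp [Matrix.mul_apply, Fin.sum_univ_two, hb, smul_smul, -Complex.coe_smul] at this
    rw [← this]; module
  have e5 : u 0 0 * u 1 0 = (q : ℂ) • (u 1 0 * u 0 0) := by
    have := congrArg star (congrFun (congrFun h.unitary_left 0) 1)
    simp [Matrix.mul_apply, Fin.sum_univ_two, hb, hd, -Complex.coe_smul] at this
    rw [neg_add_eq_zero] at this
    exact this.symm
  have e6 : u 1 0 * star (u 1 0) = star (u 1 0) * u 1 0 := by
    have := congrFun (congrFun h.unitary_left 1) 1
    simp [Matrix.mul_apply, Fin.sum_univ_two, hb, hd, e4, smul_smul, -Complex.coe_smul] at this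
    refine hinv ((q : ℂ) * q) (mul_ne_zero hq hq) (sub_eq_zero.1 ?_)
    rw [← sub_self (1 : B)]
    nth_rewrite 1 [← this]
    module
  exact ⟨hd, hb, e1, e4, e5, e3, e2, e6⟩

/-- The coaction is compatible with the relations of the sphere. -/
theorem IsPodles.act [StarModule ℂ B] [NeZero q] {ξ η : B} {u : Matrix (Fin 2) (Fin 2) B}
    (h : IsPodles q ξ η) (hu : IsSUq2 q u)
    (hc : ∀ i j, Commute ξ (u i j) ∧ Commute η (u i j) ∧ Commute (star η) (u i j)) :
    IsPodles q (actXi q ξ η u) (actEta q ξ η u) := by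
  have hq : (q : ℂ) ≠ 0 := by exact_mod_cast NeZero.ne q
  obtain ⟨hd, hb, e1, e2, e3, e4, e5, e6⟩ := hu.facts
  have hxi := h.star_xi
  have ca1 := (hc 0 0).1.eq
  have ca2 := (hc 0 0).2.1.eq
  have ca3 := (hc 0 0).2.2.eq
  have cc1 := (hc 1 0).1.eq
  have cc2 := (hc 1 0).2.1.eq
  have cc3 := (hc 1 0).2.2.eq
  generalize haa : u 0 0 = a at *
  generalize hcc : u 1 0 = c at *
  have cas1 : ξ * star a = star a * ξ := by simpa [hxi] using (congrArg star ca1).symm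
  have cas2 : η * star a = star a * η := by simpa using (congrArg star ca3).symm
  have cas3 : star η * star a = star a * star η := by simpa using (congrArg star ca2).symm
  have ccs1 : ξ * star c = star c * ξ := by simpa [hxi] using (congrArg star cc1).symm
  have ccs2 : η * star c = star c * η := by simpa using (congrArg star cc3).symm
  have ccs3 : star η * star c = star c * star η := by simpa using (congrArg star cc2).symm
  have hl : ∀ {x y : B}, x * y = y * x → ∀ z, y * (x * z) = x * (y * z) := by
    intro x y hxy z
    rw [← mul_assoc, ← hxy, mul_assoc]
  have hX : actXi q ξ η u = η * (star c * a) + star c * c - (q : ℂ) ^ 2 • (ξ * (star c * c))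
      + ξ * (star a * a) + star η * (star a * c) := by
    have : ∀ x : B, -(q : ℂ)⁻¹ • x = -((q : ℂ)⁻¹ • x) := fun x => by module
    simp only [actXi, haa, hcc, hb, hd, smul_mul_assoc, mul_smul_comm, sub_mul, one_mul,
      this, smul_add, smul_sub, neg_smul, smul_neg, smul_smul, inv_mul_cancel₀ hq, one_smul,
      mul_neg, neg_mul]
    rw [show (q : ℂ)⁻¹ * (q * q ^ 2) = (q : ℂ) ^ 2 by field_simp]
    abel
  have hE : actEta q ξ η u = η * (a * a) + a * c - (q : ℂ) ^ 2 • (ξ * (a * c))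
      - (q : ℂ) • (ξ * (c * a)) - (q : ℂ) • (star η * (c * c)) := by
    simp only [actEta, haa, hcc, smul_mul_assoc, sub_mul, one_mul]
    abel
  have hS : star (actEta q ξ η u) = star η * (star a * star a) + star c * star a
      - (q : ℂ) ^ 2 • (ξ * (star c * star a)) - (q : ℂ) • (ξ * (star a * star c))
      - (q : ℂ) • (η * (star c * star c)) := by
    rw [hE]
    simp [hxi, mul_assoc, -Complex.coe_smul,
      ← ca1, ← ca2, ← ca3, ← cc1, ← cc2, ← cc3, ← cas1, ← cas2, ← cas3, ← ccs1, ← ccs2, ← ccs3,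
      hl ca1, hl ca2, hl ca3, hl cc1, hl cc2, hl cc3, hl cas1, hl cas2, hl cas3, hl ccs1, hl ccs2,
      hl ccs3]
  have e7 : c * a = (q : ℂ)⁻¹ • (a * c) := by rw [e3, smul_smul, inv_mul_cancel₀ hq, one_smul]
  have e8 : star a * star c = (q : ℂ)⁻¹ • (star c * star a) := by
    have := congrArg star e7
    simpa [-Complex.coe_smul] using this
  have hP : !![1 - actXi q ξ η u, -star (actEta q ξ η u); -actEta q ξ η u,
      ((q : ℂ) ^ 2) • actXi q ξ η u] =
      uᴴ * !![1 - ξ, -star η; -η, ((q : ℂ) ^ 2) • ξ] * u := by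
    rw [hX, hS, hE]
    ext i j
    fin_cases i <;> fin_cases j
    all_goals
      simp [Matrix.mul_apply, Fin.sum_univ_two, haa, hcc, hb, hd, mul_assoc, mul_sub, sub_mul,
        mul_add, add_mul, -Complex.coe_smul, ← ca1, ← ca2, ← ca3, ← cc1, ← cc2, ← cc3, ← cas1,
        ← cas2, ← cas3, ← ccs1, ← ccs2, ← ccs3,
        hl ca1, hl ca2, hl ca3, hl cc1, hl cc2, hl cc3, hl cas1, hl cas2, hl cas3, hl ccs1, hl ccs2,
        hl ccs3, e1, e2, e4, e5, e6, e7, e8, smul_smul, smul_sub, smul_add]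
    all_goals try simp only [mul_inv_cancel₀ hq, one_smul]
    all_goals module
  refine isPodles_of_mul_self ?_ ?_
  · rw [hX]
    simp [hxi, mul_assoc, -Complex.coe_smul,
      ← ca1, ← ca2, ← ca3, ← cc1, ← cc2, ← cc3, ← cas1, ← cas2, ← cas3, ← ccs1, ← ccs2, ← ccs3,
      hl ca1, hl ca2, hl ca3, hl cc1, hl cc2, hl cc3, hl cas1, hl cas2, hl cas3, hl ccs1, hl ccs2,
      hl ccs3]
    abel
  · rw [hP]
    calc _ = uᴴ * !![1 - ξ, -star η; -η, ((q : ℂ) ^ 2) • ξ] * (u * uᴴ) *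
          !![1 - ξ, -star η; -η, ((q : ℂ) ^ 2) • ξ] * u := by simp only [mul_assoc]
      _ = _ := by rw [hu.unitary_right, mul_one, mul_assoc uᴴ, h.mul_self]

/-- `-q⁻¹ u₁₂ u₂₁` and `u₁₁ u₂₁` satisfy the relations of the sphere. -/
theorem IsSUq2.isPodles [StarModule ℂ B] [NeZero q] {u : Matrix (Fin 2) (Fin 2) B}
    (hu : IsSUq2 q u) : IsPodles q (-(q : ℂ)⁻¹ • (u 0 1 * u 1 0)) (u 0 0 * u 1 0) := by
  have hq : (q : ℂ) ≠ 0 := by exact_mod_cast NeZero.ne q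
  obtain ⟨hd, hb, e1, e2, e3, e4, e5, e6⟩ := hu.facts
  generalize haa : u 0 0 = a at *
  generalize hcc : u 1 0 = c at *
  have hX : -(q : ℂ)⁻¹ • (u 0 1 * c) = star c * c := by
    rw [hb, smul_mul_assoc, smul_smul, neg_mul_neg, inv_mul_cancel₀ hq, one_smul]
  rw [hX]
  refine ⟨by simp, ?_, ?_, ?_⟩
  · calc star (a * c) * (a * c) = star c * (star a * a) * c := by
          simp only [star_mul, mul_assoc]
      _ = star c * c - star c * (star c * c) * c := by rw [e1]; noncomm_ring
      _ = star c * c - star c * (c * star c) * c := by rw [e6]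
      _ = _ := by rw [pow_two]; noncomm_ring
  · calc a * c * (star c * c) = a * (c * star c) * c := by simp only [mul_assoc]
      _ = (a * star c) * c * c := by rw [e6]; simp only [mul_assoc]
      _ = (q : ℂ) • (star c * (a * c) * c) := by rw [e4]; simp only [smul_mul_assoc, mul_assoc]
      _ = ((q : ℂ) * q) • (star c * c * (a * c)) := by
          nth_rewrite 1 [e3]; simp only [smul_mul_assoc, mul_smul_comm, mul_assoc, smul_smul]
      _ = _ := by rw [pow_two]
  · calc a * c * star (a * c) = a * (c * star c) * star a := by simp only [star_mul, mul_assoc]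
      _ = (a * star c) * (c * star a) := by rw [e6]; simp only [mul_assoc]
      _ = ((q : ℂ) * q) • (star c * (a * star a) * c) := by
          rw [e4, e5]; simp only [smul_mul_assoc, mul_smul_comm, mul_assoc, smul_smul]
      _ = ((q : ℂ) * q) • (star c * c) - ((q : ℂ) * q * (q ^ 2)) • (star c * (star c * c) * c) := by
          rw [e2]
          simp only [mul_sub, sub_mul, mul_one, smul_sub, smul_smul, mul_smul_comm, smul_mul_assoc]
      _ = ((q : ℂ) * q) • (star c * c) - ((q : ℂ) * q * (q ^ 2)) • (star c * (c * star c) * c) := by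
          rw [e6]
      _ = _ := by
          rw [pow_two (star c * c)]; simp only [mul_assoc]; module

/-- Under `ξ = -q⁻¹ u₁₂ u₂₁`, `η = u₁₁ u₂₁` the coaction becomes the comultiplication. -/
theorem IsSUq2.act_eq [StarModule ℂ B] [NeZero q] {u v : Matrix (Fin 2) (Fin 2) B}
    (hu : IsSUq2 q u) (hc : ∀ i j k l, Commute (u i j) (v k l)) :
    actXi q (-(q : ℂ)⁻¹ • (u 0 1 * u 1 0)) (u 0 0 * u 1 0) v =
      -(q : ℂ)⁻¹ • ((u * v) 0 1 * (u * v) 1 0) ∧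
    actEta q (-(q : ℂ)⁻¹ • (u 0 1 * u 1 0)) (u 0 0 * u 1 0) v = (u * v) 0 0 * (u * v) 1 0 := by
  have hq : (q : ℂ) ≠ 0 := by exact_mod_cast NeZero.ne q
  obtain ⟨hd, hb, -⟩ := hu.facts
  have e1 : 1 - ((q : ℂ) ^ 2) • (-(q : ℂ)⁻¹ • (u 0 1 * u 1 0)) = u 0 0 * u 1 1 := by
    rw [sub_eq_iff_eq_add.1 hu.det01, smul_smul,
      show (q : ℂ) ^ 2 * -(q : ℂ)⁻¹ = -q by field_simp]
    module
  have e2 : ∀ z, (q : ℂ) • (-(q : ℂ)⁻¹ • (u 0 1 * u 1 0) * z) = -(u 0 1 * u 1 0 * z) := by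
    intro z
    rw [smul_mul_assoc, smul_smul, mul_neg, mul_inv_cancel₀ hq, neg_smul, one_smul]
  have e3 : ∀ z, (q : ℂ) • (star (u 0 0 * u 1 0) * z) = -(u 0 1 * u 1 1 * z) := by
    intro z
    rw [hb, hd]
    simp only [star_mul, smul_mul_assoc, neg_smul, neg_neg, neg_mul, mul_assoc]
  have hm : ∀ i j k l m n o p, u i j * u k l * (v m n * v o p) =
      u i j * v m n * (u k l * v o p) := by
    intro i j k l m n o p
    rw [mul_assoc, ← mul_assoc (u k l), (hc k l m n).eq]
    simp only [mul_assoc]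
  constructor
  · rw [actXi, e1, e2, e3]
    simp only [hm, Matrix.mul_apply, Fin.sum_univ_two, mul_add, add_mul]
    module
  · rw [actEta, e1, e2, e3]
    simp only [hm, Matrix.mul_apply, Fin.sum_univ_two, mul_add, add_mul]
    module

end Relations

/-- The entries of a unitary matrix are contractions. -/
theorem IsSUq2.norm_le {q : ℝ} {u : Matrix (Fin 2) (Fin 2) BddOp} (h : IsSUq2 q u) (i j : Fin 2) :
    ‖u i j‖ ≤ 1 := by
  let _ : PartialOrder BddOp := CStarAlgebra.spectralOrder _
  have _ : StarOrderedRing BddOp := CStarAlgebra.spectralOrderedRing _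
  have h1 : ∑ k, star (u k j) * u k j = 1 := by
    simpa [Matrix.mul_apply] using congrFun (congrFun h.unitary_left j) j
  have h2 : star (u i j) * u i j ≤ 1 := by
    rw [← h1]
    exact Finset.single_le_sum (f := fun k => star (u k j) * u k j)
      (fun k _ => star_mul_self_nonneg _) (Finset.mem_univ i)
  have h3 := CStarAlgebra.norm_le_norm_of_nonneg_of_le (star_mul_self_nonneg _) h2
  rw [CStarRing.norm_star_mul_self] at h3
  have h4 : ‖(1 : BddOp)‖ ≤ 1 := by
    rcases subsingleton_or_nontrivial BddOp with h | h
    · rw [Subsingleton.elim (1 : BddOp) 0, norm_zero]; exact zero_le_one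
    · exact CStarRing.norm_one.le
  nlinarith [norm_nonneg (u i j)]

theorem IsPodles.norm_le {q : ℝ} {ξ η : BddOp} (h : IsPodles q ξ η) : ‖ξ‖ ≤ 1 ∧ ‖η‖ ≤ 1 := by
  let _ : PartialOrder BddOp := CStarAlgebra.spectralOrder _
  have _ : StarOrderedRing BddOp := CStarAlgebra.spectralOrderedRing _
  have h1 : (0 : BddOp) ≤ star ξ * ξ := star_mul_self_nonneg _
  have h2 : (0 : BddOp) ≤ star η * η := star_mul_self_nonneg _
  have h3 : ξ = star ξ * ξ + star η * η := by rw [h.star_eta_mul, h.star_xi, pow_two]; abel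
  have h4 : star ξ * ξ ≤ ξ := (le_add_of_nonneg_right h2).trans_eq h3.symm
  have h5 : star η * η ≤ ξ := (le_add_of_nonneg_left h1).trans_eq h3.symm
  have h6 := CStarAlgebra.norm_le_norm_of_nonneg_of_le h1 h4
  have h7 := CStarAlgebra.norm_le_norm_of_nonneg_of_le h2 h5
  rw [CStarRing.norm_star_mul_self] at h6 h7
  have h8 : ‖ξ‖ ≤ 1 := by nlinarith [norm_nonneg ξ]
  exact ⟨h8, by nlinarith [norm_nonneg η]⟩

open Presentation

section Algebras

variable (q : ℝ)

/-- Generators and relations of `C(SU_q(2))`. -/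
def suq2 : Presentation (Fin 2 × Fin 2) where
  reps := {x | IsSUq2 q (Matrix.of fun i j => x (i, j))}
  norm_le _ hx i := IsSUq2.norm_le hx i.1 i.2

/-- Generators and relations of `C(S²_{q0})`; the generators are `ξ` (index `0`) and `η`
(index `1`). -/
def sphere : Presentation (Fin 2) where
  reps := {x | IsPodles q (x 0) (x 1)}
  norm_le x hx i := by
    fin_cases i
    exacts [(IsPodles.norm_le hx).1, (IsPodles.norm_le hx).2]

/-- The C⋆-algebra `C(SU_q(2))`. -/
abbrev CG : Type := (suq2 q).CStar

/-- The C⋆-algebra `C(S²_{q0})`. -/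
abbrev CS : Type := (sphere q).CStar

/-- `C(SU_q(2)) ⊗ C(SU_q(2))`. -/
abbrev CGG : Type := ((suq2 q).tensor (suq2 q)).CStar

/-- `C(S²_{q0}) ⊗ C(SU_q(2))`. -/
abbrev CSG : Type := ((sphere q).tensor (suq2 q)).CStar

/-- The fundamental unitary of `SU_q(2)`. -/
def u : Matrix (Fin 2) (Fin 2) (CG q) := Matrix.of fun i j => (suq2 q).gen (i, j)

/-- The generator `ξ` of `C(S²_{q0})`. -/
def xi : CS q := (sphere q).gen 0

/-- The generator `η` of `C(S²_{q0})`. -/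
def eta : CS q := (sphere q).gen 1

variable [NeZero q]

/-- The comultiplication, `Δ(uᵢⱼ) = ∑ₖ uᵢₖ ⊗ uₖⱼ`. -/
def Δ : CG q →⋆ₐ[ℂ] CGG q :=
  lift (suq2 q) ((suq2 q).tensor (suq2 q))
    (fun ij => ∑ k, inl (suq2 q) (suq2 q) (u q ij.1 k) * inr (suq2 q) (suq2 q) (u q k ij.2))
    (fun x => ⟨fun ij => ((Matrix.of fun i j => x.1 (Sum.inl (i, j))) *
        (Matrix.of fun i j => x.1 (Sum.inr (i, j)))) ij.1 ij.2,
      IsSUq2.mul x.2.1 x.2.2.1 (fun i j k l => (x.2.2.2 (i, j) (k, l)).1)⟩)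
    (by
      intro i x
      simp only [Fin.sum_univ_two, Matrix.mul_apply]
      rfl)

/-- The isomorphism of `C(S²_{q0})` with `C(SU_q(2)\𝕋) ⊆ C(SU_q(2))`,
`ψ(ξ) = -q⁻¹ u₁₂ u₂₁` and `ψ(η) = u₁₁ u₂₁`. -/
def ψ : CS q →⋆ₐ[ℂ] CG q :=
  lift (sphere q) (suq2 q) ![-(q : ℂ)⁻¹ • (u q 0 1 * u q 1 0), u q 0 0 * u q 1 0]
    (fun x => ⟨![-(q : ℂ)⁻¹ • (x.1 (0, 1) * x.1 (1, 0)), x.1 (0, 0) * x.1 (1, 0)],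
      IsSUq2.isPodles (u := Matrix.of fun i j => x.1 (i, j)) x.2⟩)
    (by
      intro i x
      fin_cases i <;> rfl)

/-- The action of `SU_q(2)` on the sphere, defined on generators by
`τ(ξ) = actXi (ξ ⊗ 1) (η ⊗ 1) (1 ⊗ u)` and `τ(η) = actEta (ξ ⊗ 1) (η ⊗ 1) (1 ⊗ u)`. -/
def τ : CS q →⋆ₐ[ℂ] CSG q :=
  lift (sphere q) ((sphere q).tensor (suq2 q))
    ![actXi q (inl _ _ (xi q)) (inl _ _ (eta q)) ((u q).map (inr (sphere q) (suq2 q))),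
      actEta q (inl _ _ (xi q)) (inl _ _ (eta q)) ((u q).map (inr (sphere q) (suq2 q)))]
    (fun x => ⟨![actXi q (x.1 (Sum.inl 0)) (x.1 (Sum.inl 1))
          (Matrix.of fun i j => x.1 (Sum.inr (i, j))),
        actEta q (x.1 (Sum.inl 0)) (x.1 (Sum.inl 1))
          (Matrix.of fun i j => x.1 (Sum.inr (i, j)))],
      IsPodles.act x.2.1 x.2.2.1 (fun i j => ⟨(x.2.2.2 0 (i, j)).1, (x.2.2.2 1 (i, j)).1, by
        simpa using (x.2.2.2 1 (i, j)).2.star_star⟩)⟩)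
    (by
      intro i x
      fin_cases i <;> rfl)

/-- `ψ ⊗ id`. -/
def ψid : CSG q →⋆ₐ[ℂ] CGG q :=
  lift ((sphere q).tensor (suq2 q)) ((suq2 q).tensor (suq2 q))
    (Sum.elim (fun i => inl _ _ (ψ q ((sphere q).gen i))) (fun j => inr _ _ ((suq2 q).gen j)))
    (fun x => ⟨Sum.elim ![-(q : ℂ)⁻¹ • (x.1 (Sum.inl (0, 1)) * x.1 (Sum.inl (1, 0))),
          x.1 (Sum.inl (0, 0)) * x.1 (Sum.inl (1, 0))] (fun j => x.1 (Sum.inr j)),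
      IsSUq2.isPodles (u := Matrix.of fun i j => x.1 (Sum.inl (i, j))) x.2.1, x.2.2.1, by
        intro i j
        have h := fun k => x.2.2.2 k j
        fin_cases i
        · exact ⟨((h (0, 1)).1.mul_left (h (1, 0)).1).smul_left _,
            ((h (0, 1)).2.mul_left (h (1, 0)).2).smul_left _⟩
        · exact ⟨(h (0, 0)).1.mul_left (h (1, 0)).1, (h (0, 0)).2.mul_left (h (1, 0)).2⟩⟩)
    (by
      rintro (i | j) x
      · fin_cases i <;> rfl
      · rfl)

/-- The square defining the action commutes: `(ψ ⊗ id) ∘ τ = Δ ∘ ψ`. -/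
theorem ψid_comp_τ (a : CS q) : ψid q (τ q a) = Δ q (ψ q a) := by
  apply Subtype.ext
  ext1 x
  refine congrArg a.1 (Subtype.ext (funext fun i => ?_))
  have h := IsSUq2.act_eq (q := q) (u := Matrix.of fun i j => x.1 (Sum.inl (i, j)))
    (v := Matrix.of fun i j => x.1 (Sum.inr (i, j))) x.2.1
    (fun i j k l => (x.2.2.2 (i, j) (k, l)).1)
  fin_cases i
  · exact h.1
  · exact h.2

/-- An irreducible unitary representation of `SU_q(2)` on `ℂⁿ`, as a matrix over `C(SU_q(2))`. -/
structure IsIrreducibleRep {n : ℕ} (v : Matrix (Fin n) (Fin n) (CG q)) : Prop where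
  unitary_left : vᴴ * v = 1
  unitary_right : v * vᴴ = 1
  comul : ∀ i j, Δ q (v i j) = ∑ k, inl _ _ (v i k) * inr _ _ (v k j)
  irreducible : ∀ T : Matrix (Fin n) (Fin n) ℂ,
    T.map (algebraMap ℂ (CG q)) * v = v * T.map (algebraMap ℂ (CG q)) →
      ∃ c : ℂ, T = c • (1 : Matrix (Fin n) (Fin n) ℂ)

/-- The `⋆`-algebra `A(SU_q(2))` generated by the matrix entries of the irreducible unitary
representations. -/
def polyAlg : StarSubalgebra ℂ (CG q) :=
  StarAlgebra.adjoin ℂ {g | ∃ (n : ℕ) (v : Matrix (Fin n) (Fin n) (CG q)) (i j : Fin n),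
    IsIrreducibleRep q v ∧ g = v i j}

/-- The dense `⋆`-subalgebra `𝒜 = {a : τ(a) ∈ C(S²_{q0}) ⊗_alg A(SU_q(2))}`. -/
def smoothAlg : Set (CS q) :=
  {a | τ q a ∈ Submodule.span ℂ
    {t | ∃ (b : CS q) (g : CG q), g ∈ polyAlg q ∧ t = inl _ _ b * inr _ _ g}}

variable {q}

/-- `ρ` is a state of `C(S²_{q0})` with `(ρ ⊗ id) τ(a) = ρ(a) 1`; here `S` is the slice map
`ρ ⊗ id`. -/
def IsInvariantState (ρ : CS q →ₚ[ℂ] ℂ) : Prop :=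
  ρ 1 = 1 ∧ ∃ S : CSG q →L[ℂ] CG q,
    (∀ (a : CS q) (g : CG q), S (inl _ _ a * inr _ _ g) = ρ a • g) ∧
    ∀ a : CS q, S (τ q a) = ρ a • (1 : CG q)

/-- The canonical map of `C(S²_{q0})` to the GNS space of `ρ`. -/
def gnsVec (ρ : CS q →ₚ[ℂ] ℂ) (a : CS q) : ρ.GNS := ((ρ.toPreGNS a : ρ.PreGNS) : ρ.GNS)

/-- The operators `(id ⊗ ω)(u_τ)`, `ω ∈ C(SU_q(2))*`, where `u_τ` is the unitary representation of
`SU_q(2)` on the GNS space that is induced by `τ`. Explicitly `(id ⊗ ω)(u_τ)` maps the vector of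
`a` to the vector of `(id ⊗ ω) τ(a)`; here `S` is the slice map `id ⊗ ω`. -/
def sliceOps (ρ : CS q →ₚ[ℂ] ℂ) : Set (ρ.GNS →L[ℂ] ρ.GNS) :=
  {U | ∃ (ω : CG q →L[ℂ] ℂ) (S : CSG q →L[ℂ] CS q),
    (∀ (a : CS q) (g : CG q), S (inl _ _ a * inr _ _ g) = ω g • a) ∧
    ∀ a : CS q, U (gnsVec ρ a) = gnsVec ρ (S (τ q a))}

/-- A subspace of the GNS space that is invariant under `u_τ`. -/
def IsInvariantSubspace (ρ : CS q →ₚ[ℂ] ℂ) (V : Submodule ℂ ρ.GNS) : Prop :=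
  ∀ U ∈ sliceOps ρ, ∀ x ∈ V, U x ∈ V

/-- An invariant subspace on which `u_τ` restricts to an irreducible representation. -/
def IsIrreducibleSubspace (ρ : CS q →ₚ[ℂ] ℂ) (V : Submodule ℂ ρ.GNS) : Prop :=
  IsInvariantSubspace ρ V ∧ V ≠ ⊥ ∧
    ∀ W : Submodule ℂ ρ.GNS, W ≤ V → IsInvariantSubspace ρ W → W = ⊥ ∨ W = V

/-- The spin-`k` block, i.e. the isotypic component of the irreducible representation of dimension
`2k+1` (which is unique up to equivalence). -/
def spinBlock (ρ : CS q →ₚ[ℂ] ℂ) (k : ℕ) : Submodule ℂ ρ.GNS :=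
  sSup {V | IsIrreducibleSubspace ρ V ∧ Module.finrank ℂ V = 2 * k + 1}

/-- `D` is selfadjoint and multiplies the spin-`k` block by `d k`. -/
def IsBlockScalar (ρ : CS q →ₚ[ℂ] ℂ) (d : ℕ → ℝ) (D : ρ.GNS →ₗ.[ℂ] ρ.GNS) : Prop :=
  IsSelfAdjoint D ∧ ∀ k, ∀ x ∈ spinBlock ρ k, ∃ h : x ∈ D.domain, D ⟨x, h⟩ = (d k : ℂ) • x

/-- `D ⊗ 1` commutes with `u_τ`. -/
def IsEquivariant (ρ : CS q →ₚ[ℂ] ℂ) (D : ρ.GNS →ₗ.[ℂ] ρ.GNS) : Prop :=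
  ∀ U ∈ sliceOps ρ, CommutesWith D U

/-- `(H_ρ, π_ρ, D)` is an equivariant spectral triple for `𝒜`. -/
def IsEquivariantSpectralTriple (ρ : CS q →ₚ[ℂ] ℂ) (D : ρ.GNS →ₗ.[ℂ] ρ.GNS) : Prop :=
  IsSpectralTriple (ρ.gnsStarAlgHom '' smoothAlg q) D ∧ IsEquivariant ρ D

variable (q) in
/-- The spectral dimension of the system `(C(S²_{q0}), SU_q(2), τ)`: the infimum (`∞` if there are
none) of all `p > 0` such that there is a `p`-summable equivariant spectral triple on the GNS space
of the (unique) invariant state. -/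
def spectralDimension : ℝ≥0∞ :=
  sInf {s | ∃ p : ℝ, 0 < p ∧ s = ENNReal.ofReal p ∧ ∃ ρ : CS q →ₚ[ℂ] ℂ, IsInvariantState ρ ∧
    ∃ D : ρ.GNS →ₗ.[ℂ] ρ.GNS, IsEquivariantSpectralTriple ρ D ∧ IsPSummable D p}

end Algebras
end Podles

end

/-! Write a = u₁₁, c = u₂₁, ζ = 1 - (1 + q²)ξ and let h be the Haar state. The theorem is reduced to
one explicit orthogonal family of vectors and two estimates of norm ratios.

The Haar state. The elements a and c act by weighted shifts on ℓ²(ℕ × ℤ × ℤ), and h is a vector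
state with h(x) = (1 - q²) ∑ q²ⁿ xₙₙ. Since ξ acts by q²ⁿ, this is a trace weighted by ξ. Hence
h(yx) = q² h(xy) for y = a* and y = η* (`Raises.haar_mul_comm`), and h(z) = 0 whenever zξ is a
commutator with η* (`haar_eq_zero_of_mul_xi`). Each point of the index set carries a copy of ℓ²(ℕ),
on which a commuting representation can act; compression to the vacuum then gives slice maps on the
maximal tensor product (`leftSlice`) with no appeal to nuclearity.

The spin basis. The elements `sph k l` are the coefficients in τ(ηᵏ) = ∑ sph k l ⊗ cˡ a²ᵏ⁻ˡ, 0 ≤ l ≤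
2k (`τ_eta_pow`). By coassociativity they span a subcomodule with matrix `tc (2k)` (`Δ_ψ_sph`). A
highest weight slice shows that they are independent, and a count shows that they span the
polynomials. The identity `sph_commutator` writes sph k (l+1) · ξ as a multiple of [η*, sph k l], so
h kills every spin k > 0. This makes h ∘ ψ invariant, while slicing τ(ηᵏ) shows that any invariant
state has the same values. Invariance applied to (ηᵏ)*ηˡ, with the linear independence of the
products (cⁱaᵖ)*cʲaʳ of one bidegree, makes all `sph k l` orthogonal (`haar_star_sph_mul_of_ne`).
Normalized, they are an orthonormal basis of the GNS space.

Rank one slices. By the counit, ψ(sph k i) is a multiple of the middle row entry tc (2k) k i. The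
slice of u_τ along it is x ↦ const · ⟪sph k i, x⟫ sph k k (`exists_sliceOp_ψ_sph`). These operators
of rank one show that every irreducible subspace is a block, that an equivariant selfadjoint D is
scalar on each block, and that an element of 𝒜 has only finitely many spins.

Commutators. Multiplication by a spin-one element changes the spin by at most one, so [D_d, T]
consists of the blocks of T between H_k and H_{k+1}, times ±(d(k+1) - d(k)). The slice `highSlice k`
detects exactly the spin-k component (`norm_highSlice_sq`) and is multiplicative up to the ratio of
the squared norms of ηᵏ⁺¹ and ηᵏ (`highSlice_sph_mul`). That ratio is at most q²⁽ᵏ⁺²⁾, whence the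
blocks have norm O(|q|ᵏ) and the growth condition suffices. Conversely η · ηᵏ = ηᵏ⁺¹, with the ratio
bounded below by a multiple of q²⁽ᵏ⁺²⁾, makes the condition necessary. An element of 𝒜 has the same
GNS vector as a polynomial, and by the modular relation a vanishing GNS vector gives a vanishing
operator, so 𝒜 adds nothing to the polynomials. For d(k) = q⁻ᵏ the eigenvalues have multiplicity
2k+1, and ∑ (2k+1)|q|ᵖᵏ converges for all p > 0. -/

noncomputable section
namespace Podles

/-! ### Universal C⋆-algebras: density of the generated algebra and of elementary tensors. -/

namespace Presentation

variable {ι κ : Type}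

/-- Evaluation of the elements of the universal C⋆-algebra in a representation. -/
def evalHom (P : Presentation ι) (x : P.reps) : P.CStar →⋆ₐ[ℂ] BddOp where
  toFun a := a.1 x
  map_one' := rfl
  map_mul' _ _ := rfl
  map_zero' := rfl
  map_add' _ _ := rfl
  commutes' _ := rfl
  map_star' _ := rfl

theorem ext_evalHom {P : Presentation ι} {a b : P.CStar} (h : ∀ x, P.evalHom x a = P.evalHom x b) :
    a = b :=
  Subtype.ext (BoundedContinuousFunction.ext h)

theorem adjoin_gen_topologicalClosure (P : Presentation ι) :
    (StarAlgebra.adjoin ℂ (Set.range P.gen)).topologicalClosure = ⊤ := by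
  rw [eq_top_iff]
  rintro a -
  have ha : (a.1 : P.reps →ᵇ BddOp) ∈
      closure (StarAlgebra.adjoin ℂ (Set.range P.genFun) : Set (P.reps →ᵇ BddOp)) := a.2
  have hle : StarAlgebra.adjoin ℂ (Set.range P.genFun) ≤
      (StarAlgebra.adjoin ℂ (Set.range P.gen)).map (P.alg.subtype : P.CStar →⋆ₐ[ℂ] _) := by
    refine StarAlgebra.adjoin_le ?_
    rintro _ ⟨i, rfl⟩
    exact ⟨P.gen i, StarAlgebra.subset_adjoin ℂ _ ⟨i, rfl⟩, rfl⟩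
  have hb := closure_mono (SetLike.coe_subset_coe.2 hle) ha
  change a ∈ closure (StarAlgebra.adjoin ℂ (Set.range P.gen) : Set P.CStar)
  have he : Topology.IsInducing (Subtype.val : P.alg → (P.reps →ᵇ BddOp)) := ⟨rfl⟩
  have := (he.closure_eq_preimage_closure_image
    (StarAlgebra.adjoin ℂ (Set.range P.gen) : Set P.CStar))
  change a ∈ closure (X := P.alg) _
  rw [this]
  exact hb

/-- A closed star subalgebra that contains the generators is everything. -/
theorem mem_of_gen_mem {P : Presentation ι} (S : StarSubalgebra ℂ P.CStar)
    (hS : IsClosed (S : Set P.CStar)) (h : ∀ i, P.gen i ∈ S) (a : P.CStar) : a ∈ S := by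
  have h1 : (StarAlgebra.adjoin ℂ (Set.range P.gen)).topologicalClosure ≤ S := by
    refine StarSubalgebra.topologicalClosure_minimal (StarAlgebra.adjoin_le ?_) hS
    rintro _ ⟨i, rfl⟩
    exact h i
  rw [adjoin_gen_topologicalClosure] at h1
  exact h1 trivial

theorem continuous_starAlgHom {A B : Type} [CStarAlgebra A] [CStarAlgebra B] (f : A →⋆ₐ[ℂ] B) :
    Continuous f :=
  AddMonoidHomClass.continuous_of_bound f 1 fun a => by
    rw [one_mul]; exact NonUnitalStarAlgHom.norm_apply_le f a

theorem inl_gen (P : Presentation ι) (Q : Presentation κ) (i : ι) :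
    inl P Q (P.gen i) = (P.tensor Q).gen (Sum.inl i) := lift_gen _ _ _ _ _ i

theorem inr_gen (P : Presentation ι) (Q : Presentation κ) (j : κ) :
    inr P Q (Q.gen j) = (P.tensor Q).gen (Sum.inr j) := lift_gen _ _ _ _ _ j

theorem hom_ext {P : Presentation ι} {B : Type} [CStarAlgebra B] {f g : P.CStar →⋆ₐ[ℂ] B}
    (h : ∀ i, f (P.gen i) = g (P.gen i)) (a : P.CStar) : f a = g a := by
  refine mem_of_gen_mem (StarAlgHom.equalizer f g) ?_ h a
  exact isClosed_eq (continuous_starAlgHom f) (continuous_starAlgHom g)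

/-- An operator that commutes with the generators of a representation and with their adjoints
commutes with the whole image. -/
theorem commute_of_gen {P : Presentation ι} {B : Type} [CStarAlgebra B] (f : P.CStar →⋆ₐ[ℂ] B) {Z : B}
    (h : ∀ i, Commute Z (f (P.gen i)) ∧ Commute Z (star (f (P.gen i)))) (a : P.CStar) :
    Commute Z (f a) := by
  have := mem_of_gen_mem ((StarSubalgebra.centralizer ℂ {Z}).comap f) ?_ ?_ a
  · rw [StarSubalgebra.mem_comap, StarSubalgebra.mem_centralizer_iff] at this
    exact (this Z rfl).1
  · exact (Set.isClosed_centralizer _).preimage (continuous_starAlgHom f)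
  · intro i
    rw [StarSubalgebra.mem_comap, StarSubalgebra.mem_centralizer_iff]
    rintro _ rfl
    refine ⟨(h i).1, ?_⟩
    have := congrArg star (h i).2.eq
    simpa using this.symm

theorem evalHom_map {P : Presentation ι} (Φ : BddOp →⋆ₐ[ℂ] BddOp) (x y : P.reps)
    (hy : ∀ i, y.1 i = Φ (x.1 i)) (a : P.CStar) : P.evalHom y a = Φ (P.evalHom x a) :=
  hom_ext (f := P.evalHom y) (g := Φ.comp (P.evalHom x)) hy a

theorem commute_inl_inr (P : Presentation ι) (Q : Presentation κ) (a : P.CStar) (b : Q.CStar) :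
    Commute (inl P Q a) (inr P Q b) := by
  have key : ∀ (a : P.CStar) j, Commute ((P.tensor Q).gen (Sum.inr j)) (inl P Q a) := by
    intro a j
    refine commute_of_gen (inl P Q) (fun i => ⟨?_, ?_⟩) a
    · rw [inl_gen]
      refine ext_evalHom fun x => ?_
      exact (x.2.2.2 i j).1.symm.eq
    · rw [inl_gen]
      refine ext_evalHom fun x => ?_
      have := (x.2.2.2 i j).2.star_star.symm.eq
      rw [star_star] at this
      exact this
  refine commute_of_gen (inr P Q) (fun j => ?_) b
  rw [inr_gen]
  refine ⟨(key a j).symm, ?_⟩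
  have := (key (star a) j).symm.star_star
  rwa [map_star, star_star] at this

/-- The algebraic tensor product, as a subspace of the C⋆-tensor product. -/
def algTensor (P : Presentation ι) (Q : Presentation κ) : Submodule ℂ (P.tensor Q).CStar :=
  Submodule.span ℂ {t | ∃ a b, t = inl P Q a * inr P Q b}

theorem tmul_mem_algTensor {P : Presentation ι} {Q : Presentation κ} (a : P.CStar) (b : Q.CStar) :
    inl P Q a * inr P Q b ∈ algTensor P Q := Submodule.subset_span ⟨a, b, rfl⟩

theorem tmul_mul_tmul {P : Presentation ι} {Q : Presentation κ} (a a' : P.CStar) (b b' : Q.CStar) :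
    inl P Q a * inr P Q b * (inl P Q a' * inr P Q b') = inl P Q (a * a') * inr P Q (b * b') := by
  rw [map_mul, map_mul, mul_assoc, ← mul_assoc (inr P Q b), ← (commute_inl_inr P Q a' b).eq]
  simp only [mul_assoc]

theorem star_tmul {P : Presentation ι} {Q : Presentation κ} (a : P.CStar) (b : Q.CStar) :
    star (inl P Q a * inr P Q b) = inl P Q (star a) * inr P Q (star b) := by
  rw [star_mul, ← map_star, ← map_star, (commute_inl_inr P Q _ _).eq]

theorem dense_algTensor (P : Presentation ι) (Q : Presentation κ) :
    Dense (algTensor P Q : Set (P.tensor Q).CStar) := by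
  let S : StarSubalgebra ℂ (P.tensor Q).CStar :=
    { carrier := algTensor P Q
      zero_mem' := zero_mem _
      add_mem' := add_mem
      mul_mem' := by
        intro s t hs ht
        refine Submodule.span_induction (p := fun s _ => s * t ∈ algTensor P Q) ?_ ?_ ?_ ?_ hs
        · rintro _ ⟨a, b, rfl⟩
          refine Submodule.span_induction
            (p := fun t _ => inl P Q a * inr P Q b * t ∈ algTensor P Q) ?_ ?_ ?_ ?_ ht
          · rintro _ ⟨a', b', rfl⟩
            rw [tmul_mul_tmul]; exact tmul_mem_algTensor _ _
          · rw [mul_zero]; exact zero_mem _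
          · intro x y _ _ hx hy; rw [mul_add]; exact add_mem hx hy
          · intro c x _ hx; rw [mul_smul_comm]; exact Submodule.smul_mem _ _ hx
        · rw [zero_mul]; exact zero_mem _
        · intro x y _ _ hx hy; rw [add_mul]; exact add_mem hx hy
        · intro c x _ hx; rw [smul_mul_assoc]; exact Submodule.smul_mem _ _ hx
      one_mem' := by
        have := tmul_mem_algTensor (1 : P.CStar) (1 : Q.CStar)
        rw [map_one, map_one, mul_one] at this
        exact this
      algebraMap_mem' := by
        intro c
        have := Submodule.smul_mem _ c (tmul_mem_algTensor (1 : P.CStar) (1 : Q.CStar))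
        rw [map_one, map_one, mul_one] at this
        rw [Algebra.algebraMap_eq_smul_one]
        exact this
      star_mem' := by
        intro s hs
        refine Submodule.span_induction (p := fun s _ => star s ∈ algTensor P Q) ?_ ?_ ?_ ?_ hs
        · rintro _ ⟨a, b, rfl⟩
          rw [star_tmul]; exact tmul_mem_algTensor _ _
        · rw [star_zero]; exact zero_mem _
        · intro x y _ _ hx hy; rw [star_add]; exact add_mem hx hy
        · intro c x _ hx; rw [star_smul]; exact Submodule.smul_mem _ _ hx }
  intro t
  refine mem_of_gen_mem S.topologicalClosure (StarSubalgebra.isClosed_topologicalClosure _) ?_ t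
  rintro (i | j)
  · refine StarSubalgebra.le_topologicalClosure _ ?_
    have := tmul_mem_algTensor (Q := Q) (P.gen i) 1
    rw [map_one, mul_one, inl_gen] at this
    exact this
  · refine StarSubalgebra.le_topologicalClosure _ ?_
    have := tmul_mem_algTensor (P := P) 1 (Q.gen j)
    rw [map_one, one_mul, inr_gen] at this
    exact this

/-- Continuous maps that are additive and homogeneous are determined by elementary tensors. -/
theorem tensor_clm_ext {P : Presentation ι} {Q : Presentation κ} {E : Type} [NormedAddCommGroup E]
    [NormedSpace ℂ E] {f g : (P.tensor Q).CStar →L[ℂ] E}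
    (h : ∀ a b, f (inl P Q a * inr P Q b) = g (inl P Q a * inr P Q b)) (t : (P.tensor Q).CStar) :
    f t = g t := by
  have : f = g := by
    refine ContinuousLinearMap.ext_on (s := {t | ∃ a b, t = inl P Q a * inr P Q b})
      (dense_algTensor P Q) ?_
    rintro _ ⟨a, b, rfl⟩
    exact h a b
  rw [this]

end Presentation

theorem IsSUq2.map {q : ℝ} {B C : Type} [Ring B] [StarRing B] [Algebra ℂ B] [Ring C] [StarRing C]
    [Algebra ℂ C] {u : Matrix (Fin 2) (Fin 2) B} (h : IsSUq2 q u) (f : B →⋆ₐ[ℂ] C) :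
    IsSUq2 q (u.map f) := by
  have hs : (u.map f)ᴴ = (uᴴ).map f := by
    ext i j; simp [Matrix.conjTranspose_apply, map_star]
  have hm : ∀ x y : Matrix (Fin 2) (Fin 2) B, x.map f * y.map f = (x * y).map f :=
    fun x y => (Matrix.map_mul (f := (f : B →+* C))).symm
  have h1 : (1 : Matrix (Fin 2) (Fin 2) B).map f = 1 :=
    Matrix.map_one _ (map_zero f) (map_one f)
  refine ⟨?_, ?_, ?_, ?_, ?_, ?_⟩
  · rw [hs, hm, h.unitary_left, h1]
  · rw [hs, hm, h.unitary_right, h1]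
  all_goals simp only [Matrix.map_apply, ← map_mul, ← map_smul, ← map_sub]
  · rw [h.det01, map_one]
  · rw [h.det10, map_smul, map_one]
  · rw [h.det00, map_zero]
  · rw [h.det11, map_zero]

theorem IsPodles.map {q : ℝ} {B C : Type} [Ring B] [StarRing B] [Algebra ℂ B] [Ring C] [StarRing C]
    [Algebra ℂ C] {ξ η : B} (h : IsPodles q ξ η) (f : B →⋆ₐ[ℂ] C) : IsPodles q (f ξ) (f η) := by
  refine ⟨?_, ?_, ?_, ?_⟩
  · rw [← map_star, h.star_xi]
  · rw [← map_star, ← map_mul, h.star_eta_mul, map_sub, map_pow]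
  · rw [← map_mul, h.eta_xi, map_smul, map_mul]
  · rw [← map_star, ← map_mul, h.eta_mul_star, map_sub, map_smul, map_smul, map_pow]

/-! ### Operators on `ℓ²`-sums of copies of a Hilbert space -/

section WeightedShifts

variable {J : Type} {E : Type} [NormedAddCommGroup E] [InnerProductSpace ℂ E]

/-- A partial injection `shift` of the index set (with inverse `back`) with weights. -/
structure WeightedShift (J : Type) where
  shift : J → J
  back : J → J
  weight : J → ℝ
  backWeight : J → ℝ
  weight_le : ∀ j, |weight j| ≤ 1
  backWeight_le : ∀ j, |backWeight j| ≤ 1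
  back_shift : ∀ j, weight j ≠ 0 → back (shift j) = j ∧ backWeight (shift j) = weight j
  shift_back : ∀ j, backWeight j ≠ 0 → shift (back j) = j ∧ weight (back j) = backWeight j

namespace WeightedShift

/-- The inverse weighted shift. -/
def symm (W : WeightedShift J) : WeightedShift J where
  shift := W.back
  back := W.shift
  weight := W.backWeight
  backWeight := W.weight
  weight_le := W.backWeight_le
  backWeight_le := W.weight_le
  back_shift := W.shift_back
  shift_back := W.back_shift

/-- Where the weight is nonzero, `back` inverts `shift`, so `shift` is injective on the terms that
contribute and no value of f is counted twice. -/
theorem sum_le (W : WeightedShift J) (f : lp (fun _ : J => E) 2) (s : Finset J) :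
    ∑ j ∈ s, ‖(W.weight j : ℂ) • f (W.shift j)‖ ^ (2 : ℝ≥0∞).toReal ≤
      ‖f‖ ^ (2 : ℝ≥0∞).toReal := by
  classical
  have h2 : (0 : ℝ) < (2 : ℝ≥0∞).toReal := by norm_num
  rw [← Finset.sum_filter_add_sum_filter_not s (fun j => W.weight j ≠ 0)]
  rw [Finset.sum_eq_zero (s := s.filter fun j => ¬ W.weight j ≠ 0), add_zero]
  · calc _ ≤ ∑ j ∈ s.filter (fun j => W.weight j ≠ 0), ‖f (W.shift j)‖ ^ (2 : ℝ≥0∞).toReal := by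
          refine Finset.sum_le_sum fun j _ => Real.rpow_le_rpow (norm_nonneg _) ?_ h2.le
          rw [norm_smul, Complex.norm_real, Real.norm_eq_abs]
          exact mul_le_of_le_one_left (norm_nonneg _) (W.weight_le j)
      _ = ∑ i ∈ (s.filter (fun j => W.weight j ≠ 0)).image W.shift,
            ‖f i‖ ^ (2 : ℝ≥0∞).toReal := by
          rw [Finset.sum_image]
          intro i hi j hj hij
          have hi' := (W.back_shift i (Finset.mem_filter.1 hi).2).1
          have hj' := (W.back_shift j (Finset.mem_filter.1 hj).2).1
          rw [← hi', ← hj', hij]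
      _ ≤ _ := lp.sum_rpow_le_norm_rpow h2 f _
  · intro j hj
    rw [not_not.1 (Finset.mem_filter.1 hj).2]
    simp

/-- The operator `(W f)ⱼ = wⱼ f (shift j)`. -/
def op (W : WeightedShift J) : lp (fun _ : J => E) 2 →L[ℂ] lp (fun _ : J => E) 2 :=
  LinearMap.mkContinuous
    { toFun := fun f => (⟨fun j => (W.weight j : ℂ) • f (W.shift j), memℓp_gen' (W.sum_le f)⟩ :
        lp (fun _ : J => E) 2)
      map_add' := fun f g => by
        ext j; exact smul_add _ (f (W.shift j)) (g (W.shift j))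
      map_smul' := fun c f => by
        ext j; exact smul_comm _ _ _ } 1
    (fun f => by
      rw [one_mul]
      exact lp.norm_le_of_forall_sum_le (by norm_num) (norm_nonneg _) (W.sum_le f))

@[simp] theorem op_apply (W : WeightedShift J) (f : lp (fun _ : J => E) 2) (j : J) :
    W.op f j = (W.weight j : ℂ) • f (W.shift j) := rfl

variable [CompleteSpace E]

theorem star_op (W : WeightedShift J) :
    star (W.op : lp (fun _ : J => E) 2 →L[ℂ] lp (fun _ : J => E) 2) = W.symm.op := by
  symm
  rw [ContinuousLinearMap.star_eq_adjoint, ContinuousLinearMap.eq_adjoint_iff]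
  intro f g
  rw [lp.inner_eq_tsum, lp.inner_eq_tsum]
  -- The two series have different index sets of nonzero terms; `shift` is the bijection between
  -- these supports, so no bijectivity on all of J is required.
  refine tsum_eq_tsum_of_ne_zero_bij (fun j => W.shift j.1) ?_ ?_ ?_
  · rintro ⟨i, hi⟩ ⟨j, hj⟩ hij
    have hw : ∀ i, ⟪f i, W.op g i⟫_ℂ ≠ 0 → W.weight i ≠ 0 := by
      intro i h h0; apply h; simp [h0]
    have hi' := (W.back_shift i (hw i hi)).1
    have hj' := (W.back_shift j (hw j hj)).1
    simp only at hij
    exact Subtype.ext (hi'.symm.trans ((congrArg W.back hij).trans hj'))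
  · intro i hi
    have hw : W.backWeight i ≠ 0 := by
      intro h0; apply hi; simp [symm, h0]
    obtain ⟨h1, h2⟩ := W.shift_back i hw
    refine ⟨⟨W.back i, ?_⟩, h1⟩
    rw [Function.mem_support]
    simp only [op_apply, h1, h2]
    simpa [symm, inner_smul_left, inner_smul_right] using hi
  · rintro ⟨j, hj⟩
    have hw : W.weight j ≠ 0 := by
      intro h0; apply hj; simp [h0]
    obtain ⟨h1, h2⟩ := W.back_shift j hw
    simp [symm, h1, h2]

end WeightedShift

/-- The diagonal operator `(T f)ⱼ = T (fⱼ)`. -/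
def ampCLM (T : E →L[ℂ] E) : lp (fun _ : J => E) 2 →L[ℂ] lp (fun _ : J => E) 2 :=
  have hmem : ∀ (f : lp (fun _ : J => E) 2) (s : Finset J),
      ∑ j ∈ s, ‖T (f j)‖ ^ (2 : ℝ≥0∞).toReal ≤ (‖T‖ * ‖f‖) ^ (2 : ℝ≥0∞).toReal := by
    intro f s
    calc _ ≤ ∑ j ∈ s, (‖T‖ * ‖f j‖) ^ (2 : ℝ≥0∞).toReal :=
          Finset.sum_le_sum fun j _ =>
            Real.rpow_le_rpow (norm_nonneg _) (T.le_opNorm _) (by norm_num)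
      _ = ‖T‖ ^ (2 : ℝ≥0∞).toReal * ∑ j ∈ s, ‖f j‖ ^ (2 : ℝ≥0∞).toReal := by
          rw [Finset.mul_sum]
          exact Finset.sum_congr rfl fun j _ => Real.mul_rpow (norm_nonneg _) (norm_nonneg _)
      _ ≤ ‖T‖ ^ (2 : ℝ≥0∞).toReal * ‖f‖ ^ (2 : ℝ≥0∞).toReal :=
          mul_le_mul_of_nonneg_left (lp.sum_rpow_le_norm_rpow (by norm_num) f s) (by positivity)
      _ = _ := (Real.mul_rpow (norm_nonneg _) (norm_nonneg _)).symm
  LinearMap.mkContinuous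
    { toFun := fun f => (⟨fun j => T (f j), memℓp_gen' (hmem f)⟩ : lp (fun _ : J => E) 2)
      map_add' := fun f g => by ext j; exact map_add T _ _
      map_smul' := fun c f => by ext j; exact map_smul T _ _ } ‖T‖
    (fun f => lp.norm_le_of_forall_sum_le (by norm_num) (by positivity) (hmem f))

@[simp] theorem ampCLM_apply (T : E →L[ℂ] E) (f : lp (fun _ : J => E) 2) (j : J) :
    ampCLM T f j = T (f j) := rfl

/-- The isometry `v ↦ (Ωⱼ v)ⱼ` for a unit vector `Ω` of `ℓ²(J)`. -/
def spread (Ω : J → ℝ) (hΩ : HasSum (fun j => Ω j ^ 2) 1) : E →ₗᵢ[ℂ] lp (fun _ : J => E) 2 :=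
  have hn : ∀ (v : E) j, ‖(Ω j : ℂ) • v‖ ^ (2 : ℝ≥0∞).toReal = Ω j ^ 2 * ‖v‖ ^ 2 := by
    intro v j
    rw [norm_smul, Complex.norm_real, Real.norm_eq_abs]
    norm_num [mul_pow]
  { toFun := fun v => (⟨fun j => (Ω j : ℂ) • v, memℓp_gen (by
        simp only [hn]; exact hΩ.summable.mul_right _)⟩ : lp (fun _ : J => E) 2)
    map_add' := fun v w => by ext j; exact smul_add _ _ _
    map_smul' := fun c v => by ext j; exact smul_comm _ _ _
    norm_map' := fun v => by
      rw [← sq_eq_sq₀ (norm_nonneg _) (norm_nonneg _)]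
      have h := lp.norm_rpow_eq_tsum (p := 2) (by norm_num)
        (⟨fun j => (Ω j : ℂ) • v, memℓp_gen (by
        simp only [hn]; exact hΩ.summable.mul_right _)⟩ : lp (fun _ : J => E) 2)
      simp only [hn] at h
      rw [(hΩ.mul_right (‖v‖ ^ 2)).tsum_eq, one_mul] at h
      simpa using h }

@[simp] theorem spread_apply (Ω : J → ℝ) (hΩ : HasSum (fun j => Ω j ^ 2) 1) (v : E) (j : J) :
    spread Ω hΩ v j = (Ω j : ℂ) • v := rfl

variable [CompleteSpace E]

variable (J E) in
/-- Amplification of operators. -/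
def amp : (E →L[ℂ] E) →⋆ₐ[ℂ] (lp (fun _ : J => E) 2 →L[ℂ] lp (fun _ : J => E) 2) where
  toFun := ampCLM
  map_one' := by ext f j; rfl
  map_mul' S T := by ext f j; rfl
  map_zero' := by ext f j; rfl
  map_add' S T := by ext f j; rfl
  commutes' c := by ext f j; rfl
  map_star' T := by
    rw [ContinuousLinearMap.star_eq_adjoint, ContinuousLinearMap.star_eq_adjoint,
      ContinuousLinearMap.eq_adjoint_iff]
    intro f g
    rw [lp.inner_eq_tsum, lp.inner_eq_tsum]
    exact tsum_congr fun j => ContinuousLinearMap.adjoint_inner_left _ _ _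

@[simp] theorem amp_apply (T : E →L[ℂ] E) (f : lp (fun _ : J => E) 2) (j : J) :
    amp J E T f j = T (f j) := rfl

theorem commute_amp_op (W : WeightedShift J) (T : E →L[ℂ] E) : Commute (amp J E T) W.op := by
  ext f j
  simp [WeightedShift.op_apply]

theorem exists_linearIsometryEquiv_lp [Denumerable J] :
    Nonempty (lp (fun _ : J => SepHilbert) 2 ≃ₗᵢ[ℂ] SepHilbert) := by
  classical
  let v : ℕ → lp (fun _ : J => SepHilbert) 2 := fun k =>
    lp.single 2 ((Denumerable.eqv (J × ℕ)).symm k).1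
      (lp.single 2 ((Denumerable.eqv (J × ℕ)).symm k).2 (1 : ℂ) : SepHilbert)
  have hv : Orthonormal ℂ v := by
    rw [orthonormal_iff_ite]
    intro i j
    simp only [v]
    rw [lp.inner_single_left]
    by_cases h : i = j
    · subst h
      rw [lp.single_apply_self, lp.inner_single_left, lp.single_apply_self]
      simp
    · rw [if_neg h]
      by_cases h1 : ((Denumerable.eqv (J × ℕ)).symm i).1 = ((Denumerable.eqv (J × ℕ)).symm j).1
      · have h2 : ((Denumerable.eqv (J × ℕ)).symm i).2 ≠ ((Denumerable.eqv (J × ℕ)).symm j).2 := by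
          intro h2
          exact h ((Denumerable.eqv (J × ℕ)).symm.injective (Prod.ext h1 h2))
        rw [h1, lp.single_apply_self, lp.inner_single_left, lp.single_apply_ne _ _ _ h2]
        simp
      · rw [lp.single_apply_ne _ _ _ h1, inner_zero_right]
  have hsp : (Submodule.span ℂ (Set.range v))ᗮ = ⊥ := by
    rw [Submodule.eq_bot_iff]
    intro f hf
    ext j n
    have := (Submodule.mem_orthogonal _ _).1 hf (v (Denumerable.eqv (J × ℕ) (j, n)))
      (Submodule.subset_span ⟨_, rfl⟩)
    simp only [v, Equiv.symm_apply_apply] at this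
    rw [lp.inner_single_left, lp.inner_single_left] at this
    simpa using this
  exact ⟨(HilbertBasis.mkOfOrthogonalEqBot hv hsp).repr⟩

end WeightedShifts

open Presentation

/-! ### The regular representation of `C(SU_q(2))` -/

theorem IsSUq2.of_relations {B : Type} [Ring B] [StarRing B] [Algebra ℂ B] [StarModule ℂ B] {q : ℝ}
    [NeZero q] {a c : B} (h1 : star a * a + star c * c = 1)
    (h2 : a * star a + ((q : ℂ) ^ 2) • (star c * c) = 1) (h3 : a * c = (q : ℂ) • (c * a))
    (h4 : a * star c = (q : ℂ) • (star c * a)) (h5 : c * star c = star c * c) :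
    IsSUq2 q !![a, -(q : ℂ) • star c; c, star a] := by
  have hq : (q : ℂ) ≠ 0 := by exact_mod_cast NeZero.ne q
  have h3' : star c * star a = (q : ℂ) • (star a * star c) := by
    simpa [-Complex.coe_smul] using congrArg star h3
  have h4' : c * star a = (q : ℂ) • (star a * c) := by
    simpa [-Complex.coe_smul] using congrArg star h4
  have h1' : star a * a = 1 - star c * c := eq_sub_of_add_eq h1
  have h2' : a * star a = 1 - ((q : ℂ) ^ 2) • (star c * c) := eq_sub_of_add_eq h2
  refine IsSUq2.of_adjugate ?_ ?_ ?_
  all_goals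
    ext i j
    fin_cases i <;> fin_cases j <;>
      simp [Matrix.mul_apply, Fin.sum_univ_two, h1', h2', h3, h4, h5, h3', h4', smul_smul, hq, pow_two,
        -Complex.coe_smul]

section RegularRepresentation

variable (q : ℝ)

/-- Index set of the regular representation. -/
abbrev Idx : Type := ℕ × ℤ × ℤ

/-- The Hilbert space of the regular representation. -/
abbrev RegHilbert : Type := lp (fun _ : Idx => SepHilbert) 2

theorem abs_sqrt_one_sub_le (x : ℝ) (hx : 0 ≤ x) : |√(1 - x)| ≤ 1 := by
  rw [abs_of_nonneg (Real.sqrt_nonneg _)]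
  exact Real.sqrt_le_one.2 (by linarith)

/-- The operator of `u₁₁`. -/
def shiftA : WeightedShift Idx where
  shift j := (j.1 + 1, j.2)
  back j := (j.1 - 1, j.2)
  weight j := √(1 - (q ^ 2) ^ (j.1 + 1))
  backWeight j := √(1 - (q ^ 2) ^ j.1)
  weight_le _ := abs_sqrt_one_sub_le _ (by positivity)
  backWeight_le _ := abs_sqrt_one_sub_le _ (by positivity)
  back_shift _ _ := ⟨rfl, rfl⟩
  shift_back := by
    rintro ⟨n, m⟩ h
    rcases n with _ | n
    · simp at h
    · exact ⟨rfl, rfl⟩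

variable [hq : Fact (|q| < 1)]

theorem q_sq_lt_one : q ^ 2 < 1 := by
  rw [← sq_abs]; exact pow_lt_one₀ (abs_nonneg q) hq.out two_ne_zero

/-- The operator of `u₂₁`. -/
def shiftC : WeightedShift Idx where
  shift j := (j.1, j.2.1 - 1, j.2.2)
  back j := (j.1, j.2.1 + 1, j.2.2)
  weight j := q ^ j.1
  backWeight j := q ^ j.1
  weight_le j := by rw [abs_pow]; exact pow_le_one₀ (abs_nonneg q) hq.out.le
  backWeight_le j := by rw [abs_pow]; exact pow_le_one₀ (abs_nonneg q) hq.out.le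
  back_shift _ _ := ⟨by simp, rfl⟩
  shift_back _ _ := ⟨by simp, rfl⟩

/-- The image of `u₁₁` in the regular representation. -/
def regA : RegHilbert →L[ℂ] RegHilbert := (shiftA q).op

/-- The image of `u₂₁` in the regular representation. -/
def regC : RegHilbert →L[ℂ] RegHilbert := (shiftC q).op

theorem star_regA : star (regA q) = (shiftA q).symm.op := WeightedShift.star_op _

theorem star_regC : star (regC q) = (shiftC q).symm.op := WeightedShift.star_op _

/-- The image of `u` in the regular representation. -/
def regU : Matrix (Fin 2) (Fin 2) (RegHilbert →L[ℂ] RegHilbert) :=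
  !![regA q, -(q : ℂ) • star (regC q); regC q, star (regA q)]

theorem sq_sqrt_one_sub (n : ℕ) :
    ((√(1 - (q ^ 2) ^ n) : ℝ) : ℂ) * ((√(1 - (q ^ 2) ^ n) : ℝ) : ℂ) = 1 - ((q : ℂ) ^ 2) ^ n := by
  rw [← Complex.ofReal_mul, Real.mul_self_sqrt]
  · push_cast; ring
  · rw [sub_nonneg]
    exact pow_le_one₀ (sq_nonneg q) (q_sq_lt_one q).le

theorem isSUq2_regU [NeZero q] : IsSUq2 q (regU q) := by
  refine IsSUq2.of_relations (a := regA q) (c := regC q) ?_ ?_ ?_ ?_ ?_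
  rotate_left 2
  · unfold regC regA
    ext f ⟨n, m, r⟩ : 3
    simp only [mul_apply_eq_comp, WeightedShift.op_apply, shiftA,
      shiftC, smul_smul, smul_apply, lp.coeFn_smul, Pi.smul_apply]
    congr 1; push_cast; ring
  rotate_left 2
  all_goals
    rw [star_regC]
    try rw [star_regA]
    try unfold regC
    try unfold regA
    ext f ⟨n, m, r⟩ : 3
  -- At n = 0 the truncated index n - 1 is again 0, but the weight √(1 - q⁰) is zero, so a*a
  -- vanishes there and c*c is the identity.
  · rcases n with _ | n
    · simp [shiftA, shiftC, WeightedShift.symm, -Complex.coe_smul]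
    · simp only [ContinuousLinearMap.add_apply, mul_apply_eq_comp,
        ContinuousLinearMap.one_apply, lp.coeFn_add, Pi.add_apply, WeightedShift.op_apply, shiftA,
        shiftC, WeightedShift.symm, smul_smul, Nat.add_sub_cancel, sq_sqrt_one_sub, add_sub_cancel_right]
      rw [← add_smul]
      convert one_smul ℂ _ using 2
      push_cast; ring
  · simp only [ContinuousLinearMap.add_apply, mul_apply_eq_comp,
      ContinuousLinearMap.one_apply, lp.coeFn_add, Pi.add_apply, WeightedShift.op_apply, shiftA,
      shiftC, WeightedShift.symm, smul_smul, Nat.add_sub_cancel, sq_sqrt_one_sub, add_sub_cancel_right,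
      smul_apply, lp.coeFn_smul, Pi.smul_apply]
    rw [← add_smul]
    convert one_smul ℂ _ using 2
    push_cast; ring
  · simp only [mul_apply_eq_comp, WeightedShift.op_apply, shiftA, WeightedShift.symm,
      shiftC, smul_smul, smul_apply, lp.coeFn_smul, Pi.smul_apply]
    congr 1; push_cast; ring
  · simp only [mul_apply_eq_comp, WeightedShift.op_apply, WeightedShift.symm, shiftC, smul_smul,
      sub_add_cancel, add_sub_cancel_right]

/-- Identification of the regular Hilbert space with `ℓ²(ℕ)`. -/
def regEquiv : RegHilbert ≃ₗᵢ[ℂ] SepHilbert :=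
  (exists_linearIsometryEquiv_lp (J := Idx)).some

/-- Operators on the regular Hilbert space as operators on `ℓ²(ℕ)`. -/
def toBdd : (RegHilbert →L[ℂ] RegHilbert) →⋆ₐ[ℂ] BddOp :=
  (regEquiv.conjStarAlgEquiv : (RegHilbert →L[ℂ] RegHilbert) →⋆ₐ[ℂ] (SepHilbert →L[ℂ] SepHilbert))

/-- Operators on `ℓ²(ℕ)` as operators on the regular Hilbert space. -/
def ofBdd : BddOp →⋆ₐ[ℂ] (RegHilbert →L[ℂ] RegHilbert) :=
  (regEquiv.symm.conjStarAlgEquiv :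
    (SepHilbert →L[ℂ] SepHilbert) →⋆ₐ[ℂ] (RegHilbert →L[ℂ] RegHilbert))

theorem ofBdd_toBdd (X : RegHilbert →L[ℂ] RegHilbert) : ofBdd (toBdd X) = X := by
  ext f : 1
  change regEquiv.symm (regEquiv (X (regEquiv.symm (regEquiv f)))) = X f
  simp

theorem toBdd_ofBdd (T : BddOp) : toBdd (ofBdd T) = T := by
  have h : ∀ S : SepHilbert →L[ℂ] SepHilbert,
      regEquiv.conjStarAlgEquiv (regEquiv.symm.conjStarAlgEquiv S) = S := by
    intro S
    ext f : 1
    change regEquiv (regEquiv.symm (S (regEquiv (regEquiv.symm f)))) = S f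
    simp
  exact h T

/-- Amplification as an endomorphism of the bounded operators on `ℓ²(ℕ)`. -/
def ampBdd : BddOp →⋆ₐ[ℂ] BddOp :=
  toBdd.comp (amp Idx SepHilbert : (SepHilbert →L[ℂ] SepHilbert) →⋆ₐ[ℂ] _)

theorem ofBdd_ampBdd (T : BddOp) : ofBdd (ampBdd T) = amp Idx SepHilbert T := ofBdd_toBdd _

variable [NeZero q]

/-- The regular representation as an element of the space of representations. -/
def regRep : (suq2 q).reps :=
  ⟨fun ij => toBdd (regU q ij.1 ij.2), (isSUq2_regU q).map toBdd⟩

/-- The regular representation of `C(SU_q(2))`. -/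
def reg : CG q →⋆ₐ[ℂ] (RegHilbert →L[ℂ] RegHilbert) := ofBdd.comp ((suq2 q).evalHom (regRep q))

theorem reg_u (i j : Fin 2) : reg q (u q i j) = regU q i j := ofBdd_toBdd _

theorem commute_reg_of (Z : RegHilbert →L[ℂ] RegHilbert)
    (ha : Commute Z (regA q)) (ha' : Commute Z (star (regA q)))
    (hc : Commute Z (regC q)) (hc' : Commute Z (star (regC q))) (a : CG q) :
    Commute Z (reg q a) := by
  refine commute_of_gen (reg q) ?_ a
  rintro ⟨i, j⟩
  change Commute Z (reg q (u q i j)) ∧ Commute Z (star (reg q (u q i j)))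
  rw [reg_u]
  fin_cases i <;> fin_cases j
  · exact ⟨ha, ha'⟩
  · change Commute Z (-(q : ℂ) • star (regC q)) ∧ Commute Z (star (-(q : ℂ) • star (regC q)))
    rw [star_smul, star_star]
    exact ⟨hc'.smul_right _, hc.smul_right _⟩
  · exact ⟨hc, hc'⟩
  · change Commute Z (star (regA q)) ∧ Commute Z (star (star (regA q)))
    rw [star_star]
    exact ⟨ha', ha⟩

/-- Amplified operators act on the fibre ℓ²(ℕ), the regular representation on the index set. This
commutation is what allows a second tensor factor to be represented beside the regular one. -/
theorem commute_amp_reg (T : BddOp) (a : CG q) : Commute (amp Idx SepHilbert T) (reg q a) :=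
  commute_reg_of q _ (commute_amp_op _ _) (by rw [star_regA]; exact commute_amp_op _ _)
    (commute_amp_op _ _) (by rw [star_regC]; exact commute_amp_op _ _) a

end RegularRepresentation

open Presentation

/-! ### The Haar state and its slice maps -/

/-- A bounded operator as a continuous linear map. -/
def BddOp.toCLM (T : BddOp) : SepHilbert →L[ℂ] SepHilbert := T

/-- A continuous linear map as a bounded operator. -/
def BddOp.ofCLM (T : SepHilbert →L[ℂ] SepHilbert) : BddOp := T

theorem bddOp_ext {S T : BddOp} (h : ∀ v w : SepHilbert, ⟪v, S.toCLM w⟫_ℂ = ⟪v, T.toCLM w⟫_ℂ) :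
    S = T :=
  (ContinuousLinearMap.ext fun w => ext_inner_left ℂ fun v => h v w : S.toCLM = T.toCLM)

section HaarState

variable (q : ℝ) [hq : Fact (|q| < 1)]

/-- The index `(n, 0, n)`. -/
def diagIdx (n : ℕ) : Idx := (n, 0, n)

theorem diagIdx_injective : Function.Injective diagIdx := fun _ _ h => congrArg Prod.fst h

/-- Coefficients of the vacuum vector. -/
def vacCoeff (j : Idx) : ℝ := if j = diagIdx j.1 then √(1 - q ^ 2) * q ^ j.1 else 0

theorem vacCoeff_diagIdx (n : ℕ) : vacCoeff q (diagIdx n) = √(1 - q ^ 2) * q ^ n := if_pos rfl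

theorem vacCoeff_eq_zero {j : Idx} (h : ∀ n, j ≠ diagIdx n) : vacCoeff q j = 0 := if_neg (h _)

theorem sq_vacCoeff_diagIdx (n : ℕ) : vacCoeff q (diagIdx n) ^ 2 = (1 - q ^ 2) * (q ^ 2) ^ n := by
  rw [vacCoeff_diagIdx, mul_pow, Real.sq_sqrt (sub_nonneg.2 (q_sq_lt_one q).le)]
  ring

theorem hasSum_diagIdx_iff {X : Type} [AddCommMonoid X] [TopologicalSpace X] {g : Idx → X} {s : X}
    (hg : ∀ j, (∀ n, j ≠ diagIdx n) → g j = 0) : HasSum (fun n => g (diagIdx n)) s ↔ HasSum g s :=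
  diagIdx_injective.hasSum_iff fun j hj => hg j fun n h => hj ⟨n, h.symm⟩

theorem hasSum_sq_vacCoeff : HasSum (fun j => vacCoeff q j ^ 2) 1 := by
  rw [← hasSum_diagIdx_iff fun j hj => by rw [vacCoeff_eq_zero q hj]; simp]
  simp only [sq_vacCoeff_diagIdx]
  have h := (hasSum_geometric_of_lt_one (sq_nonneg q) (q_sq_lt_one q)).mul_left (1 - q ^ 2)
  rwa [mul_inv_cancel₀ (sub_pos.2 (q_sq_lt_one q)).ne'] at h

/-- A unit vector. -/
def unitVec : SepHilbert := lp.single 2 0 1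

theorem norm_unitVec : ‖unitVec‖ = 1 := by
  rw [unitVec, lp.norm_single (by norm_num)]; simp

theorem inner_unitVec : ⟪unitVec, unitVec⟫_ℂ = 1 := by
  rw [inner_self_eq_norm_sq_to_K, norm_unitVec]; simp

/-- The isometry that defines the compression of the slice maps. -/
def vacMap : SepHilbert →ₗᵢ[ℂ] RegHilbert := spread (vacCoeff q) (hasSum_sq_vacCoeff q)

theorem amp_vacMap (T : BddOp) (v : SepHilbert) :
    amp Idx SepHilbert T.toCLM (vacMap q v) = vacMap q (T.toCLM v) := by
  ext j : 2
  exact map_smul T.toCLM (vacCoeff q j : ℂ) v |>.trans rfl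

/-- The vacuum vector. -/
def vac : RegHilbert := vacMap q unitVec

theorem norm_vac : ‖vac q‖ = 1 := by rw [vac, LinearIsometry.norm_map, norm_unitVec]

/-- Compression to the vacuum space. -/
def cut : BddOp →L[ℂ] BddOp :=
  LinearMap.mkContinuous
    { toFun := fun T => BddOp.ofCLM (ContinuousLinearMap.adjoint (vacMap q).toContinuousLinearMap ∘L
        ofBdd T ∘L (vacMap q).toContinuousLinearMap)
      map_add' := fun S T => by
        rw [map_add, ContinuousLinearMap.add_comp, ContinuousLinearMap.comp_add]; rfl
      map_smul' := fun c T => by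
        rw [map_smul ofBdd c T, ContinuousLinearMap.smul_comp, ContinuousLinearMap.comp_smul]; rfl } 1
    (fun T => by
      have h1 : ‖(vacMap q).toContinuousLinearMap‖ ≤ 1 :=
        (vacMap q).norm_toContinuousLinearMap_le
      have h2 : ‖ContinuousLinearMap.adjoint (vacMap q).toContinuousLinearMap‖ ≤ 1 := by
        rwa [LinearIsometryEquiv.norm_map]
      have h3 : ‖ofBdd T‖ ≤ ‖T‖ := NonUnitalStarAlgHom.norm_apply_le ofBdd T
      refine (ContinuousLinearMap.opNorm_comp_le _ _).trans ?_
      refine mul_le_mul h2 ?_ (norm_nonneg _) zero_le_one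
      refine (ContinuousLinearMap.opNorm_comp_le _ _).trans ?_
      calc _ ≤ ‖T‖ * 1 := mul_le_mul h3 h1 (norm_nonneg _) (norm_nonneg _)
        _ = _ := mul_one _)

theorem toCLM_cut (T : BddOp) :
    (cut q T).toCLM = ContinuousLinearMap.adjoint (vacMap q).toContinuousLinearMap ∘L
      ofBdd T ∘L (vacMap q).toContinuousLinearMap := rfl

theorem inner_cut (T : BddOp) (v w : SepHilbert) :
    ⟪v, (cut q T).toCLM w⟫_ℂ = ⟪vacMap q v, ofBdd T (vacMap q w)⟫_ℂ := by
  rw [toCLM_cut, ContinuousLinearMap.comp_apply, ContinuousLinearMap.adjoint_inner_right]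
  rfl

/-- The range of `vacMap` is preserved by amplified operators, which restrict there to the original
operators. So `cut` is a bimodule map over the amplified operators. -/
theorem cut_mul_ampBdd (S T : BddOp) : cut q (S * ampBdd T) = cut q S * T := by
  refine bddOp_ext fun v w => ?_
  rw [inner_cut, map_mul, ofBdd_ampBdd]
  change ⟪_, ofBdd S (amp Idx SepHilbert T.toCLM _)⟫_ℂ =
    ⟪_, (cut q S).toCLM (T.toCLM w)⟫_ℂ
  rw [amp_vacMap, inner_cut]

theorem cut_ampBdd_mul (S T : BddOp) : cut q (ampBdd T * S) = T * cut q S := by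
  refine bddOp_ext fun v w => ?_
  rw [inner_cut, map_mul, ofBdd_ampBdd]
  change ⟪_, amp Idx SepHilbert T.toCLM (ofBdd S _)⟫_ℂ =
    ⟪v, T.toCLM ((cut q S).toCLM w)⟫_ℂ
  have h1 := ContinuousLinearMap.adjoint_inner_left (amp Idx SepHilbert T.toCLM)
    (ofBdd S (vacMap q w)) (vacMap q v)
  have h2 := ContinuousLinearMap.adjoint_inner_left T.toCLM ((cut q S).toCLM w) v
  have h3 : ContinuousLinearMap.adjoint (amp Idx SepHilbert T.toCLM) =
      amp Idx SepHilbert (BddOp.toCLM (star T)) :=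
    (map_star (amp Idx SepHilbert) T.toCLM).symm
  rw [h3, amp_vacMap] at h1
  rw [← h1, ← h2, inner_cut]
  rfl

variable [NeZero q]

/-- The Haar state of `SU_q(2)`. -/
def haar : CG q →L[ℂ] ℂ :=
  LinearMap.mkContinuous
    { toFun := fun a => ⟪vac q, reg q a (vac q)⟫_ℂ
      map_add' := fun a b => by rw [map_add, add_apply, inner_add_right]
      map_smul' := fun c a => by
        rw [map_smul (reg q) c a, RingHom.id_apply, smul_eq_mul, smul_apply, inner_smul_right] } 1
    (fun a => by
      have h3 : ‖reg q a‖ ≤ ‖a‖ := NonUnitalStarAlgHom.norm_apply_le (reg q) a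
      refine (norm_inner_le_norm (𝕜 := ℂ) (vac q) (reg q a (vac q))).trans ?_
      rw [norm_vac, one_mul, one_mul]
      refine ((reg q a).le_opNorm _).trans ?_
      rwa [norm_vac, mul_one])

theorem haar_apply (a : CG q) : haar q a = ⟪vac q, reg q a (vac q)⟫_ℂ := rfl

theorem haar_one : haar q 1 = 1 := by
  rw [haar_apply, map_one]
  change ⟪vac q, vac q⟫_ℂ = 1
  rw [inner_self_eq_norm_sq_to_K (𝕜 := ℂ), norm_vac]; simp

theorem haar_star_mul (a b : CG q) :
    haar q (star a * b) = ⟪reg q a (vac q), reg q b (vac q)⟫_ℂ := by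
  rw [haar_apply, map_mul, map_star (reg q) a, ContinuousLinearMap.star_eq_adjoint,
    mul_apply_eq_comp, ContinuousLinearMap.adjoint_inner_right]

theorem haar_star (a : CG q) : haar q (star a) = star (haar q a) := by
  have h := haar_star_mul q a 1
  rw [mul_one, map_one] at h
  rw [h, haar_apply]
  exact (inner_conj_symm _ _).symm

/-- By the bimodule property and `commute_amp_reg`, the compression of reg(a) commutes with every
bounded operator. It is therefore a scalar, and a unit vector identifies the scalar as h(a). -/
theorem cut_toBdd_reg (a : CG q) : cut q (toBdd (reg q a)) = haar q a • (1 : BddOp) := by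
  have hc : ∀ T : BddOp, T * cut q (toBdd (reg q a)) = cut q (toBdd (reg q a)) * T := by
    intro T
    rw [← cut_ampBdd_mul, ← cut_mul_ampBdd]
    congr 1
    change toBdd (amp Idx SepHilbert T.toCLM) * _ = _ * toBdd (amp Idx SepHilbert T.toCLM)
    rw [← map_mul, ← map_mul, (commute_amp_reg q T.toCLM a).eq]
  have hmem : (cut q (toBdd (reg q a))).toCLM ∈ Subalgebra.center ℂ (SepHilbert →L[ℂ] SepHilbert) :=
    Subalgebra.mem_center_iff.2 fun T => hc (BddOp.ofCLM T)
  rw [Algebra.IsCentral.center_eq_bot, Algebra.mem_bot] at hmem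
  obtain ⟨c, hc⟩ := hmem
  have hc' : cut q (toBdd (reg q a)) = c • (1 : BddOp) :=
    hc.symm.trans (Algebra.algebraMap_eq_smul_one c)
  rw [hc']
  congr 1
  have h := inner_cut q (toBdd (reg q a)) unitVec unitVec
  rw [hc', ofBdd_toBdd] at h
  change ⟪unitVec, c • unitVec⟫_ℂ = _ at h
  rw [inner_smul_right, inner_unitVec, mul_one] at h
  exact h

end HaarState

open Presentation

/-! ### Slice maps on tensor products. -/

section Slices

variable {ι κ : Type}

/-- An element of the universal algebra as a function of the representation. -/
def valCLM (Q : Presentation κ) : Q.CStar →L[ℂ] (Q.reps →ᵇ BddOp) :=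
  ⟨⟨⟨fun a => a.1, fun _ _ => rfl⟩, fun _ _ => rfl⟩, continuous_subtype_val⟩

theorem inr_mul_tmul (P : Presentation ι) (Q : Presentation κ) (a : P.CStar) (b c : Q.CStar) :
    inr P Q c * (inl P Q a * inr P Q b) = inl P Q a * inr P Q (c * b) := by
  rw [map_mul, ← mul_assoc, ← (commute_inl_inr P Q a c).eq, mul_assoc]

/-- The relations are stable under amplification. -/
class AmpStable (Q : Presentation κ) : Prop where
  ampBdd_mem : ∀ y ∈ Q.reps, (fun j => ampBdd (y j)) ∈ Q.reps

instance (q : ℝ) : AmpStable (suq2 q) := ⟨fun _ hy => IsSUq2.map hy ampBdd⟩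

instance (q : ℝ) : AmpStable (sphere q) := ⟨fun _ hy => IsPodles.map hy ampBdd⟩

/-- Amplification of a representation. -/
def ampRep (Q : Presentation κ) [AmpStable Q] (y : Q.reps) : Q.reps :=
  ⟨fun j => ampBdd (y.1 j), AmpStable.ampBdd_mem _ y.2⟩

theorem evalHom_ampRep (Q : Presentation κ) [AmpStable Q] (y : Q.reps) (a : Q.CStar) :
    Q.evalHom (ampRep Q y) a = ampBdd (Q.evalHom y a) :=
  evalHom_map ampBdd y (ampRep Q y) (fun _ => rfl) a

/-- The flip `a ⊗ b ↦ b ⊗ a`. -/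
def flip (P : Presentation ι) (Q : Presentation κ) : (P.tensor Q).CStar →⋆ₐ[ℂ] (Q.tensor P).CStar :=
  lift (P.tensor Q) (Q.tensor P) (fun i => (Q.tensor P).gen i.swap)
    (fun x => ⟨fun i => x.1 i.swap, x.2.2.1, x.2.1, fun i j =>
      ⟨(x.2.2.2 j i).1.symm, by simpa using (x.2.2.2 j i).2.star_star.symm⟩⟩)
    (fun _ _ => rfl)

theorem flip_inl (P : Presentation ι) (Q : Presentation κ) (a : P.CStar) :
    flip P Q (inl P Q a) = inr Q P a := by
  refine hom_ext (f := (flip P Q).comp (inl P Q)) (g := inr Q P) (fun i => ?_) a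
  rfl

theorem flip_inr (P : Presentation ι) (Q : Presentation κ) (b : Q.CStar) :
    flip P Q (inr P Q b) = inl Q P b := by
  refine hom_ext (f := (flip P Q).comp (inr P Q)) (g := inl Q P) (fun i => ?_) b
  rfl

variable (q : ℝ) [hq : Fact (|q| < 1)] [NeZero q]

/-- The regular representation next to an amplified representation of `Q`. -/
def pairRep (Q : Presentation κ) [AmpStable Q] (y : Q.reps) : ((suq2 q).tensor Q).reps :=
  ⟨Sum.elim (regRep q).1 (ampRep Q y).1, (regRep q).2, (ampRep Q y).2, by
    have h : ∀ (T : BddOp) i, Commute ((regRep q).1 i) (ampBdd T) := by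
      rintro T ⟨i, j⟩
      have h := (commute_amp_reg q T.toCLM (u q i j)).symm
      rw [reg_u] at h
      exact h.map toBdd
    intro i j
    refine ⟨h _ _, ?_⟩
    change Commute _ (star (ampBdd (y.1 j)))
    rw [← map_star]
    exact h _ _⟩

theorem continuous_pairRep (Q : Presentation κ) [AmpStable Q] : Continuous (pairRep q Q) := by
  refine Continuous.subtype_mk (continuous_pi ?_) _
  rintro (i | j)
  · exact continuous_const
  · exact (continuous_starAlgHom ampBdd).comp ((continuous_apply j).comp continuous_subtype_val)

theorem evalHom_pairRep (Q : Presentation κ) [AmpStable Q] (y : Q.reps) (a : CG q) (b : Q.CStar) :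
    ((suq2 q).tensor Q).evalHom (pairRep q Q y) (inl _ _ a * inr _ _ b) =
      toBdd (reg q a) * ampBdd (Q.evalHom y b) := by
  rw [map_mul, ← evalHom_ampRep]
  congr 1
  change (suq2 q).evalHom (regRep q) a = toBdd (ofBdd ((suq2 q).evalHom (regRep q) a))
  exact (toBdd_ofBdd _).symm

/-- The slice map on bounded functions. -/
def sliceFun (Q : Presentation κ) [AmpStable Q] :
    (((suq2 q).tensor Q).reps →ᵇ BddOp) →L[ℂ] (Q.reps →ᵇ BddOp) :=
  ((cut q).compLeftContinuousBounded Q.reps).comp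
    ⟨(compHom ⟨pairRep q Q, continuous_pairRep q Q⟩).toAlgHom.toLinearMap,
      BoundedContinuousFunction.continuous_compContinuous _⟩

theorem sliceFun_tmul (Q : Presentation κ) [AmpStable Q] (a : CG q) (b : Q.CStar) :
    sliceFun q Q (valCLM _ (inl (suq2 q) Q a * inr (suq2 q) Q b)) = valCLM _ (haar q a • b) := by
  ext1 y
  have h := evalHom_pairRep q Q y a b
  change cut q (((suq2 q).tensor Q).evalHom (pairRep q Q y) (inl _ _ a * inr _ _ b)) =
    haar q a • Q.evalHom y b
  rw [h, cut_mul_ampBdd, cut_toBdd_reg, smul_mul_assoc, one_mul]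

/-- A compression of a function on representations is a priori only a bounded function. It lies in
the closed algebra on elementary tensors, and these have dense span. -/
theorem sliceFun_mem (Q : Presentation κ) [AmpStable Q] (t : ((suq2 q).tensor Q).CStar) :
    sliceFun q Q (valCLM _ t) ∈ Q.alg.toSubalgebra.toSubmodule := by
  let L := (sliceFun q Q).comp (valCLM ((suq2 q).tensor Q))
  let S : Submodule ℂ ((suq2 q).tensor Q).CStar :=
    Q.alg.toSubalgebra.toSubmodule.comap L.toLinearMap
  have hcl : IsClosed (S : Set ((suq2 q).tensor Q).CStar) := by
    have h : IsClosed (Q.alg : Set (Q.reps →ᵇ BddOp)) := StarSubalgebra.isClosed_topologicalClosure _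
    exact h.preimage L.continuous
  have hle : algTensor (suq2 q) Q ≤ S := by
    refine Submodule.span_le.2 ?_
    rintro _ ⟨a, b, rfl⟩
    change sliceFun q Q (valCLM _ (inl (suq2 q) Q a * inr (suq2 q) Q b)) ∈
      Q.alg.toSubalgebra.toSubmodule
    rw [sliceFun_tmul]
    exact (haar q a • b).2
  exact hcl.closure_subset_iff.2 hle (dense_algTensor (suq2 q) Q t)

/-- The slice map `h ⊗ id`. -/
def leftSlice (Q : Presentation κ) [AmpStable Q] : ((suq2 q).tensor Q).CStar →L[ℂ] Q.CStar :=
  LinearMap.mkContinuous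
    { toFun := fun t => ⟨sliceFun q Q (valCLM _ t), sliceFun_mem q Q t⟩
      map_add' := fun s t => Subtype.ext (map_add ((sliceFun q Q).comp (valCLM _)) s t)
      map_smul' := fun c t => Subtype.ext (map_smul ((sliceFun q Q).comp (valCLM _)) c t) }
    ‖(sliceFun q Q).comp (valCLM _)‖
    (fun t => ((sliceFun q Q).comp (valCLM _)).le_opNorm t)

theorem leftSlice_tmul (Q : Presentation κ) [AmpStable Q] (a : CG q) (b : Q.CStar) :
    leftSlice q Q (inl _ _ a * inr _ _ b) = haar q a • b :=
  Subtype.ext (sliceFun_tmul q Q a b)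

/-- The slice map `id ⊗ h(y* ·)`. -/
def rightSlice (P : Presentation ι) [AmpStable P] (y : CG q) : (P.tensor (suq2 q)).CStar →L[ℂ] P.CStar :=
  (leftSlice q P).comp ((⟨(flip P (suq2 q) : _ →ₗ[ℂ] _), continuous_starAlgHom _⟩ : _ →L[ℂ] _) ∘L
    ContinuousLinearMap.mul ℂ _ (inr P (suq2 q) (star y)))

theorem rightSlice_apply (P : Presentation ι) [AmpStable P] (y : CG q) (t : (P.tensor (suq2 q)).CStar) :
    rightSlice q P y t = leftSlice q P (flip P (suq2 q) (inr P (suq2 q) (star y) * t)) := rfl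

theorem rightSlice_tmul (P : Presentation ι) [AmpStable P] (y : CG q) (a : P.CStar) (g : CG q) :
    rightSlice q P y (inl _ _ a * inr _ _ g) = haar q (star y * g) • a := by
  rw [rightSlice_apply, inr_mul_tmul, map_mul (flip P (suq2 q)), flip_inl, flip_inr,
    ← (commute_inl_inr (suq2 q) P _ _).eq, leftSlice_tmul]

/-- The product of two copies of the Haar state, as a vector state: the representation. -/
def biReg : CGG q →⋆ₐ[ℂ] (RegHilbert →L[ℂ] RegHilbert) :=
  ofBdd.comp (((suq2 q).tensor (suq2 q)).evalHom (pairRep q (suq2 q) (regRep q)))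

/-- The product of two copies of the Haar state, as a vector state: the vector. -/
def biVac : RegHilbert := vacMap q (regEquiv (vac q))

/-- Writes h ⊗ h as a vector state, so that the Cauchy–Schwarz inequality becomes available for it.
-/
theorem haar_leftSlice (t : CGG q) :
    haar q (leftSlice q (suq2 q) t) = ⟪biVac q, biReg q t (biVac q)⟫_ℂ := by
  have h : reg q (leftSlice q (suq2 q) t) = ofBdd (cut q
    (((suq2 q).tensor (suq2 q)).evalHom (pairRep q (suq2 q) (regRep q)) t)) := rfl
  rw [haar_apply, h]
  have h2 : ∀ T : BddOp, ofBdd T (vac q) = regEquiv.symm (T.toCLM (regEquiv (vac q))) := fun _ => rfl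
  rw [h2, ← LinearIsometryEquiv.inner_map_map regEquiv, LinearIsometryEquiv.apply_symm_apply,
    inner_cut]
  rfl

theorem haar_leftSlice_star_mul (s t : CGG q) :
    haar q (leftSlice q (suq2 q) (star s * t)) =
      ⟪biReg q s (biVac q), biReg q t (biVac q)⟫_ℂ := by
  rw [haar_leftSlice, map_mul, map_star (biReg q) s, ContinuousLinearMap.star_eq_adjoint,
    mul_apply_eq_comp, ContinuousLinearMap.adjoint_inner_right]

end Slices

open Presentation

/-! ### Matrix coefficients of the regular representation -/

section Generators

variable (q : ℝ)

theorem isSUq2_u : IsSUq2 q (u q) := by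
  have h : ∀ {x y : CG q}, (∀ r, (suq2 q).evalHom r x = (suq2 q).evalHom r y) → x = y :=
    fun h => ext_evalHom h
  have hr : ∀ r : (suq2 q).reps, IsSUq2 q ((u q).map ((suq2 q).evalHom r)) := fun r => r.2
  constructor
  · ext i j
    refine h fun r => ?_
    have := congrFun (congrFun (hr r).unitary_left i) j
    fin_cases i <;> fin_cases j <;>
      simpa [Matrix.mul_apply, Fin.sum_univ_two, map_star] using this
  · ext i j
    refine h fun r => ?_
    have := congrFun (congrFun (hr r).unitary_right i) j
    fin_cases i <;> fin_cases j <;>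
      simpa [Matrix.mul_apply, Fin.sum_univ_two, map_star] using this
  · refine h fun r => ?_
    simpa only [map_sub, map_mul, map_smul, map_one, Matrix.map_apply] using (hr r).det01
  · refine h fun r => ?_
    simpa only [map_sub, map_mul, map_smul, map_one, Matrix.map_apply] using (hr r).det10
  · refine h fun r => ?_
    simpa only [map_sub, map_mul, map_smul, map_zero, Matrix.map_apply] using (hr r).det00
  · refine h fun r => ?_
    simpa only [map_sub, map_mul, map_smul, map_zero, Matrix.map_apply] using (hr r).det11

theorem isPodles_gen : IsPodles q (xi q) (eta q) := by
  have h : ∀ {x y : CS q}, (∀ r, (sphere q).evalHom r x = (sphere q).evalHom r y) → x = y :=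
    fun h => ext_evalHom h
  have hr : ∀ r : (sphere q).reps,
    IsPodles q ((sphere q).evalHom r (xi q)) ((sphere q).evalHom r (eta q)) := fun r => r.2
  constructor
  · exact h fun r => by simpa only [map_star] using (hr r).star_xi
  · exact h fun r => by simpa only [map_star, map_mul, map_sub, map_pow] using (hr r).star_eta_mul
  · exact h fun r => by simpa only [map_mul, map_smul] using (hr r).eta_xi
  · exact h fun r => by
      simpa only [map_star, map_mul, map_sub, map_pow, map_smul] using (hr r).eta_mul_star

variable [NeZero q]

theorem ψ_xi : ψ q (xi q) = star (u q 1 0) * u q 1 0 := by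
  obtain ⟨-, hb, -⟩ := (isSUq2_u q).facts
  have hq : (q : ℂ) ≠ 0 := by exact_mod_cast NeZero.ne q
  have h : ψ q (xi q) = -(q : ℂ)⁻¹ • (u q 0 1 * u q 1 0) := lift_gen _ _ _ _ _ 0
  rw [h, hb, smul_mul_assoc, smul_smul, neg_mul_neg, inv_mul_cancel₀ hq, one_smul]

theorem ψ_eta : ψ q (eta q) = u q 0 0 * u q 1 0 := lift_gen _ _ _ _ _ 1

end Generators

section Coefficients

variable (q : ℝ) [hq : Fact (|q| < 1)] [NeZero q]

theorem reg_u00 : reg q (u q 0 0) = (shiftA q).op := reg_u q 0 0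

theorem reg_u10 : reg q (u q 1 0) = (shiftC q).op := reg_u q 1 0

theorem reg_star_u00 : reg q (star (u q 0 0)) = (shiftA q).symm.op := by
  rw [map_star, reg_u00]; exact star_regA q

theorem reg_star_u10 : reg q (star (u q 1 0)) = (shiftC q).symm.op := by
  rw [map_star, reg_u10]; exact star_regC q

theorem reg_u00_apply (f : RegHilbert) (n : ℕ) (m r : ℤ) :
    reg q (u q 0 0) f (n, m, r) = (√(1 - (q ^ 2) ^ (n + 1)) : ℂ) • f (n + 1, m, r) := by
  rw [reg_u00]; rfl

theorem reg_u10_apply (f : RegHilbert) (n : ℕ) (m r : ℤ) :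
    reg q (u q 1 0) f (n, m, r) = (q : ℂ) ^ n • f (n, m - 1, r) := by
  rw [reg_u10, WeightedShift.op_apply]; simp [shiftC, -Complex.coe_smul]

theorem reg_star_u00_apply (f : RegHilbert) (n : ℕ) (m r : ℤ) :
    reg q (star (u q 0 0)) f (n, m, r) = (√(1 - (q ^ 2) ^ n) : ℂ) • f (n - 1, m, r) := by
  rw [reg_star_u00]; rfl

theorem reg_star_u10_apply (f : RegHilbert) (n : ℕ) (m r : ℤ) :
    reg q (star (u q 1 0)) f (n, m, r) = (q : ℂ) ^ n • f (n, m + 1, r) := by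
  rw [reg_star_u10, WeightedShift.op_apply]; simp [shiftC, WeightedShift.symm, -Complex.coe_smul]

theorem reg_mul_apply (x y : CG q) (f : RegHilbert) : reg q (x * y) f = reg q x (reg q y f) := by
  rw [map_mul]; rfl

theorem reg_ψ_xi_apply (f : RegHilbert) (n : ℕ) (m r : ℤ) :
    reg q (ψ q (xi q)) f (n, m, r) = ((q : ℂ) ^ 2) ^ n • f (n, m, r) := by
  rw [ψ_xi, reg_mul_apply, reg_star_u10_apply, reg_u10_apply, smul_smul, add_sub_cancel_right,
    ← pow_add, ← pow_mul]
  congr 2; ring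

/-- The operators a and c move only n and m, with weights depending only on n. Operators that
translate m and r, or cut down to a value of r, are therefore in the commutant. -/
theorem commute_shift_reg (W : WeightedShift Idx)
    (hW : ∃ s t : ℤ, ∀ j, W.shift j = (j.1, j.2.1 + s, j.2.2 + t))
    (hw : ∀ (n n' : ℕ) (m m' r : ℤ), W.weight (n, m, r) = W.weight (n', m', r)) (x : CG q) :
    Commute (W.op : RegHilbert →L[ℂ] RegHilbert) (reg q x) := by
  obtain ⟨s, t, h⟩ := hW
  refine commute_reg_of q _ ?_ ?_ ?_ ?_ x
  · ext f ⟨n, m, r⟩ : 3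
    simp only [regA, mul_apply_eq_comp, WeightedShift.op_apply, shiftA, h]
    rw [hw n (n + 1) m m r, smul_comm]
  · rw [star_regA]
    ext f ⟨n, m, r⟩ : 3
    simp only [mul_apply_eq_comp, WeightedShift.op_apply, shiftA, WeightedShift.symm, h]
    rw [hw n (n - 1) m m r, smul_comm]
  · ext f ⟨n, m, r⟩ : 3
    simp only [regC, mul_apply_eq_comp, WeightedShift.op_apply, shiftC, h]
    rw [hw n n m (m - 1) r, smul_comm, sub_add_eq_add_sub]
  · rw [star_regC]
    ext f ⟨n, m, r⟩ : 3
    simp only [mul_apply_eq_comp, WeightedShift.op_apply, shiftC, WeightedShift.symm, h]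
    rw [hw n n m (m + 1) r, smul_comm, add_right_comm]

/-- Translation of the last two indices. -/
def translate (s t : ℤ) : WeightedShift Idx where
  shift j := (j.1, j.2.1 + s, j.2.2 + t)
  back j := (j.1, j.2.1 - s, j.2.2 - t)
  weight _ := 1
  backWeight _ := 1
  weight_le _ := by simp
  backWeight_le _ := by simp
  back_shift _ _ := by simp
  shift_back _ _ := by simp

/-- Projection to a value of the last index. -/
def restrict (t : ℤ) : WeightedShift Idx where
  shift j := j
  back j := j
  weight j := if j.2.2 = t then 1 else 0
  backWeight j := if j.2.2 = t then 1 else 0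
  weight_le _ := by split_ifs <;> simp
  backWeight_le _ := by split_ifs <;> simp
  back_shift _ _ := by simp
  shift_back _ _ := by simp

theorem commute_translate_reg (s t : ℤ) (x : CG q) :
    Commute ((translate s t).op : RegHilbert →L[ℂ] RegHilbert) (reg q x) :=
  commute_shift_reg q _ ⟨s, t, fun _ => rfl⟩ (fun _ _ _ _ _ => rfl) x

theorem commute_restrict_reg (t : ℤ) (x : CG q) :
    Commute ((restrict t).op : RegHilbert →L[ℂ] RegHilbert) (reg q x) :=
  commute_shift_reg q _ ⟨0, 0, fun j => by simp [restrict]⟩ (fun _ _ _ _ _ => rfl) x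

/-- Standard vectors of the regular Hilbert space. -/
def bs (j : Idx) : RegHilbert := lp.single 2 j unitVec

theorem bs_apply (i j : Idx) : bs j i = if i = j then unitVec else 0 := by
  by_cases h : i = j
  · subst h; rw [if_pos rfl]; exact lp.single_apply_self _ _ _
  · rw [if_neg h]; exact lp.single_apply_ne _ _ _ h

theorem norm_bs (j : Idx) : ‖bs j‖ = 1 := by
  rw [bs, lp.norm_single (by norm_num), norm_unitVec]

/-- Matrix coefficients. -/
def coeff (i j : Idx) : CG q →ₗ[ℂ] ℂ where
  toFun x := ⟪unitVec, reg q x (bs j) i⟫_ℂ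
  map_add' x y := by rw [map_add, ← inner_add_right]; rfl
  map_smul' c x := by rw [map_smul (reg q) c x, RingHom.id_apply, smul_eq_mul, ← inner_smul_right]; rfl

theorem coeff_apply (i j : Idx) (x : CG q) : coeff q i j x = ⟪unitVec, reg q x (bs j) i⟫_ℂ := rfl

theorem norm_coeff_le (i j : Idx) (x : CG q) : ‖coeff q i j x‖ ≤ ‖x‖ := by
  rw [coeff_apply]
  refine (norm_inner_le_norm (𝕜 := ℂ) _ _).trans ?_
  rw [norm_unitVec, one_mul]
  refine (lp.norm_apply_le_norm (by norm_num) _ _).trans ?_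
  refine ((reg q x).le_opNorm _).trans ?_
  rw [norm_bs, mul_one]
  exact NonUnitalStarAlgHom.norm_apply_le (reg q) x

theorem translate_bs (s t : ℤ) (n : ℕ) (m r : ℤ) :
    (translate s t).op (bs (n, m + s, r + t)) = bs (n, m, r) := by
  ext i : 2
  rw [WeightedShift.op_apply, bs_apply, bs_apply]
  simp [translate, Prod.ext_iff]

theorem coeff_translate (s t : ℤ) (n n' : ℕ) (m m' r r' : ℤ) (x : CG q) :
    coeff q (n, m + s, r + t) (n', m' + s, r' + t) x = coeff q (n, m, r) (n', m', r') x := by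
  have hb := translate_bs s t n' m' r'
  have h := congrArg (fun T => T (bs (n', m' + s, r' + t))) (commute_translate_reg q s t x).eq
  simp only [mul_apply_eq_comp] at h
  rw [coeff_apply, coeff_apply, ← hb, ← h, WeightedShift.op_apply]
  simp [translate]

theorem restrict_vac (n : ℕ) :
    (restrict n).op (vac q) = (vacCoeff q (diagIdx n) : ℂ) • bs (diagIdx n) := by
  ext i : 2
  rw [WeightedShift.op_apply, lp.coeFn_smul, Pi.smul_apply, bs_apply, vac, vacMap, spread_apply]
  simp only [restrict]
  split_ifs with h1 h2 h2
  · rw [h2]; simp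
  · rw [vacCoeff_eq_zero]
    · simp
    · rintro k rfl
      simp [diagIdx] at h1 h2
      exact h2 h1
  · rw [h2] at h1; exact absurd rfl h1
  · simp

/-- The last coordinate r is untouched by the representation, and the part of the vacuum with r = n
is a multiple of one standard vector. Thus r decouples the components of the vacuum and the vector
state becomes a weighted trace. -/
theorem reg_vac_diagIdx (n : ℕ) (x : CG q) :
    reg q x (vac q) (diagIdx n) = (vacCoeff q (diagIdx n) : ℂ) • reg q x (bs (diagIdx n)) (diagIdx n) := by
  have h := congrArg (fun T => T (vac q) (diagIdx n)) (commute_restrict_reg q n x).eq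
  simp only [mul_apply_eq_comp, restrict_vac, map_smul, WeightedShift.op_apply] at h
  rw [lp.coeFn_smul, Pi.smul_apply] at h
  rw [← h]
  simp [restrict, diagIdx]

/-- The Haar state as a weighted trace. -/
theorem hasSum_haar (x : CG q) :
    HasSum (fun n => ((1 - q ^ 2) * (q ^ 2) ^ n : ℝ) * coeff q (diagIdx n) (diagIdx n) x)
      (haar q x) := by
  have h := lp.hasSum_inner (𝕜 := ℂ) (vac q) (reg q x (vac q))
  rw [haar_apply]
  have h1 : ∀ n, ((1 - q ^ 2) * (q ^ 2) ^ n : ℝ) * coeff q (diagIdx n) (diagIdx n) x =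
      ⟪vac q (diagIdx n), reg q x (vac q) (diagIdx n)⟫_ℂ := by
    intro n
    rw [reg_vac_diagIdx, inner_smul_right, vac, vacMap, spread_apply, inner_smul_left, coeff_apply,
      ← mul_assoc, ← sq_vacCoeff_diagIdx]
    simp [pow_two]
  have h2 : ∀ j, (∀ n, j ≠ diagIdx n) → ⟪vac q j, reg q x (vac q) j⟫_ℂ = 0 := by
    intro j hj
    rw [vac, vacMap, spread_apply, vacCoeff_eq_zero q hj]
    simp
  have h3 := (hasSum_diagIdx_iff (g := fun j => ⟪vac q j, reg q x (vac q) j⟫_ℂ) h2).2 h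
  rw [funext h1]
  exact h3

theorem coeff_mul_xi (n : ℕ) (m r : ℤ) (i : Idx) (x : CG q) :
    coeff q i (n, m, r) (x * ψ q (xi q)) = ((q : ℂ) ^ 2) ^ n * coeff q i (n, m, r) x := by
  have h : reg q (ψ q (xi q)) (bs (n, m, r)) = ((q : ℂ) ^ 2) ^ n • bs (n, m, r) := by
    ext ⟨n', m', r'⟩ : 2
    rw [reg_ψ_xi_apply, lp.coeFn_smul, Pi.smul_apply, bs_apply]
    split_ifs with h
    · rw [(Prod.mk.inj h).1]
    · simp
  rw [coeff_apply, reg_mul_apply, h, map_smul, lp.coeFn_smul, Pi.smul_apply, inner_smul_right]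
  rfl

end Coefficients

open Presentation

/-! ### The modular property of the Haar state. -/

section Modular

variable (q : ℝ) [hq : Fact (|q| < 1)] [NeZero q]

/-- `y` acts as a weighted shift that raises the first index. -/
def Raises (y : CG q) (s : ℤ) (w : ℕ → ℂ) : Prop :=
  w 0 = 0 ∧ ∀ (f : RegHilbert) (n : ℕ) (m r : ℤ), reg q y f (n, m, r) = w n • f (n - 1, m + s, r)

variable {q}

theorem raises_star_u00 : Raises q (star (u q 0 0)) 0 fun n => (√(1 - (q ^ 2) ^ n) : ℂ) := by
  refine ⟨by simp, fun f n m r => ?_⟩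
  rw [reg_star_u00_apply, add_zero]

theorem raises_star_eta :
    Raises q (ψ q (star (eta q))) 1 fun n => (q : ℂ) ^ n * (√(1 - (q ^ 2) ^ n) : ℂ) := by
  refine ⟨by simp, fun f n m r => ?_⟩
  rw [map_star, ψ_eta, star_mul, reg_mul_apply, reg_star_u10_apply, reg_star_u00_apply, smul_smul]

namespace Raises

variable {y : CG q} {s : ℤ} {w : ℕ → ℂ} (h : Raises q y s w)

include h

theorem reg_bs (n : ℕ) (m r : ℤ) : reg q y (bs (n, m, r)) = w (n + 1) • bs (n + 1, m - s, r) := by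
  ext ⟨n', m', r'⟩ : 2
  rw [h.2, lp.coeFn_smul, Pi.smul_apply, bs_apply, bs_apply]
  rcases n' with _ | n'
  · rw [h.1, zero_smul, if_neg, smul_zero]
    simp
  · have : ((n' + 1 - 1, m' + s, r') : Idx) = (n, m, r) ↔
        ((n' + 1, m', r') : Idx) = (n + 1, m - s, r) := by
      simp only [Prod.mk.injEq, Nat.add_sub_cancel, Nat.add_right_cancel_iff, eq_sub_iff_add_eq]
    by_cases h1 : ((n' + 1, m', r') : Idx) = (n + 1, m - s, r)
    · rw [if_pos h1, if_pos (this.2 h1), (Prod.mk.inj h1).1]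
    · rw [if_neg h1, if_neg (fun h2 => h1 (this.1 h2)), smul_zero, smul_zero]

theorem coeff_mul_left (x : CG q) (n : ℕ) (m r : ℤ) (j : Idx) :
    coeff q (n, m, r) j (y * x) = w n * coeff q (n - 1, m + s, r) j x := by
  rw [coeff_apply, reg_mul_apply, h.2, inner_smul_right, coeff_apply]

theorem coeff_mul_right (x : CG q) (n : ℕ) (m r : ℤ) (i : Idx) :
    coeff q i (n, m, r) (x * y) = w (n + 1) * coeff q i (n + 1, m - s, r) x := by
  rw [coeff_apply, reg_mul_apply, h.reg_bs, map_smul, lp.coeFn_smul, Pi.smul_apply,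
    inner_smul_right, coeff_apply]

theorem coeff_zero (x : CG q) : coeff q (diagIdx 0) (diagIdx 0) (y * x) = 0 := by
  rw [diagIdx, h.coeff_mul_left, h.1, zero_mul]

/-- Moving y from the left to the right shifts the position by (1, -s, 0). Translation by (s, 1) in
the last two indices, which commutes with the representation, restores the diagonal position. -/
theorem coeff_succ (x : CG q) (n : ℕ) :
    coeff q (diagIdx (n + 1)) (diagIdx (n + 1)) (y * x) =
      coeff q (diagIdx n) (diagIdx n) (x * y) := by
  rw [diagIdx, diagIdx, h.coeff_mul_left, h.coeff_mul_right,
    ← coeff_translate q s 1 n (n + 1) 0 (0 - s) n n]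
  simp

/-- The modular property of the Haar state. -/
theorem haar_mul_comm (x : CG q) : haar q (y * x) = (q : ℂ) ^ 2 * haar q (x * y) := by
  have h1 := hasSum_haar q (y * x)
  have h2 := (hasSum_haar q (x * y)).mul_left ((q : ℂ) ^ 2)
  rw [← hasSum_nat_add_iff' 1] at h1
  simp only [Finset.sum_range_one, h.coeff_zero, mul_zero, sub_zero, h.coeff_succ] at h1
  have e : ∀ n, ((1 - q ^ 2) * (q ^ 2) ^ (n + 1) : ℝ) * coeff q (diagIdx n) (diagIdx n) (x * y) =
      (q : ℂ) ^ 2 * (((1 - q ^ 2) * (q ^ 2) ^ n : ℝ) * coeff q (diagIdx n) (diagIdx n) (x * y)) := by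
    intro n; push_cast; ring
  rw [funext e] at h1
  exact h1.unique h2

/-- Since ξ acts by q²ⁿ, h(z) is (1 - q²) times the plain trace of zξ = yx - xy. The bound on the
weights makes the diagonal of yx summable, and by `coeff_succ` the trace of the commutator
telescopes to its first term, which is zero. -/
theorem haar_eq_zero (hw : ∀ n, ‖w n‖ ≤ |q| ^ n) (x z : CG q)
    (hz : z * ψ q (xi q) = y * x - x * y) : haar q z = 0 := by
  have hs : Summable fun n => coeff q (diagIdx n) (diagIdx n) (y * x) := by
    refine Summable.of_norm_bounded (g := fun n => |q| ^ n * ‖x‖)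
      ((summable_geometric_of_lt_one (abs_nonneg q) hq.out).mul_right _) fun n => ?_
    rw [diagIdx, h.coeff_mul_left, norm_mul]
    exact mul_le_mul (hw n) (norm_coeff_le _ _ _ _) (norm_nonneg _) (by positivity)
  have h1 : HasSum (fun n => coeff q (diagIdx n) (diagIdx n) (y * x) -
      coeff q (diagIdx (n + 1)) (diagIdx (n + 1)) (y * x)) 0 := by
    have h2 := (hasSum_nat_add_iff' 1).2 hs.hasSum
    rw [Finset.sum_range_one, h.coeff_zero, sub_zero] at h2
    simpa using hs.hasSum.sub h2
  simp only [h.coeff_succ, ← map_sub, ← hz] at h1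
  have h3 := (h1.mul_left ((1 - q ^ 2 : ℝ) : ℂ))
  rw [mul_zero] at h3
  have e : ∀ n, ((1 - q ^ 2 : ℝ) : ℂ) * coeff q (diagIdx n) (diagIdx n) (z * ψ q (xi q)) =
      ((1 - q ^ 2) * (q ^ 2) ^ n : ℝ) * coeff q (diagIdx n) (diagIdx n) z := by
    intro n
    rw [diagIdx, coeff_mul_xi]
    push_cast; ring
  rw [funext e] at h3
  exact (hasSum_haar q z).unique h3

end Raises

theorem haar_star_u00_mul (x : CG q) :
    haar q (star (u q 0 0) * x) = (q : ℂ) ^ 2 * haar q (x * star (u q 0 0)) :=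
  raises_star_u00.haar_mul_comm x

theorem haar_star_eta_mul (x : CG q) :
    haar q (ψ q (star (eta q)) * x) = (q : ℂ) ^ 2 * haar q (x * ψ q (star (eta q))) :=
  raises_star_eta.haar_mul_comm x

theorem haar_eq_zero_of_mul_xi (x z : CG q)
    (hz : z * ψ q (xi q) = ψ q (star (eta q)) * x - x * ψ q (star (eta q))) : haar q z = 0 := by
  refine raises_star_eta.haar_eq_zero (fun n => ?_) x z hz
  rw [norm_mul, norm_pow, Complex.norm_real, Complex.norm_real, Real.norm_eq_abs, Real.norm_eq_abs]
  exact mul_le_of_le_one_right (by positivity) (abs_sqrt_one_sub_le _ (by positivity))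

theorem haar_mul_xi (x : CG q) : haar q (x * ψ q (xi q)) = haar q (ψ q (xi q) * x) := by
  have e : ∀ n, coeff q (diagIdx n) (diagIdx n) (x * ψ q (xi q)) =
      coeff q (diagIdx n) (diagIdx n) (ψ q (xi q) * x) := by
    intro n
    rw [diagIdx, coeff_mul_xi, coeff_apply, coeff_apply, reg_mul_apply, reg_ψ_xi_apply,
      inner_smul_right]
  have h := hasSum_haar q (x * ψ q (xi q))
  simp only [e] at h
  exact h.unique (hasSum_haar q _)

end Modular

/-! ### The bigrading of C(SU_q(2)). -/

section Grading

variable (q : ℝ) [hq : Fact (|q| < 1)] [NeZero q]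

/-- `x` has left degree `s` and right degree `t`. -/
def HasDeg (x : CG q) (s t : ℤ) : Prop :=
  ∀ (f : RegHilbert) (v w : ℤ),
    (∀ (n : ℕ) (m r : ℤ), ¬(r - n - m = v ∧ r - n + m = w) → f (n, m, r) = 0) →
    ∀ (n : ℕ) (m r : ℤ), ¬(r - n - m = v + s ∧ r - n + m = w + t) → reg q x f (n, m, r) = 0

variable {q}

theorem HasDeg.mul {x y : CG q} {s t s' t' : ℤ} (hx : HasDeg q x s t) (hy : HasDeg q y s' t') :
    HasDeg q (x * y) (s + s') (t + t') := by
  intro f v w hf n m r h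
  rw [reg_mul_apply]
  refine hx _ (v + s') (w + t') (hy f v w hf) n m r ?_
  convert h using 3 <;> ring

theorem HasDeg.add {x y : CG q} {s t : ℤ} (hx : HasDeg q x s t) (hy : HasDeg q y s t) :
    HasDeg q (x + y) s t := by
  intro f v w hf n m r h
  rw [map_add, add_apply, lp.coeFn_add, Pi.add_apply, hx f v w hf n m r h, hy f v w hf n m r h,
    add_zero]

theorem HasDeg.smul {x : CG q} {s t : ℤ} (c : ℂ) (hx : HasDeg q x s t) : HasDeg q (c • x) s t := by
  intro f v w hf n m r h
  rw [map_smul (reg q) c x, smul_apply, lp.coeFn_smul, Pi.smul_apply, hx f v w hf n m r h,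
    smul_zero]

theorem HasDeg.zero {s t : ℤ} : HasDeg q (0 : CG q) s t := by
  intro f v w hf n m r h
  rw [map_zero]; rfl

theorem HasDeg.one : HasDeg q (1 : CG q) 0 0 := by
  intro f v w hf n m r h
  rw [map_one]
  exact hf n m r (by simpa using h)

theorem HasDeg.pow {x : CG q} {s t : ℤ} (hx : HasDeg q x s t) (n : ℕ) :
    HasDeg q (x ^ n) (n * s) (n * t) := by
  induction n with
  | zero => simpa using HasDeg.one
  | succ n ih => rw [pow_succ]; convert ih.mul hx using 1 <;> push_cast <;> ring

theorem hasDeg_u00 : HasDeg q (u q 0 0) 1 1 := by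
  intro f v w hf n m r h
  rw [reg_u00_apply, hf, smul_zero]
  push_cast
  omega

theorem hasDeg_star_u00 : HasDeg q (star (u q 0 0)) (-1) (-1) := by
  intro f v w hf n m r h
  rw [reg_star_u00_apply]
  rcases n with _ | n
  · simp
  · rw [hf, smul_zero]
    rw [Nat.add_sub_cancel]
    push_cast at h ⊢
    omega

theorem hasDeg_u10 : HasDeg q (u q 1 0) (-1) 1 := by
  intro f v w hf n m r h
  rw [reg_u10_apply, hf, smul_zero]
  omega

theorem hasDeg_star_u10 : HasDeg q (star (u q 1 0)) 1 (-1) := by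
  intro f v w hf n m r h
  rw [reg_star_u10_apply, hf, smul_zero]
  omega

theorem hasDeg_u11 : HasDeg q (u q 1 1) (-1) (-1) := by
  rw [(isSUq2_u q).facts.1]; exact hasDeg_star_u00

theorem hasDeg_u01 : HasDeg q (u q 0 1) 1 (-1) := by
  rw [(isSUq2_u q).facts.2.1]; exact hasDeg_star_u10.smul _

theorem hasDeg_ψ_xi : HasDeg q (ψ q (xi q)) 0 0 := by
  rw [ψ_xi]; exact hasDeg_star_u10.mul hasDeg_u10

theorem hasDeg_ψ_eta : HasDeg q (ψ q (eta q)) 0 2 := by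
  rw [ψ_eta]; exact hasDeg_u00.mul hasDeg_u10

theorem hasDeg_ψ_star_eta : HasDeg q (ψ q (star (eta q))) 0 (-2) := by
  rw [map_star, ψ_eta, star_mul]; exact hasDeg_star_u10.mul hasDeg_star_u00

theorem vac_apply_eq_zero (n : ℕ) (m r : ℤ) (h : ¬(r - n - m = 0 ∧ r - n + m = 0)) :
    vac q (n, m, r) = 0 := by
  rw [vac, vacMap, spread_apply, vacCoeff_eq_zero]
  · simp
  · rintro k hk
    simp only [diagIdx, Prod.mk.injEq] at hk
    omega

/-- The vacuum has bidegree (0, 0), so elements of different bidegree send it to functions with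
disjoint supports. -/
theorem haar_star_mul_eq_zero {x y : CG q} {s t s' t' : ℤ} (hy : HasDeg q y s t)
    (hx : HasDeg q x s' t') (h : s ≠ s' ∨ t ≠ t') : haar q (star y * x) = 0 := by
  rw [haar_star_mul, lp.inner_eq_tsum]
  refine (tsum_congr fun j => ?_).trans tsum_zero
  obtain ⟨n, m, r⟩ := j
  by_cases h1 : r - n - m = 0 + s ∧ r - n + m = 0 + t
  · rw [hx (vac q) 0 0 (vac_apply_eq_zero (q := q)) n m r (by omega), inner_zero_right]
  · rw [hy (vac q) 0 0 (vac_apply_eq_zero (q := q)) n m r h1, inner_zero_left]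

theorem haar_eq_zero_of_hasDeg {x : CG q} {s t : ℤ} (hx : HasDeg q x s t) (h : s ≠ 0 ∨ t ≠ 0) :
    haar q x = 0 := by
  have := haar_star_mul_eq_zero HasDeg.one hx (by omega)
  rwa [star_one, one_mul] at this

end Grading

/-! ### Strict positivity and linear independence of monomials. -/

section Independence

variable (q : ℝ) [hq : Fact (|q| < 1)] [NeZero q]

/-- `x` acts as a weighted shift with nonzero weights that lowers the first index by `p`. -/
def LowersBy (x : CG q) (p : ℕ) (s : ℤ) : Prop :=
  ∃ w : ℕ → ℂ, (∀ n, w n ≠ 0) ∧ ∀ (f : RegHilbert) (n : ℕ) (m r : ℤ),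
    reg q x f (n, m, r) = w n • f (n + p, m + s, r)

/-- `x` acts as a weighted shift that raises the first index by `p`. -/
def RaisesBy (x : CG q) (p : ℕ) (s : ℤ) : Prop :=
  ∃ w : ℕ → ℂ, (∀ n, w n = 0 ↔ n < p) ∧ ∀ (f : RegHilbert) (n : ℕ) (m r : ℤ),
    reg q x f (n, m, r) = w n • f (n - p, m + s, r)

variable {q}

theorem LowersBy.mul {x y : CG q} {p p' : ℕ} {s s' : ℤ} (hx : LowersBy q x p s)
    (hy : LowersBy q y p' s') : LowersBy q (x * y) (p + p') (s + s') := by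
  obtain ⟨w, h1, h2⟩ := hx
  obtain ⟨w', h1', h2'⟩ := hy
  refine ⟨fun n => w n * w' (n + p), fun n => mul_ne_zero (h1 _) (h1' _), fun f n m r => ?_⟩
  rw [reg_mul_apply, h2, h2', smul_smul, add_assoc, add_assoc]

theorem RaisesBy.mul {x y : CG q} {p p' : ℕ} {s s' : ℤ} (hx : RaisesBy q x p s)
    (hy : RaisesBy q y p' s') : RaisesBy q (x * y) (p + p') (s + s') := by
  obtain ⟨w, h1, h2⟩ := hx
  obtain ⟨w', h1', h2'⟩ := hy
  refine ⟨fun n => w n * w' (n - p), fun n => ?_, fun f n m r => ?_⟩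
  · rw [mul_eq_zero, h1, h1']; omega
  · rw [reg_mul_apply, h2, h2', smul_smul, Nat.sub_sub, add_assoc]

theorem LowersBy.one : LowersBy q (1 : CG q) 0 0 :=
  ⟨1, fun _ => one_ne_zero, fun f n m r => by rw [map_one]; simp⟩

theorem RaisesBy.one : RaisesBy q (1 : CG q) 0 0 :=
  ⟨1, fun _ => by simp, fun f n m r => by rw [map_one]; simp⟩

theorem LowersBy.pow {x : CG q} {p : ℕ} {s : ℤ} (hx : LowersBy q x p s) (k : ℕ) :
    LowersBy q (x ^ k) (k * p) (k * s) := by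
  induction k with
  | zero => simpa using LowersBy.one
  | succ k ih => rw [pow_succ]; convert ih.mul hx using 1 <;> push_cast <;> ring

theorem RaisesBy.pow {x : CG q} {p : ℕ} {s : ℤ} (hx : RaisesBy q x p s) (k : ℕ) :
    RaisesBy q (x ^ k) (k * p) (k * s) := by
  induction k with
  | zero => simpa using RaisesBy.one
  | succ k ih => rw [pow_succ]; convert ih.mul hx using 1 <;> push_cast <;> ring

theorem sqrt_one_sub_pow_ne_zero (n : ℕ) : √(1 - (q ^ 2) ^ (n + 1)) ≠ 0 := by
  refine (Real.sqrt_pos.2 (sub_pos.2 ?_)).ne'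
  exact pow_lt_one₀ (sq_nonneg q) (q_sq_lt_one q) n.succ_ne_zero

omit hq in
theorem q_ne_zero : (q : ℂ) ≠ 0 := by exact_mod_cast NeZero.ne q

theorem lowersBy_u00 : LowersBy q (u q 0 0) 1 0 :=
  ⟨_, fun n => Complex.ofReal_ne_zero.2 (sqrt_one_sub_pow_ne_zero n), fun f n m r => by
    rw [reg_u00_apply, add_zero]⟩

theorem lowersBy_u10 : LowersBy q (u q 1 0) 0 (-1) :=
  ⟨_, fun n => pow_ne_zero n q_ne_zero, fun f n m r => by
    rw [reg_u10_apply, add_zero]; rfl⟩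

theorem lowersBy_star_u10 : LowersBy q (star (u q 1 0)) 0 1 :=
  ⟨_, fun n => pow_ne_zero n q_ne_zero, fun f n m r => by
    rw [reg_star_u10_apply, add_zero]⟩

theorem raisesBy_star_u00 : RaisesBy q (star (u q 0 0)) 1 0 := by
  refine ⟨_, fun n => ?_, fun f n m r => by rw [reg_star_u00_apply, add_zero]⟩
  rcases n with _ | n
  · simp
  · have := sqrt_one_sub_pow_ne_zero (q := q) n
    simpa using this

theorem raisesBy_star_u10 : RaisesBy q (star (u q 1 0)) 0 1 := by
  refine ⟨_, fun n => ?_, fun f n m r => by rw [reg_star_u10_apply, Nat.sub_zero]⟩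
  have := pow_ne_zero n (q_ne_zero (q := q))
  simpa using this

/-- The monomial `cⁱ aᵖ`. -/
def mono (q : ℝ) (i p : ℕ) : CG q := u q 1 0 ^ i * u q 0 0 ^ p

theorem lowersBy_mono (i p : ℕ) : LowersBy q (mono q i p) p (-i) := by
  simpa [mono] using (lowersBy_u10.pow i).mul (lowersBy_u00.pow p)

theorem raisesBy_star_mono (i p : ℕ) : RaisesBy q (star (mono q i p)) p i := by
  rw [mono, star_mul, star_pow, star_pow]
  simpa using (raisesBy_star_u00.pow p).mul (raisesBy_star_u10.pow i)

theorem hasDeg_mono (i p : ℕ) : HasDeg q (mono q i p) (p - i) (p + i) := by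
  have h := (hasDeg_u10.pow i).mul (hasDeg_u00.pow (q := q) p)
  rwa [show (i : ℤ) * -1 + p * 1 = p - i by ring, show (i : ℤ) * 1 + p * 1 = p + i by ring] at h

/-- The value is ‖xΩ‖² for the vacuum Ω. This gives strict positivity for the elements in use
without a proof that h is faithful. -/
theorem haar_star_mul_self_pos {x : CG q} {p : ℕ} {s : ℤ} (hx : LowersBy q x p s) :
    0 < (haar q (star x * x)).re ∧ (haar q (star x * x)).im = 0 := by
  obtain ⟨w, h1, h2⟩ := hx
  rw [haar_star_mul, inner_self_eq_norm_sq_to_K (𝕜 := ℂ)]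
  have h3 : reg q x (vac q) ≠ 0 := by
    intro h
    -- The index (0, -s, p) is the one that x maps to (p, 0, p), where the vacuum does not vanish.
    have h4 := h2 (vac q) 0 (-s) p
    rw [h, neg_add_cancel, Nat.zero_add, vac, vacMap, spread_apply,
      show ((p, 0, (p : ℤ)) : Idx) = diagIdx p from rfl, vacCoeff_diagIdx, smul_smul] at h4
    have h5 := (smul_eq_zero.1 h4.symm).resolve_right (by
      intro h6; have := norm_unitVec; rw [h6, norm_zero] at this; exact zero_ne_one this)
    refine (mul_ne_zero (h1 0) (Complex.ofReal_ne_zero.2 (mul_ne_zero ?_ ?_))) h5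
    · exact (Real.sqrt_pos.2 (sub_pos.2 (q_sq_lt_one q))).ne'
    · exact pow_ne_zero _ (NeZero.ne q)
  have h4 : 0 < ‖reg q x (vac q)‖ ^ 2 := by positivity
  have h5 : ((‖reg q x (vac q)‖ : ℂ)) ^ 2 = ((‖reg q x (vac q)‖ ^ 2 : ℝ) : ℂ) := by push_cast; rfl
  constructor
  · simpa [h5, -Complex.ofReal_pow] using h4
  · simp [h5, -Complex.ofReal_pow]

/-- From position N the product first goes down by p through a*ᵖ, which is possible without a
vanishing weight exactly when p ≤ N; all other weights are nonzero. This is the triangularity behind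
the linear independence below. -/
theorem coeff_star_mono_mul_mono (i p s N : ℕ) :
    coeff q (N, 0, 0) (N + s, -s, 0) (star (mono q i p) * mono q (i + s) (p + s)) = 0 ↔ N < p := by
  obtain ⟨w, hw1, hw2⟩ := raisesBy_star_mono (q := q) i p
  obtain ⟨w', hw1', hw2'⟩ := lowersBy_mono (q := q) (i + s) (p + s)
  rw [coeff_apply, reg_mul_apply, hw2, hw2', smul_smul, inner_smul_right, ← hw1 N]
  by_cases hN : N < p
  · simp [(hw1 N).2 hN]
  · rw [bs_apply, if_pos, inner_unitVec, mul_one, mul_eq_zero, or_iff_left (hw1' _)]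
    refine Prod.ext ?_ (Prod.ext ?_ rfl)
    · change N - p + (p + s) = N + s; omega
    · change 0 + (i : ℤ) + -((i + s : ℕ) : ℤ) = -s; push_cast; ring

/-- Products of monomials of the same bidegree are linearly independent. -/
theorem eq_zero_of_sum_star_mono_mul_mono (n s : ℕ) (z : ℕ → ℂ)
    (h : ∑ i ∈ Finset.range (n + 1), z i • (star (mono q i (n - i)) * mono q (i + s) (n - i + s)) = 0) :
    ∀ i ≤ n, z i = 0 := by
  -- The induction is on the power n - i of a. At level N the terms with n - j > N have coefficient
  -- zero, those with n - j < N are already removed, and only j = i is left.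
  suffices H : ∀ N, ∀ i ≤ n, n - i = N → z i = 0 from fun i hi => H _ i hi rfl
  intro N
  induction N using Nat.strong_induction_on with
  | _ N ih =>
    intro i hi hN
    have h1 := congrArg (coeff q (N, 0, 0) (N + s, -s, 0)) h
    rw [map_sum, map_zero, Finset.sum_eq_single_of_mem i (Finset.mem_range.2 (by omega)), map_smul,
      smul_eq_mul] at h1
    · refine (mul_eq_zero.1 h1).resolve_right fun h2 => ?_
      rw [coeff_star_mono_mul_mono] at h2
      omega
    · intro j hj hji
      have hj' := Finset.mem_range.1 hj
      rw [map_smul, smul_eq_mul, mul_eq_zero]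
      by_cases h3 : n - j < N
      · exact Or.inl (ih _ h3 j (by omega) rfl)
      · right
        rw [coeff_star_mono_mul_mono]
        omega

end Independence

open Presentation

/-! ### The spectral subspaces of the sphere -/

section Step

variable {B : Type} [Ring B] [Algebra ℂ B]

/-- The inductive step of `sph_commutator`, with K = q²ᵏ, s = qˡ and W, X, Y, Z standing for sph k
at l+1, l, l-1, l-2. Denominators are cleared, and the factors 1 - s² and q² - s² vanish at s = 1
and s = q, so that the boundary cases with Y = 0 or Z = 0 are covered by the same statement. -/
theorem commutator_step {ξ η ηs z X Y Z W : B} {q s K : ℂ}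
    (hz : z = 1 - (1 + q ^ 2) • ξ)    (h1 : ηs * η = ξ - ξ * ξ) (h2 : η * ηs = q ^ 2 • ξ - q ^ 4 • (ξ * ξ))
    (h3 : ξ * ηs = q ^ 2 • (ηs * ξ))
    (hX : K • (ηs * X - X * ηs) = (q * s * (1 - q ^ 2 * s ^ 2)) • (W * ξ))
    (hY : K • (ηs * Y - Y * ηs) = (s * (1 - s ^ 2)) • (X * ξ))
    (hZ : (q ^ 3 * K) • (ηs * Z - Z * ηs) = (s * (q ^ 2 - s ^ 2)) • (Y * ξ))
    (hXξ : s ^ 2 • (X * ξ) = K • (ξ * X)) (hYξ : s ^ 2 • (Y * ξ) = (q ^ 2 * K) • (ξ * Y)) :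
    (q ^ 2 * K) • (ηs * (s ^ 2 • (η * X) + s • (z * Y) + (-q) • (ηs * Z)) -
      (s ^ 2 • (η * X) + s • (z * Y) + (-q) • (ηs * Z)) * ηs) =
    (q * s * (1 - q ^ 2 * s ^ 2)) • (((q ^ 2 * s ^ 2) • (η * W) +
      (q * s) • (z * X) + (-q) • (ηs * Y)) * ξ) := by
  subst hz
  have r1 : ηs * (η * X) = ξ * X - ξ * (ξ * X) := by rw [← mul_assoc, h1, sub_mul, mul_assoc]
  have r2 : η * (ηs * X) = q ^ 2 • (ξ * X) - q ^ 4 • (ξ * (ξ * X)) := by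
    rw [← mul_assoc, h2, sub_mul, smul_mul_assoc, smul_mul_assoc, mul_assoc]
  have r3 : ξ * (ηs * Y) = q ^ 2 • (ηs * (ξ * Y)) := by
    rw [← mul_assoc, h3, smul_mul_assoc, mul_assoc]
  have a1 := congrArg (η * ·) hX
  have a2 := congrArg (ξ * ·) hY
  have a3 := congrArg (ηs * ·) hZ
  have b1 := congrArg (ξ * ·) hXξ
  have b2 := congrArg (ηs * ·) hYξ
  simp only [mul_sub, sub_mul, mul_add, add_mul, smul_mul_assoc, mul_smul_comm, mul_assoc, one_mul,
    mul_one, smul_sub, smul_add, smul_smul, r1, r2, r3] at *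
  linear_combination (norm := module) (q ^ 2 * s ^ 2) • a1 + (q ^ 2 * s) • hY -
    ((1 + q ^ 2) * q ^ 2 * s) • a2 - a3 - (q ^ 2 * s ^ 2 * (1 - q ^ 2)) • hXξ +
    (q ^ 2 * s ^ 2 * (1 - q ^ 4)) • b1 + ((1 - q ^ 4) * s) • b2

end Step

section Spectral

variable (q : ℝ)

/-- The degree-zero generator `1 - (1 + q²) ξ`. -/
def zeta : CS q := 1 - (1 + (q : ℂ) ^ 2) • xi q

/-- A basis of the spin-`k` spectral subspace of the sphere. -/
def sph : ℕ → ℕ → CS q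
  | 0, 0 => 1
  | 0, _ + 1 => 0
  | k + 1, 0 => eta q * sph k 0
  | k + 1, 1 => (q : ℂ) ^ 2 • (eta q * sph k 1) + (q : ℂ) • (zeta q * sph k 0)
  | k + 1, l + 2 => ((q : ℂ) ^ (l + 2)) ^ 2 • (eta q * sph k (l + 2)) +
      (q : ℂ) ^ (l + 2) • (zeta q * sph k (l + 1)) + (-(q : ℂ)) • (star (eta q) * sph k l)

theorem sph_zero_zero : sph q 0 0 = 1 := rfl

theorem sph_zero_right (k : ℕ) : sph q k 0 = eta q ^ k := by
  induction k with
  | zero => rfl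
  | succ k ih => rw [sph, ih, pow_succ']

theorem sph_eq_zero : ∀ k l : ℕ, 2 * k < l → sph q k l = 0
  | 0, 0, h => absurd h (by simp)
  | 0, l + 1, _ => rfl
  | k + 1, 0, h => absurd h (by simp)
  | k + 1, 1, h => absurd h (by omega)
  | k + 1, l + 2, h => by
    rw [sph, sph_eq_zero k (l + 2) (by omega), sph_eq_zero k (l + 1) (by omega),
      sph_eq_zero k l (by omega)]
    simp

theorem star_eta_mul_eta : star (eta q) * eta q = xi q - xi q * xi q := by
  rw [(isPodles_gen q).star_eta_mul, pow_two]

theorem eta_mul_star_eta :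
    eta q * star (eta q) = (q : ℂ) ^ 2 • xi q - (q : ℂ) ^ 4 • (xi q * xi q) := by
  rw [(isPodles_gen q).eta_mul_star, pow_two (xi q)]

theorem star_xi : star (xi q) = xi q := (isPodles_gen q).star_xi

theorem eta_mul_xi : eta q * xi q = (q : ℂ) ^ 2 • (xi q * eta q) := (isPodles_gen q).eta_xi

theorem xi_mul_star_eta : xi q * star (eta q) = (q : ℂ) ^ 2 • (star (eta q) * xi q) := by
  have := congrArg star (eta_mul_xi q)
  simpa [star_xi, -Complex.coe_smul] using this

theorem zeta_mul_xi : zeta q * xi q = xi q * zeta q := by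
  simp only [zeta, sub_mul, mul_sub, one_mul, mul_one, smul_mul_assoc, mul_smul_comm]

theorem sph_mul_xi : ∀ k l : ℕ,
    ((q : ℂ) ^ l) ^ 2 • (sph q k l * xi q) = ((q : ℂ) ^ k) ^ 2 • (xi q * sph q k l)
  | 0, 0 => by simp [sph]
  | 0, l + 1 => by simp [sph]
  | k + 1, 0 => by
    have h := congrArg (eta q * ·) (sph_mul_xi k 0)
    have e : eta q * (xi q * sph q k 0) = (q : ℂ) ^ 2 • (xi q * (eta q * sph q k 0)) := by
      rw [← mul_assoc, eta_mul_xi, smul_mul_assoc, mul_assoc]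
    rw [sph]
    simp only [mul_smul_comm, mul_assoc, e] at h ⊢
    linear_combination (norm := module) h
  | k + 1, 1 => by
    have h := congrArg (eta q * ·) (sph_mul_xi k 1)
    have h' := congrArg (zeta q * ·) (sph_mul_xi k 0)
    have e : eta q * (xi q * sph q k 1) = (q : ℂ) ^ 2 • (xi q * (eta q * sph q k 1)) := by
      rw [← mul_assoc, eta_mul_xi, smul_mul_assoc, mul_assoc]
    have e' : zeta q * (xi q * sph q k 0) = xi q * (zeta q * sph q k 0) := by
      rw [← mul_assoc, zeta_mul_xi, mul_assoc]
    rw [sph]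
    simp only [mul_smul_comm, mul_assoc, e, e', mul_add, add_mul, smul_mul_assoc] at h h' ⊢
    linear_combination (norm := module) (q : ℂ) ^ 2 • h + (q : ℂ) ^ 3 • h'
  | k + 1, l + 2 => by
    have h := congrArg (eta q * ·) (sph_mul_xi k (l + 2))
    have h' := congrArg (zeta q * ·) (sph_mul_xi k (l + 1))
    have h'' := congrArg (star (eta q) * ·) (sph_mul_xi k l)
    have e : eta q * (xi q * sph q k (l + 2)) = (q : ℂ) ^ 2 • (xi q * (eta q * sph q k (l + 2))) := by
      rw [← mul_assoc, eta_mul_xi, smul_mul_assoc, mul_assoc]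
    have e' : zeta q * (xi q * sph q k (l + 1)) = xi q * (zeta q * sph q k (l + 1)) := by
      rw [← mul_assoc, zeta_mul_xi, mul_assoc]
    have e'' : xi q * (star (eta q) * sph q k l) =
        (q : ℂ) ^ 2 • (star (eta q) * (xi q * sph q k l)) := by
      rw [← mul_assoc, xi_mul_star_eta, smul_mul_assoc, mul_assoc]
    rw [sph]
    simp only [mul_smul_comm, mul_assoc, e, e', e'', mul_add, add_mul, smul_mul_assoc] at h h' h'' ⊢
    linear_combination (norm := module) ((q : ℂ) ^ (l + 2)) ^ 2 • h +
      ((q : ℂ) ^ (l + 2) * (q : ℂ) ^ 2) • h' - ((q : ℂ) ^ 5) • h''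

/-- The commutator with η* serves as a lowering operator. The identity is arranged to exhibit sph k
(l+1) · ξ as a multiple of a commutator with η*, the form in which the Haar state is seen to vanish
on sph k (l+1). -/
theorem sph_commutator : ∀ k l : ℕ,
    ((q : ℂ) ^ k) ^ 2 • (star (eta q) * sph q k l - sph q k l * star (eta q)) =
      ((q : ℂ) * (q : ℂ) ^ l * (1 - (q : ℂ) ^ 2 * ((q : ℂ) ^ l) ^ 2)) • (sph q k (l + 1) * xi q)
  | 0, 0 => by simp [sph]
  | 0, l + 1 => by simp [sph]
  | k + 1, 0 => by
    have h := commutator_step (Y := 0) (Z := 0) (z := zeta q) rfl (star_eta_mul_eta q)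
      (eta_mul_star_eta q) (xi_mul_star_eta q) (sph_commutator k 0) (by simp) (by simp)
      (sph_mul_xi q k 0) (by simp)
    simp only [sph, zero_add, pow_zero, one_pow, one_smul, mul_zero, smul_zero, add_zero, mul_one]
      at h ⊢
    linear_combination (norm := module) h
  | k + 1, 1 => by
    have h := commutator_step (X := sph q k 1) (Y := sph q k 0) (Z := 0) (z := zeta q) rfl (star_eta_mul_eta q) (eta_mul_star_eta q)
      (xi_mul_star_eta q) (sph_commutator k 1)
      (by linear_combination (norm := module) sph_commutator k 0) (by simp)
      (sph_mul_xi q k 1) (by linear_combination (norm := module) (q : ℂ) ^ 2 • sph_mul_xi q k 0)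
    simp only [sph, mul_zero, smul_zero, add_zero, mul_add, add_mul, mul_smul_comm, smul_mul_assoc,
      Nat.reduceAdd, zero_add] at h ⊢
    linear_combination (norm := module) h
  | k + 1, l + 2 => by
    have h := commutator_step (X := sph q k (l + 2)) (Y := sph q k (l + 1)) (Z := sph q k l)
      (z := zeta q) rfl (star_eta_mul_eta q) (eta_mul_star_eta q)
      (xi_mul_star_eta q) (sph_commutator k (l + 2))
      (by linear_combination (norm := module) sph_commutator k (l + 1))
      (by linear_combination (norm := module) (q : ℂ) ^ 3 • sph_commutator k l)
      (sph_mul_xi q k (l + 2))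
      (by linear_combination (norm := module) (q : ℂ) ^ 2 • sph_mul_xi q k (l + 1))
    simp only [sph, mul_add, add_mul, mul_smul_comm, smul_mul_assoc, add_assoc, Nat.reduceAdd] at h ⊢
    linear_combination (norm := module) h

end Spectral

open Presentation

/-! ### The coaction on powers of η and matrix coefficients of monomials. -/

section Coaction

variable (q : ℝ) [NeZero q]

theorem u00_mul_u10 : u q 0 0 * u q 1 0 = (q : ℂ) • (u q 1 0 * u q 0 0) :=
  (isSUq2_u q).facts.2.2.2.2.1

theorem u00_mul_u01 : u q 0 0 * u q 0 1 = (q : ℂ) • (u q 0 1 * u q 0 0) :=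
  sub_eq_zero.1 (isSUq2_u q).det00

theorem mul_pow_of_mul_eq_smul {B : Type} [Ring B] [Algebra ℂ B] {x y : B} {c : ℂ}
    (h : x * y = c • (y * x)) (n : ℕ) : x * y ^ n = c ^ n • (y ^ n * x) := by
  induction n with
  | zero => simp
  | succ n ih => rw [pow_succ, ← mul_assoc, ih, smul_mul_assoc, mul_assoc, h, mul_smul_comm,
      smul_smul, ← mul_assoc, pow_succ]

theorem u00_mul_mono (i p : ℕ) : u q 0 0 * mono q i p = (q : ℂ) ^ i • mono q i (p + 1) := by
  rw [mono, ← mul_assoc, mul_pow_of_mul_eq_smul (u00_mul_u10 q), smul_mul_assoc, mul_assoc,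
    ← pow_succ', mono]

theorem u10_mul_mono (i p : ℕ) : u q 1 0 * mono q i p = mono q (i + 1) p := by
  rw [mono, ← mul_assoc, ← pow_succ', mono]

theorem τ_eta : τ q (eta q) = inl _ _ (eta q) * inr _ _ (mono q 0 2) +
    (q : ℂ) • (inl _ _ (zeta q) * inr _ _ (mono q 1 1)) +
    (-(q : ℂ)) • (inl _ _ (star (eta q)) * inr _ _ (mono q 2 0)) := by
  have h : τ q (eta q) = actEta q (inl _ _ (xi q)) (inl _ _ (eta q))
    ((u q).map (inr (sphere q) (suq2 q))) := lift_gen _ _ _ _ _ 1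
  have h1 : mono q 1 1 = u q 1 0 * u q 0 0 := by simp [mono]
  have h2 : mono q 0 2 = u q 0 0 * u q 0 0 := by simp [mono, pow_two]
  have h3 : mono q 2 0 = u q 1 0 * u q 1 0 := by simp [mono, pow_two]
  rw [h, actEta, h1, h2, h3]
  simp only [Matrix.map_apply, ← map_mul, ← map_star, u00_mul_u10, map_smul, zeta, map_sub, map_one]
  simp only [map_mul, sub_mul, one_mul, smul_mul_assoc, mul_smul_comm]
  module

/-- A sum over `range` in which two terms of a recursion are shifted. -/
theorem sum_range_shift_two {M : Type} [AddCommGroup M] (F G H E : ℕ → M) (n : ℕ)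
    (h0 : E 0 = F 0) (h1 : E 1 = F 1 + G 0) (h2 : ∀ l, E (l + 2) = F (l + 2) + G (l + 1) + H l)
    (hF : F (n + 1) = 0) (hF' : F (n + 2) = 0) (hG : G (n + 1) = 0) :
    ∑ l ∈ Finset.range (n + 3), E l =
      ∑ l ∈ Finset.range (n + 1), (F l + G l + H l) := by
  have hF1 : ∑ l ∈ Finset.range (n + 1), F l = ∑ l ∈ Finset.range (n + 3), F l := by
    rw [Finset.sum_range_succ _ (n + 2), Finset.sum_range_succ _ (n + 1), hF, hF', add_zero, add_zero]
  have hG1 : ∑ l ∈ Finset.range (n + 1), G l = ∑ l ∈ Finset.range (n + 2), G l := by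
    rw [Finset.sum_range_succ _ (n + 1), hG, add_zero]
  rw [Finset.sum_add_distrib, Finset.sum_add_distrib, hF1, hG1, Finset.sum_range_succ' _ (n + 2),
    Finset.sum_range_succ' _ (n + 1), Finset.sum_range_succ' F (n + 2),
    Finset.sum_range_succ' _ (n + 1), Finset.sum_range_succ' G (n + 1)]
  simp only [add_assoc, Nat.reduceAdd, h0, h1, zero_add]
  simp only [h2, Finset.sum_add_distrib]
  abel

theorem sum_range_shift_one {M : Type} [AddCommGroup M] (F G E : ℕ → M) (n : ℕ)
    (h0 : E 0 = F 0) (h1 : ∀ l, E (l + 1) = F (l + 1) + G l) (hF : F (n + 1) = 0) :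
    ∑ l ∈ Finset.range (n + 2), E l = ∑ l ∈ Finset.range (n + 1), (F l + G l) := by
  have hF1 : ∑ l ∈ Finset.range (n + 1), F l = ∑ l ∈ Finset.range (n + 2), F l := by
    rw [Finset.sum_range_succ _ (n + 1), hF, add_zero]
  rw [Finset.sum_add_distrib, hF1, Finset.sum_range_succ' _ (n + 1), Finset.sum_range_succ' F (n + 1)]
  simp only [h0, h1, Finset.sum_add_distrib]
  abel

theorem mono_two_mul_mono (i p : ℕ) : mono q 0 2 * mono q i p =
    ((q : ℂ) ^ i) ^ 2 • mono q i (p + 2) := by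
  have : mono q 0 2 = u q 0 0 * u q 0 0 := by simp [mono, pow_two]
  rw [this, mul_assoc, u00_mul_mono, mul_smul_comm, u00_mul_mono, smul_smul, pow_two]

theorem mono_one_mul_mono (i p : ℕ) : mono q 1 1 * mono q i p =
    (q : ℂ) ^ i • mono q (i + 1) (p + 1) := by
  have : mono q 1 1 = u q 1 0 * u q 0 0 := by simp [mono]
  rw [this, mul_assoc, u00_mul_mono, mul_smul_comm, u10_mul_mono]

theorem mono_zero_mul_mono (i p : ℕ) : mono q 2 0 * mono q i p = mono q (i + 2) p := by
  have : mono q 2 0 = u q 1 0 * u q 1 0 := by simp [mono, pow_two]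
  rw [this, mul_assoc, u10_mul_mono, u10_mul_mono]

/-- The origin of the recursion for `sph`: multiply the expansion for k by τ(η) = η ⊗ a² + qζ ⊗ ca -
qη* ⊗ c² and collect the coefficient of cˡa²ᵏ⁺²⁻ˡ. The powers of q arise from moving a past cˡ. -/
theorem τ_eta_pow (k : ℕ) : τ q (eta q ^ k) =
    ∑ l ∈ Finset.range (2 * k + 1), inl _ _ (sph q k l) * inr _ _ (mono q l (2 * k - l)) := by
  induction k with
  | zero => simp [sph, mono]
  | succ k ih =>
    rw [pow_succ', map_mul, ih, τ_eta, Finset.mul_sum]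
    rw [show 2 * (k + 1) + 1 = 2 * k + 3 by ring]
    symm
    rw [sum_range_shift_two
      (fun l => ((q : ℂ) ^ l) ^ 2 • (inl _ _ (eta q * sph q k l) * inr _ _ (mono q l (2 * k + 2 - l))))
      (fun l => (q : ℂ) ^ (l + 1) •
        (inl _ _ (zeta q * sph q k l) * inr _ _ (mono q (l + 1) (2 * k + 1 - l))))
      (fun l => (-(q : ℂ)) •
        (inl _ _ (star (eta q) * sph q k l) * inr _ _ (mono q (l + 2) (2 * k - l))))]
    · refine Finset.sum_congr rfl fun l hl => ?_
      have hl' := Finset.mem_range.1 hl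
      rw [add_mul, add_mul, smul_mul_assoc, smul_mul_assoc, tmul_mul_tmul, tmul_mul_tmul,
        tmul_mul_tmul, mono_two_mul_mono, mono_one_mul_mono, mono_zero_mul_mono, map_smul, map_smul,
        show 2 * k - l + 2 = 2 * k + 2 - l by omega, show 2 * k - l + 1 = 2 * k + 1 - l by omega]
      simp only [mul_smul_comm]
      rw [smul_smul, pow_succ' (q : ℂ) l]
    · simp only [sph, pow_zero, one_pow, one_smul]; rfl
    · simp only [sph, pow_one, map_add, map_smul, add_mul, smul_mul_assoc, zero_add]
      rfl
    · intro l
      have e1 : 2 * (k + 1) - (l + 2) = 2 * k - l := by omega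
      have e2 : 2 * k + 2 - (l + 2) = 2 * k - l := by omega
      have e3 : 2 * k + 1 - (l + 1) = 2 * k - l := by omega
      simp only [sph, map_add, map_smul, add_mul, smul_mul_assoc, e1, e2, e3, add_assoc,
        Nat.reduceAdd]
    · simp [sph_eq_zero q k (2 * k + 1) (by omega)]
    · simp [sph_eq_zero q k (2 * k + 2) (by omega)]
    · simp [sph_eq_zero q k (2 * k + 1) (by omega)]

theorem ψid_inl (a : CS q) : ψid q (inl _ _ a) = inl _ _ (ψ q a) := by
  refine hom_ext (f := (ψid q).comp (inl _ _)) (g := (inl _ _).comp (ψ q)) (fun i => ?_) a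
  change ψid q (inl _ _ _) = _
  rw [inl_gen]
  exact lift_gen _ _ _ _ _ (Sum.inl i)

theorem ψid_inr (a : CG q) : ψid q (inr _ _ a) = inr _ _ a := by
  refine hom_ext (f := (ψid q).comp (inr _ _)) (g := inr _ _) (fun i => ?_) a
  change ψid q (inr _ _ _) = _
  rw [inr_gen]
  exact lift_gen _ _ _ _ _ (Sum.inr i)

theorem Δ_ψ_eta_pow (k : ℕ) : Δ q (ψ q (eta q ^ k)) =
    ∑ l ∈ Finset.range (2 * k + 1), inl _ _ (ψ q (sph q k l)) * inr _ _ (mono q l (2 * k - l)) := by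
  rw [← ψid_comp_τ, τ_eta_pow, map_sum]
  simp only [map_mul, ψid_inl, ψid_inr]

/-- One step of the recursion for the matrix coefficients. -/
def tstep (x y : CG q) (T : ℕ → CG q) : ℕ → CG q
  | 0 => x * T 0
  | j + 1 => (q : ℂ) ^ (j + 1) • (x * T (j + 1)) + y * T j

/-- Matrix coefficients of the corepresentation spanned by the monomials `cⁱ aⁿ⁻ⁱ`. -/
def tc : ℕ → ℕ → ℕ → CG q
  | 0, _, 0 => 1
  | 0, _, _ + 1 => 0
  | n + 1, 0, j => tstep q (u q 0 0) (u q 0 1) (tc n 0) j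
  | n + 1, i + 1, j => tstep q (u q 1 0) (u q 1 1) (tc n i) j

theorem tstep_eq_zero {x y : CG q} {T : ℕ → CG q} {n : ℕ} (hT : ∀ j, n < j → T j = 0) (j : ℕ)
    (hj : n + 1 < j) : tstep q x y T j = 0 := by
  rcases j with _ | j
  · omega
  · rw [tstep, hT j (by omega), hT (j + 1) (by omega)]; simp

theorem tc_eq_zero : ∀ n i j : ℕ, n < j → tc q n i j = 0
  | 0, i, 0, h => absurd h (by simp)
  | 0, i, j + 1, h => by rw [tc]
  | n + 1, 0, j, h => by rw [tc]; exact tstep_eq_zero q (tc_eq_zero n 0) j h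
  | n + 1, i + 1, j, h => by rw [tc]; exact tstep_eq_zero q (tc_eq_zero n i) j h

theorem Δ_u (i j : Fin 2) :
    Δ q (u q i j) = ∑ k, inl _ _ (u q i k) * inr _ _ (u q k j) := lift_gen _ _ _ _ _ (i, j)

/-- In the second leg a and c turn cʲaⁿ⁻ʲ into qʲ cʲaⁿ⁺¹⁻ʲ and cʲ⁺¹aⁿ⁻ʲ; `tstep` is the resulting
recursion of the first leg. -/
theorem Δ_step (i : Fin 2) (T : ℕ → CG q) (n : ℕ) (hT : ∀ j, n < j → T j = 0) :
    Δ q (u q i 0) * ∑ j ∈ Finset.range (n + 1), inl _ _ (T j) * inr _ _ (mono q j (n - j)) =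
      ∑ j ∈ Finset.range (n + 2), inl _ _ (tstep q (u q i 0) (u q i 1) T j) *
        inr _ _ (mono q j (n + 1 - j)) := by
  rw [Δ_u, Fin.sum_univ_two, Finset.mul_sum]
  symm
  rw [sum_range_shift_one
    (fun j => (q : ℂ) ^ j • (inl _ _ (u q i 0 * T j) * inr _ _ (mono q j (n + 1 - j))))
    (fun j => inl _ _ (u q i 1 * T j) * inr _ _ (mono q (j + 1) (n - j)))]
  · refine Finset.sum_congr rfl fun l hl => ?_
    have hl' := Finset.mem_range.1 hl
    rw [add_mul, tmul_mul_tmul, tmul_mul_tmul, u00_mul_mono, u10_mul_mono, map_smul,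
      show n - l + 1 = n + 1 - l by omega]
    simp only [mul_smul_comm]
  · simp [tstep]
  · intro l
    simp only [tstep, map_add, map_smul, add_mul, smul_mul_assoc, Nat.add_sub_add_right]
  · simp [hT (n + 1) (by omega)]

theorem Δ_mono : ∀ n i : ℕ, i ≤ n → Δ q (mono q i (n - i)) =
    ∑ j ∈ Finset.range (n + 1), inl _ _ (tc q n i j) * inr _ _ (mono q j (n - j))
  | 0, i, h => by
    obtain rfl : i = 0 := by omega
    simp [mono, tc]
  | n + 1, 0, _ => by
    have h : mono q 0 (n + 1 - 0) = u q 0 0 * mono q 0 (n - 0) := by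
      rw [u00_mul_mono]; simp
    rw [h, map_mul, Δ_mono n 0 (by omega), Δ_step q 0 _ n (tc_eq_zero q n 0)]
    simp only [tc]
  | n + 1, i + 1, hi => by
    rw [← u10_mul_mono, map_mul, Nat.add_sub_add_right, Δ_mono n i (by omega),
      Δ_step q 1 _ n (tc_eq_zero q n i)]
    simp only [tc]

theorem tc_zero_right : ∀ n i : ℕ, i ≤ n → tc q n i 0 = mono q i (n - i)
  | 0, i, h => by
    obtain rfl : i = 0 := by omega
    simp [mono, tc]
  | n + 1, 0, _ => by
    rw [tc, tstep, tc_zero_right n 0 (by omega), u00_mul_mono]; simp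
  | n + 1, i + 1, hi => by
    rw [tc, tstep, tc_zero_right n i (by omega), u10_mul_mono, Nat.add_sub_add_right]

/-- The constants obey a recursion whose coefficients are even powers of q, so they stay positive
also for negative q and no cancellation can make an entry of the top row vanish. -/
theorem tc_zero_left : ∀ n j : ℕ, j ≤ n → ∃ γ : ℝ, 0 < γ ∧
    tc q n 0 j = (γ : ℂ) • (u q 0 1 ^ j * u q 0 0 ^ (n - j))
  | 0, 0, _ => ⟨1, one_pos, by simp [tc]⟩
  | n + 1, 0, _ => by
    obtain ⟨γ, h1, h2⟩ := tc_zero_left n 0 (by omega)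
    refine ⟨γ, h1, ?_⟩
    rw [tc, tstep, h2, mul_smul_comm]
    simp [pow_succ']
  | n + 1, j + 1, h => by
    obtain ⟨γ, h1, h2⟩ := tc_zero_left n j (by omega)
    have hq : 0 < (q ^ (j + 1)) ^ 2 := by have := NeZero.ne q; positivity
    rcases Nat.lt_or_ge n (j + 1) with hj | hj
    · refine ⟨γ, h1, ?_⟩
      rw [tc, tstep, tc_eq_zero q n 0 (j + 1) hj, h2, mul_zero, smul_zero, zero_add, mul_smul_comm,
        ← mul_assoc, ← pow_succ', Nat.add_sub_add_right]
    · obtain ⟨γ', h1', h2'⟩ := tc_zero_left n (j + 1) hj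
      -- One factor qʲ⁺¹ comes from `tstep`, the other from moving u₁₁ past u₁₂ʲ⁺¹.
      refine ⟨(q ^ (j + 1)) ^ 2 * γ' + γ, by positivity, ?_⟩
      rw [tc, tstep, h2, h2', mul_smul_comm, mul_smul_comm, ← mul_assoc, ← mul_assoc,
        mul_pow_of_mul_eq_smul (u00_mul_u01 q), smul_mul_assoc, mul_assoc _ (u q 0 0), ← pow_succ',
        ← pow_succ', Nat.add_sub_add_right, show n - (j + 1) + 1 = n - j by omega, smul_smul,
        smul_smul, ← add_smul]
      congr 1
      push_cast; ring

end Coaction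

/-! ### Bidegrees of the matrix coefficients and of the spin basis. -/

section Degrees

variable {q : ℝ} [hq : Fact (|q| < 1)] [NeZero q]

theorem hasDeg_tstep {x y : CG q} {T : ℕ → CG q} {n s s' : ℤ} (hx : HasDeg q x s 1)
    (hy : HasDeg q y s (-1)) (hT : ∀ j : ℕ, HasDeg q (T j) s' (n - 2 * j)) (j : ℕ) :
    HasDeg q (tstep q x y T j) (s + s') (n + 1 - 2 * j) := by
  rcases j with _ | j
  · rw [tstep]
    convert hx.mul (hT 0) using 1
    push_cast; ring
  · rw [tstep]
    refine HasDeg.add (HasDeg.smul _ ?_) ?_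
    · convert hx.mul (hT (j + 1)) using 1
      push_cast; ring
    · convert hy.mul (hT j) using 1
      push_cast; ring

theorem hasDeg_tc : ∀ n i : ℕ, i ≤ n → ∀ j : ℕ, HasDeg q (tc q n i j) (n - 2 * i) (n - 2 * j)
  | 0, 0, _, 0 => by simpa [tc] using HasDeg.one
  | 0, 0, _, j + 1 => by rw [tc]; exact HasDeg.zero
  | n + 1, 0, _, j => by
    rw [tc]
    convert hasDeg_tstep hasDeg_u00 hasDeg_u01 (hasDeg_tc n 0 (by omega)) j using 1
    · push_cast; ring
    · push_cast; ring
  | n + 1, i + 1, h, j => by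
    rw [tc]
    convert hasDeg_tstep hasDeg_u10 hasDeg_u11 (hasDeg_tc n i (by omega)) j using 1
    · push_cast; ring
    · push_cast; ring

theorem hasDeg_ψ_zeta : HasDeg q (ψ q (zeta q)) 0 0 := by
  have h := (HasDeg.one (q := q)).add (hasDeg_ψ_xi.smul (-(1 + (q : ℂ) ^ 2)))
  convert h using 1
  rw [zeta, map_sub, map_one, map_smul, neg_smul, sub_eq_add_neg]

theorem hasDeg_ψ_sph : ∀ k l : ℕ, HasDeg q (ψ q (sph q k l)) 0 (2 * k - 2 * l)
  | 0, 0 => by simpa [sph] using HasDeg.one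
  | 0, l + 1 => by rw [sph, map_zero]; exact HasDeg.zero
  | k + 1, 0 => by
    rw [sph, map_mul]
    convert hasDeg_ψ_eta.mul (hasDeg_ψ_sph k 0) using 1 <;> omega
  | k + 1, 1 => by
    rw [sph, map_add, map_smul, map_smul, map_mul, map_mul]
    refine HasDeg.add (HasDeg.smul _ ?_) (HasDeg.smul _ ?_)
    · convert hasDeg_ψ_eta.mul (hasDeg_ψ_sph k 1) using 1 <;> omega
    · convert hasDeg_ψ_zeta.mul (hasDeg_ψ_sph k 0) using 1 <;> omega
  | k + 1, l + 2 => by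
    rw [sph, map_add, map_add, map_smul, map_smul, map_smul, map_mul, map_mul, map_mul]
    refine HasDeg.add (HasDeg.add (HasDeg.smul _ ?_) (HasDeg.smul _ ?_)) (HasDeg.smul _ ?_)
    · convert hasDeg_ψ_eta.mul (hasDeg_ψ_sph k (l + 2)) using 1 <;> omega
    · convert hasDeg_ψ_zeta.mul (hasDeg_ψ_sph k (l + 1)) using 1 <;> omega
    · convert hasDeg_ψ_star_eta.mul (hasDeg_ψ_sph k l) using 1 <;> omega

theorem haar_star_mono_mul_eq_zero {i p j r : ℕ} (h : i ≠ j ∨ p ≠ r) :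
    haar q (star (mono q i p) * mono q j r) = 0 :=
  haar_star_mul_eq_zero (hasDeg_mono i p) (hasDeg_mono j r) (by omega)

theorem haar_star_mono_mul_self_ne_zero (i p : ℕ) :
    haar q (star (mono q i p) * mono q i p) ≠ 0 := by
  intro h
  have := (haar_star_mul_self_pos (lowersBy_mono (q := q) i p)).1
  rw [h] at this
  exact lt_irrefl _ this

end Degrees

/-! ### Coassociativity, read off in representations. -/

section Coassociativity

variable (q : ℝ) [hq : Fact (|q| < 1)] [NeZero q]

/-- An amplified representation next to the regular representation. -/
def rightPairRep {κ : Type} (Q : Presentation κ) [AmpStable Q] (y : Q.reps) :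
    (Q.tensor (suq2 q)).reps :=
  ⟨fun i => (pairRep q Q y).1 i.swap, (pairRep q Q y).2.2.1, (pairRep q Q y).2.1, fun i j =>
      ⟨((pairRep q Q y).2.2.2 j i).1.symm, by
        simpa using ((pairRep q Q y).2.2.2 j i).2.star_star.symm⟩⟩

theorem evalHom_rightPairRep {κ : Type} (Q : Presentation κ) [AmpStable Q] (y : Q.reps)
    (a : Q.CStar) (b : CG q) :
    (Q.tensor (suq2 q)).evalHom (rightPairRep q Q y) (inl _ _ a * inr _ _ b) =
      ampBdd (Q.evalHom y a) * toBdd (reg q b) := by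
  rw [map_mul, ← evalHom_ampRep]
  congr 1
  change (suq2 q).evalHom (regRep q) b = toBdd (ofBdd ((suq2 q).evalHom (regRep q) b))
  exact (toBdd_ofBdd _).symm

/-- The product of two commuting representations. -/
def mulRep (x : ((suq2 q).tensor (suq2 q)).reps) : (suq2 q).reps :=
  ⟨fun ij => ((Matrix.of fun i j => x.1 (Sum.inl (i, j))) *
      (Matrix.of fun i j => x.1 (Sum.inr (i, j)))) ij.1 ij.2,
    IsSUq2.mul x.2.1 x.2.2.1 (fun i j k l => (x.2.2.2 (i, j) (k, l)).1)⟩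

theorem evalHom_mulRep (x : ((suq2 q).tensor (suq2 q)).reps) (a : CG q) :
    (suq2 q).evalHom (mulRep q x) a = ((suq2 q).tensor (suq2 q)).evalHom x (Δ q a) := rfl

/-- The first factor of a pair of commuting representations. -/
def fstRep {ι κ : Type} {P : Presentation ι} {Q : Presentation κ} (x : (P.tensor Q).reps) : P.reps :=
  ⟨fun i => x.1 (Sum.inl i), x.2.1⟩

/-- The second factor of a pair of commuting representations. -/
def sndRep {ι κ : Type} {P : Presentation ι} {Q : Presentation κ} (x : (P.tensor Q).reps) : Q.reps :=
  ⟨fun i => x.1 (Sum.inr i), x.2.2.1⟩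

theorem evalHom_tmul {ι κ : Type} {P : Presentation ι} {Q : Presentation κ} (x : (P.tensor Q).reps)
    (a : P.CStar) (b : Q.CStar) : (P.tensor Q).evalHom x (inl _ _ a * inr _ _ b) =
      P.evalHom (fstRep x) a * Q.evalHom (sndRep x) b := rfl

theorem commute_mulRep_rightPairRep (y : (suq2 q).reps) (S : BddOp) (hS : ∀ j, Commute S (y.1 j))
    (i : Fin 2 × Fin 2) : Commute (ampBdd S) ((mulRep q (rightPairRep q (suq2 q) y)).1 i) := by
  have h1 : ∀ j, Commute (ampBdd S) (ampBdd (y.1 j)) := fun j => (hS j).map ampBdd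
  have h2 : ∀ j k, Commute (ampBdd S) (toBdd (regU q j k)) := by
    intro j k
    have := (commute_amp_reg q S.toCLM (u q j k)).map toBdd
    rwa [reg_u] at this
  change Commute (ampBdd S) (∑ k, ampBdd (y.1 (i.1, k)) * toBdd (regU q k i.2))
  rw [Fin.sum_univ_two]
  exact ((h1 _).mul_right (h2 _ _)).add_right ((h1 _).mul_right (h2 _ _))

/-- The first factor, amplified, next to the product of the second factor, amplified, and the
regular representation. -/
def assocRep (x : ((suq2 q).tensor (suq2 q)).reps) : ((suq2 q).tensor (suq2 q)).reps :=
  ⟨Sum.elim (ampRep (suq2 q) (fstRep x)).1 (mulRep q (rightPairRep q (suq2 q) (sndRep x))).1,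
    (ampRep (suq2 q) (fstRep x)).2, (mulRep q (rightPairRep q (suq2 q) (sndRep x))).2, by
    intro i j
    refine ⟨commute_mulRep_rightPairRep q _ _ (fun j => (x.2.2.2 i j).1) j, ?_⟩
    have h := commute_mulRep_rightPairRep q (sndRep x) (star (x.1 (Sum.inl i)))
      (fun j => by have h := (x.2.2.2 i j).2.star_star; rwa [star_star] at h) j
    rw [map_star] at h
    have h' := h.star_star
    rwa [star_star] at h'⟩

/-- At the level of representations coassociativity is associativity of matrix multiplication. Using
it in this form avoids a threefold tensor product. -/
theorem mulRep_assocRep (x : ((suq2 q).tensor (suq2 q)).reps) :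
    mulRep q (assocRep q x) = mulRep q (rightPairRep q (suq2 q) (mulRep q x)) := by
  refine Subtype.ext (funext fun ij => ?_)
  let A : Matrix (Fin 2) (Fin 2) BddOp := Matrix.of fun i j => x.1 (Sum.inl (i, j))
  let B : Matrix (Fin 2) (Fin 2) BddOp := Matrix.of fun i j => x.1 (Sum.inr (i, j))
  let R : Matrix (Fin 2) (Fin 2) BddOp := (regU q).map toBdd
  change (A.map ampBdd * (B.map ampBdd * R)) ij.1 ij.2 = ((A * B).map ampBdd * R) ij.1 ij.2
  rw [Matrix.map_mul, Matrix.mul_assoc]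

/-- The spectral subspaces are subcomodules. -/
theorem Δ_ψ_sph (k i : ℕ) (hi : i ≤ 2 * k) : Δ q (ψ q (sph q k i)) =
    ∑ j ∈ Finset.range (2 * k + 1), inl _ _ (ψ q (sph q k j)) * inr _ _ (tc q (2 * k) j i) := by
  refine ext_evalHom fun x => ?_
  -- The element ψ(ηᵏ) is evaluated in a product of three commuting representations, the third being
  -- the regular one. The two bracketings give two expansions along cʲa²ᵏ⁻ʲ in the regular leg.
  have h1 : (suq2 q).evalHom (mulRep q (assocRep q x)) (ψ q (eta q ^ k)) =
      ∑ j ∈ Finset.range (2 * k + 1), (∑ i ∈ Finset.range (2 * k + 1),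
        ampBdd ((suq2 q).evalHom (fstRep x) (ψ q (sph q k i)) *
          (suq2 q).evalHom (sndRep x) (tc q (2 * k) i j))) * toBdd (reg q (mono q j (2 * k - j))) := by
    rw [evalHom_mulRep, Δ_ψ_eta_pow, map_sum]
    simp only [Finset.sum_mul]
    rw [Finset.sum_comm]
    refine Finset.sum_congr rfl fun i hi => ?_
    have hi' := Finset.mem_range.1 hi
    rw [evalHom_tmul]
    have e1 : (suq2 q).evalHom (fstRep (assocRep q x)) (ψ q (sph q k i)) =
        ampBdd ((suq2 q).evalHom (fstRep x) (ψ q (sph q k i))) := evalHom_ampRep _ _ _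
    have e2 : (suq2 q).evalHom (sndRep (assocRep q x)) (mono q i (2 * k - i)) =
        ((suq2 q).tensor (suq2 q)).evalHom (rightPairRep q (suq2 q) (sndRep x))
          (Δ q (mono q i (2 * k - i))) := rfl
    rw [e1, e2, Δ_mono q (2 * k) i (by omega), map_sum, Finset.mul_sum]
    refine Finset.sum_congr rfl fun j _ => ?_
    rw [evalHom_rightPairRep, ← mul_assoc, map_mul]
  have h2 : (suq2 q).evalHom (mulRep q (assocRep q x)) (ψ q (eta q ^ k)) =
      ∑ j ∈ Finset.range (2 * k + 1), ampBdd (((suq2 q).tensor (suq2 q)).evalHom x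
        (Δ q (ψ q (sph q k j)))) * toBdd (reg q (mono q j (2 * k - j))) := by
    rw [mulRep_assocRep, evalHom_mulRep, Δ_ψ_eta_pow, map_sum]
    refine Finset.sum_congr rfl fun j _ => ?_
    rw [evalHom_rightPairRep, evalHom_mulRep]
  -- Distinct monomials are orthogonal for h, so slicing the regular leg with h((cⁱa²ᵏ⁻ⁱ)* ·)
  -- isolates the coefficient of index i, up to a nonzero factor.
  have key : ∀ X : ℕ → BddOp, cut q (toBdd (reg q (star (mono q i (2 * k - i)))) *
      ∑ j ∈ Finset.range (2 * k + 1), ampBdd (X j) * toBdd (reg q (mono q j (2 * k - j)))) =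
      haar q (star (mono q i (2 * k - i)) * mono q i (2 * k - i)) • X i := by
    intro X
    have hc : ∀ T y, ampBdd T * toBdd (reg q y) = toBdd (reg q y) * ampBdd T := by
      intro T y
      have := (commute_amp_reg q T.toCLM y).map toBdd
      exact this.eq
    rw [Finset.mul_sum, map_sum, Finset.sum_eq_single_of_mem i (Finset.mem_range.2 (by omega))]
    · rw [hc, ← mul_assoc, ← map_mul, ← map_mul, cut_mul_ampBdd, cut_toBdd_reg, smul_mul_assoc, one_mul]
    · intro j hj hji
      rw [hc, ← mul_assoc, ← map_mul, ← map_mul, cut_mul_ampBdd, cut_toBdd_reg,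
        haar_star_mono_mul_eq_zero (Or.inl hji.symm), zero_smul, zero_mul]
  have h3 := h2.symm.trans h1
  simp only [← map_sum] at h3
  have h4 := congrArg (fun Y => cut q (toBdd (reg q (star (mono q i (2 * k - i)))) * Y)) h3
  simp only [key] at h4
  have h5 := smul_right_injective BddOp (haar_star_mono_mul_self_ne_zero (q := q) i (2 * k - i)) h4
  rw [h5, map_sum]
  exact Finset.sum_congr rfl fun j _ => (evalHom_tmul x _ _).symm

end Coassociativity

open Presentation

/-! ### Polynomials on the sphere -/

section Filtration

variable (q : ℝ)

/-- Normally ordered monomials in the generators of the sphere. -/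
def sphMono (m i : ℕ) : CS q :=
  if i ≤ m then eta q ^ (m - i) * xi q ^ i else xi q ^ (2 * m - i) * star (eta q) ^ (i - m)

/-- Polynomials of degree at most `n`. -/
def polyDeg (n : ℕ) : Submodule ℂ (CS q) :=
  Submodule.span ℂ {x | ∃ m i, m ≤ n ∧ i ≤ 2 * m ∧ x = sphMono q m i}

theorem eta_pow_mul_mem {n a b : ℕ} (h : a + b ≤ n) : eta q ^ a * xi q ^ b ∈ polyDeg q n := by
  refine Submodule.subset_span ⟨a + b, b, h, by omega, ?_⟩
  rw [sphMono, if_pos (by omega), Nat.add_sub_cancel]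

theorem xi_pow_mul_mem {n b c : ℕ} (h : b + c ≤ n) :
    xi q ^ b * star (eta q) ^ c ∈ polyDeg q n := by
  rcases c with _ | c
  · simpa using eta_pow_mul_mem q (a := 0) (b := b) (by omega)
  · refine Submodule.subset_span ⟨b + (c + 1), b + 2 * (c + 1), h, by omega, ?_⟩
    rw [sphMono, if_neg (by omega), show 2 * (b + (c + 1)) - (b + 2 * (c + 1)) = b by omega,
      show b + 2 * (c + 1) - (b + (c + 1)) = c + 1 by omega]

theorem polyDeg_mono {n n' : ℕ} (h : n ≤ n') : polyDeg q n ≤ polyDeg q n' :=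
  Submodule.span_mono fun _ ⟨m, i, h1, h2, h3⟩ => ⟨m, i, h1.trans h, h2, h3⟩

theorem polyDeg_induction {n : ℕ} {S : Submodule ℂ (CS q)} {f : CS q →ₗ[ℂ] CS q}
    (h1 : ∀ a b, a + b ≤ n → f (eta q ^ a * xi q ^ b) ∈ S)
    (h2 : ∀ b c, b + c + 1 ≤ n → f (xi q ^ b * star (eta q) ^ (c + 1)) ∈ S) {x : CS q}
    (hx : x ∈ polyDeg q n) : f x ∈ S := by
  have : polyDeg q n ≤ S.comap f := by
    refine Submodule.span_le.2 ?_
    rintro _ ⟨m, i, hm, hi, rfl⟩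
    change f _ ∈ S
    rw [sphMono]
    split_ifs with h
    · exact h1 _ _ (by omega)
    · rw [show i - m = (i - m - 1) + 1 by omega]
      exact h2 _ _ (by omega)
  exact this hx

theorem eta_mul_mem {n : ℕ} {x : CS q} (hx : x ∈ polyDeg q n) : eta q * x ∈ polyDeg q (n + 1) := by
  refine polyDeg_induction q (f := LinearMap.mulLeft ℂ (eta q)) ?_ ?_ hx
  · intro a b h
    rw [LinearMap.mulLeft_apply, ← mul_assoc, ← pow_succ']
    exact eta_pow_mul_mem q (by omega)
  · intro b c h
    rw [LinearMap.mulLeft_apply, ← mul_assoc, mul_pow_of_mul_eq_smul (eta_mul_xi q), smul_mul_assoc,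
      pow_succ' (star (eta q)) c, mul_assoc, ← mul_assoc (eta q), eta_mul_star_eta]
    refine Submodule.smul_mem _ _ ?_
    rw [sub_mul, mul_sub, smul_mul_assoc, smul_mul_assoc, mul_smul_comm, mul_smul_comm, mul_assoc,
      ← mul_assoc _ (xi q), ← mul_assoc _ (xi q), ← pow_succ, ← mul_assoc _ (xi q), ← pow_succ]
    exact sub_mem (Submodule.smul_mem _ _ (xi_pow_mul_mem q (by omega)))
      (Submodule.smul_mem _ _ (xi_pow_mul_mem q (by omega)))

variable [NeZero q]

theorem xi_mul_eta : xi q * eta q = ((q : ℂ) ^ 2)⁻¹ • (eta q * xi q) := by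
  rw [eta_mul_xi, smul_smul, inv_mul_cancel₀ (pow_ne_zero 2 q_ne_zero), one_smul]

theorem star_eta_mul_xi : star (eta q) * xi q = ((q : ℂ) ^ 2)⁻¹ • (xi q * star (eta q)) := by
  rw [xi_mul_star_eta, smul_smul, inv_mul_cancel₀ (pow_ne_zero 2 q_ne_zero), one_smul]

theorem xi_mul_mem {n : ℕ} {x : CS q} (hx : x ∈ polyDeg q n) : xi q * x ∈ polyDeg q (n + 1) := by
  refine polyDeg_induction q (f := LinearMap.mulLeft ℂ (xi q)) ?_ ?_ hx
  · intro a b h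
    rw [LinearMap.mulLeft_apply, ← mul_assoc, mul_pow_of_mul_eq_smul (xi_mul_eta q), smul_mul_assoc,
      mul_assoc, ← pow_succ']
    exact Submodule.smul_mem _ _ (eta_pow_mul_mem q (by omega))
  · intro b c h
    rw [LinearMap.mulLeft_apply, ← mul_assoc, ← pow_succ']
    exact xi_pow_mul_mem q (by omega)

theorem star_eta_mul_mem {n : ℕ} {x : CS q} (hx : x ∈ polyDeg q n) :
    star (eta q) * x ∈ polyDeg q (n + 1) := by
  refine polyDeg_induction q (f := LinearMap.mulLeft ℂ (star (eta q))) ?_ ?_ hx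
  · intro a b h
    rw [LinearMap.mulLeft_apply]
    rcases a with _ | a
    · rw [pow_zero, one_mul, mul_pow_of_mul_eq_smul (star_eta_mul_xi q)]
      refine Submodule.smul_mem _ _ ?_
      rw [← pow_one (star (eta q))]
      exact xi_pow_mul_mem q (by omega)
    · rw [pow_succ', mul_assoc, ← mul_assoc, star_eta_mul_eta, sub_mul, mul_assoc (xi q) (xi q)]
      have h1 : xi q * (eta q ^ a * xi q ^ b) ∈ polyDeg q n :=
        polyDeg_mono q (by omega) (xi_mul_mem q (eta_pow_mul_mem q le_rfl))
      exact sub_mem (polyDeg_mono q (by omega) h1) (xi_mul_mem q h1)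
  · intro b c h
    rw [LinearMap.mulLeft_apply, ← mul_assoc, mul_pow_of_mul_eq_smul (star_eta_mul_xi q),
      smul_mul_assoc, mul_assoc, ← pow_succ']
    exact Submodule.smul_mem _ _ (xi_pow_mul_mem q (by omega))

theorem one_mem_polyDeg (n : ℕ) : (1 : CS q) ∈ polyDeg q n := by
  simpa using eta_pow_mul_mem q (n := n) (a := 0) (b := 0) (by omega)

theorem zeta_mul_mem {n : ℕ} {x : CS q} (hx : x ∈ polyDeg q n) : zeta q * x ∈ polyDeg q (n + 1) := by
  rw [zeta, sub_mul, one_mul, smul_mul_assoc]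
  exact sub_mem (polyDeg_mono q (by omega) hx) (Submodule.smul_mem _ _ (xi_mul_mem q hx))

theorem sph_mem_polyDeg : ∀ k l : ℕ, sph q k l ∈ polyDeg q k
  | 0, 0 => one_mem_polyDeg q 0
  | 0, l + 1 => by rw [sph]; exact zero_mem _
  | k + 1, 0 => by rw [sph]; exact eta_mul_mem q (sph_mem_polyDeg k 0)
  | k + 1, 1 => by
    rw [sph]
    exact add_mem (Submodule.smul_mem _ _ (eta_mul_mem q (sph_mem_polyDeg k 1)))
      (Submodule.smul_mem _ _ (zeta_mul_mem q (sph_mem_polyDeg k 0)))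
  | k + 1, l + 2 => by
    rw [sph]
    exact add_mem (add_mem (Submodule.smul_mem _ _ (eta_mul_mem q (sph_mem_polyDeg k (l + 2))))
      (Submodule.smul_mem _ _ (zeta_mul_mem q (sph_mem_polyDeg k (l + 1)))))
      (Submodule.smul_mem _ _ (star_eta_mul_mem q (sph_mem_polyDeg k l)))

end Filtration

/-! ### Independence of the spin basis; the polynomials as its span. -/

section Independence

variable (q : ℝ) [hq : Fact (|q| < 1)] [NeZero q]

/-- The slice `h(η̂ᵏ* ·) ⊗ id` of the coaction. -/
def highSlice (k : ℕ) : CS q →ₗ[ℂ] CG q where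
  toFun y := leftSlice q (suq2 q) (inl _ _ (star (ψ q (sph q k 0))) * Δ q (ψ q y))
  map_add' x y := by rw [map_add, map_add, mul_add, map_add]
  map_smul' c x := by
    rw [map_smul (ψ q), map_smul (Δ q), mul_smul_comm, map_smul, RingHom.id_apply]

theorem highSlice_apply (k : ℕ) (y : CS q) : highSlice q k y =
    leftSlice q (suq2 q) (inl _ _ (star (ψ q (sph q k 0))) * Δ q (ψ q y)) := rfl

theorem leftSlice_inl_mul_sum (x : CG q) (n : ℕ) (X Y : ℕ → CG q) :
    leftSlice q (suq2 q) (inl _ _ x * ∑ j ∈ Finset.range n, inl _ _ (X j) * inr _ _ (Y j)) =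
      ∑ j ∈ Finset.range n, haar q (x * X j) • Y j := by
  rw [Finset.mul_sum, map_sum]
  refine Finset.sum_congr rfl fun j _ => ?_
  rw [← mul_assoc, ← map_mul, leftSlice_tmul]

theorem leftSlice_star_sum_mul_sum (m n : ℕ) (X Y X' Y' : ℕ → CG q) :
    leftSlice q (suq2 q) (star (∑ i ∈ Finset.range m, inl _ _ (X i) * inr _ _ (Y i)) *
      ∑ j ∈ Finset.range n, inl _ _ (X' j) * inr _ _ (Y' j)) =
      ∑ i ∈ Finset.range m, ∑ j ∈ Finset.range n,
        haar q (star (X i) * X' j) • (star (Y i) * Y' j) := by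
  rw [star_sum, Finset.sum_mul_sum, map_sum]
  refine Finset.sum_congr rfl fun i _ => ?_
  rw [map_sum]
  refine Finset.sum_congr rfl fun j _ => ?_
  rw [star_tmul, tmul_mul_tmul, leftSlice_tmul]

variable {q}

theorem haar_star_sph_mul_eq_zero {k l i j : ℕ} (h : k + j ≠ l + i) :
    haar q (star (ψ q (sph q k i)) * ψ q (sph q l j)) = 0 :=
  haar_star_mul_eq_zero (hasDeg_ψ_sph k i) (hasDeg_ψ_sph l j) (by omega)

/-- Spin l has right degrees between -2l and 2l, and the highest weight vector of spin k has right
degree 2k. -/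
theorem highSlice_sph_of_lt {k l i : ℕ} (h : l < k) (hi : i ≤ 2 * l) :
    highSlice q k (sph q l i) = 0 := by
  rw [highSlice_apply, Δ_ψ_sph q l i hi, leftSlice_inl_mul_sum]
  refine Finset.sum_eq_zero fun j _ => ?_
  rw [haar_star_sph_mul_eq_zero (by omega), zero_smul]

/-- The squared norm of the highest weight vector. -/
def hwNorm (q : ℝ) [Fact (|q| < 1)] [NeZero q] (k : ℕ) : ℂ :=
  haar q (star (ψ q (sph q k 0)) * ψ q (sph q k 0))

theorem highSlice_sph_self {k i : ℕ} (hi : i ≤ 2 * k) :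
    highSlice q k (sph q k i) = hwNorm q k • tc q (2 * k) 0 i := by
  rw [highSlice_apply, Δ_ψ_sph q k i hi, leftSlice_inl_mul_sum,
    Finset.sum_eq_single_of_mem 0 (by simp)]
  · rfl
  · intro j _ hj
    rw [haar_star_sph_mul_eq_zero (by omega), zero_smul]

theorem hwNorm_pos (k : ℕ) : 0 < (hwNorm q k).re ∧ (hwNorm q k).im = 0 := by
  rw [hwNorm, sph_zero_right, map_pow, ψ_eta]
  exact haar_star_mul_self_pos ((lowersBy_u00.mul lowersBy_u10).pow k)

theorem hwNorm_ne_zero (k : ℕ) : hwNorm q k ≠ 0 := fun h => by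
  have := (hwNorm_pos (q := q) k).1
  rw [h] at this
  exact lt_irrefl _ this

theorem lowersBy_tc {n j : ℕ} (hj : j ≤ n) : ∃ s, LowersBy q (tc q n 0 j) (n - j) s := by
  obtain ⟨γ, h1, h2⟩ := tc_zero_left q n j hj
  have h3 := (lowersBy_star_u10.pow j).mul (lowersBy_u00.pow (q := q) (n - j))
  rw [mul_zero, zero_add, mul_one] at h3
  obtain ⟨w, h4, h5⟩ := h3
  refine ⟨(j : ℤ) * 1 + ((n - j : ℕ) : ℤ) * 0, fun n => (γ * (-(q : ℂ)) ^ j) * w n,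
    fun n => mul_ne_zero (mul_ne_zero (Complex.ofReal_ne_zero.2 h1.ne')
      (pow_ne_zero _ (neg_ne_zero.2 q_ne_zero))) (h4 n), fun f n m r => ?_⟩
  rw [h2, (isSUq2_u q).facts.2.1, smul_pow, smul_mul_assoc, smul_smul, map_smul (reg q),
    smul_apply, lp.coeFn_smul, Pi.smul_apply, h5, smul_smul]

theorem haar_star_tc_mul_self_pos {n j : ℕ} (hj : j ≤ n) :
    0 < (haar q (star (tc q n 0 j) * tc q n 0 j)).re ∧
      (haar q (star (tc q n 0 j) * tc q n 0 j)).im = 0 := by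
  obtain ⟨s, hs⟩ := lowersBy_tc (q := q) hj
  exact haar_star_mul_self_pos hs

theorem haar_star_tc_mul_self_ne_zero {n j : ℕ} (hj : j ≤ n) :
    haar q (star (tc q n 0 j) * tc q n 0 j) ≠ 0 := fun h => by
  have := (haar_star_tc_mul_self_pos (q := q) hj).1
  rw [h] at this
  exact lt_irrefl _ this

theorem haar_star_tc_mul_eq_zero {n i j : ℕ} (h : i ≠ j) :
    haar q (star (tc q n 0 i) * tc q n 0 j) = 0 :=
  haar_star_mul_eq_zero (hasDeg_tc n 0 (by omega) i) (hasDeg_tc n 0 (by omega) j) (by omega)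

/-- The slice `highSlice n` kills all spins below n and sends sph n i to a nonzero multiple of tc
(2n) 0 i. Those entries are nonzero and orthogonal for h, so the coefficients of top spin vanish;
induction on n removes the rest. -/
theorem sph_independent : ∀ (n : ℕ) (c : ℕ → ℕ → ℂ),
    ∑ k ∈ Finset.range (n + 1), ∑ i ∈ Finset.range (2 * k + 1), c k i • sph q k i = 0 →
    ∀ k i, k ≤ n → i ≤ 2 * k → c k i = 0 := by
  have top : ∀ (n : ℕ) (c : ℕ → ℕ → ℂ),
      ∑ k ∈ Finset.range (n + 1), ∑ i ∈ Finset.range (2 * k + 1), c k i • sph q k i = 0 →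
      ∀ i, i ≤ 2 * n → c n i = 0 := by
    intro n c h i hi
    have h1 := congrArg (highSlice q n) h
    rw [map_zero, map_sum, Finset.sum_range_succ, Finset.sum_eq_zero, zero_add, map_sum] at h1
    · have h2 := congrArg (fun y => haar q (star (tc q (2 * n) 0 i) * y)) h1
      simp only [mul_zero, map_zero] at h2
      rw [Finset.mul_sum, map_sum, Finset.sum_eq_single_of_mem i (Finset.mem_range.2 (by omega)),
        map_smul, highSlice_sph_self hi, mul_smul_comm, mul_smul_comm, map_smul, map_smul, smul_eq_mul,
        smul_eq_mul] at h2
      · exact (mul_eq_zero.1 h2).resolve_right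
          (mul_ne_zero (hwNorm_ne_zero n) (haar_star_tc_mul_self_ne_zero hi))
      · intro j hj hji
        have hj' := Finset.mem_range.1 hj
        rw [map_smul, highSlice_sph_self (by omega), mul_smul_comm, mul_smul_comm, map_smul, map_smul,
          haar_star_tc_mul_eq_zero hji.symm, smul_zero, smul_zero]
    · intro k hk
      have hk' := Finset.mem_range.1 hk
      rw [map_sum]
      refine Finset.sum_eq_zero fun i hi => ?_
      have hi' := Finset.mem_range.1 hi
      rw [map_smul, highSlice_sph_of_lt hk' (by omega), smul_zero]
  intro n
  induction n with
  | zero =>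
    intro c h k i hk hi
    obtain rfl : k = 0 := by omega
    exact top 0 c h i hi
  | succ n ih =>
    intro c h k i hk hi
    rcases Nat.lt_or_ge n k with hk' | hk'
    · obtain rfl : k = n + 1 := by omega
      exact top _ c h i hi
    · refine ih c ?_ k i hk' hi
      rw [Finset.sum_range_succ] at h
      rw [← h, left_eq_add]
      refine Finset.sum_eq_zero fun i hi => ?_
      have hi' := Finset.mem_range.1 hi
      rw [top _ c (by rw [Finset.sum_range_succ]; exact h) i (by omega), zero_smul]

/-- Indices of the basis of the polynomials of degree at most `n`. -/
abbrev DegIdx (n : ℕ) : Type := Σ k : Fin (n + 1), Fin (2 * k.1 + 1)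

theorem linearIndependent_sph (n : ℕ) :
    LinearIndependent ℂ fun p : DegIdx n => sph q p.1.1 p.2.1 := by
  rw [Fintype.linearIndependent_iff]
  intro g hg p
  have := sph_independent (q := q) n
    (fun k i => if h : k < n + 1 ∧ i < 2 * k + 1 then g ⟨⟨k, h.1⟩, ⟨i, h.2⟩⟩ else 0) ?_ p.1.1 p.2.1
    (by omega) (by omega)
  · rw [dif_pos ⟨p.1.2, p.2.2⟩] at this
    exact this
  · rw [← hg, Fintype.sum_sigma, Finset.sum_range]
    refine Finset.sum_congr rfl fun k _ => ?_
    rw [Finset.sum_range]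
    refine Finset.sum_congr rfl fun i _ => ?_
    rw [dif_pos ⟨k.2, i.2⟩]

/-- A dimension count: the ordered monomials of degree at most n and the elements sph k i with k ≤ n
have the same index set. The latter are independent and lie in the span of the former. -/
theorem polyDeg_eq_span (n : ℕ) :
    polyDeg q n = Submodule.span ℂ (Set.range fun p : DegIdx n => sph q p.1.1 p.2.1) := by
  have h1 : polyDeg q n = Submodule.span ℂ (Set.range fun p : DegIdx n => sphMono q p.1.1 p.2.1) := by
    rw [polyDeg]
    congr 1
    ext x
    constructor
    · rintro ⟨m, i, hm, hi, rfl⟩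
      exact ⟨⟨⟨m, by omega⟩, ⟨i, by simp; omega⟩⟩, rfl⟩
    · rintro ⟨p, rfl⟩
      exact ⟨p.1.1, p.2.1, by omega, by omega, rfl⟩
  have h2 : Submodule.span ℂ (Set.range fun p : DegIdx n => sph q p.1.1 p.2.1) ≤ polyDeg q n := by
    refine Submodule.span_le.2 ?_
    rintro _ ⟨p, rfl⟩
    exact polyDeg_mono q (by omega) (sph_mem_polyDeg q p.1.1 p.2.1)
  have : FiniteDimensional ℂ (polyDeg q n) := by
    rw [h1]; exact FiniteDimensional.span_of_finite ℂ (Set.finite_range _)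
  refine (Submodule.eq_of_le_of_finrank_le h2 ?_).symm
  rw [finrank_span_eq_card (linearIndependent_sph n), h1]
  exact finrank_range_le_card _

variable (q) in
/-- The `⋆`-algebra of polynomials on the sphere. -/
def polySph : StarSubalgebra ℂ (CS q) := StarAlgebra.adjoin ℂ (Set.range (sphere q).gen)

theorem xi_mem_polySph : xi q ∈ polySph q := StarAlgebra.subset_adjoin ℂ _ ⟨0, rfl⟩

theorem eta_mem_polySph : eta q ∈ polySph q := StarAlgebra.subset_adjoin ℂ _ ⟨1, rfl⟩

theorem sph_mem_polySph (k l : ℕ) : sph q k l ∈ polySph q := by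
  have h : polyDeg q k ≤ (polySph q).toSubalgebra.toSubmodule := by
    refine Submodule.span_le.2 ?_
    rintro _ ⟨m, i, -, -, rfl⟩
    change sphMono q m i ∈ polySph q
    rw [sphMono]
    split_ifs
    · exact mul_mem (pow_mem eta_mem_polySph _) (pow_mem xi_mem_polySph _)
    · exact mul_mem (pow_mem xi_mem_polySph _) (pow_mem (star_mem eta_mem_polySph) _)
  exact h (sph_mem_polyDeg q k l)

theorem mem_polySph_iff {x : CS q} : x ∈ polySph q ↔ ∃ n, x ∈ polyDeg q n := by
  constructor
  · intro hx
    -- Stability of the union of the filtration under left multiplication passes through the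
    -- induction over the generated algebra; the claim is its value at y = 1.
    suffices H : ∀ y : CS q, (∃ n, y ∈ polyDeg q n) → ∃ n, x * y ∈ polyDeg q n by
      simpa using H 1 ⟨0, one_mem_polyDeg q 0⟩
    have hx' : x ∈ Algebra.adjoin ℂ (Set.range (sphere q).gen ∪ star (Set.range (sphere q).gen)) := hx
    clear hx
    induction hx' using Algebra.adjoin_induction with
    | mem x h =>
      rintro y ⟨n, hy⟩
      rcases h with ⟨i, rfl⟩ | h
      · fin_cases i
        · exact ⟨_, xi_mul_mem q hy⟩
        · exact ⟨_, eta_mul_mem q hy⟩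
      · obtain ⟨i, hi⟩ := h
        obtain rfl : x = star ((sphere q).gen i) := by rw [hi, star_star]
        fin_cases i
        · refine ⟨n + 1, ?_⟩
          change star (xi q) * y ∈ _
          rw [star_xi]
          exact xi_mul_mem q hy
        · exact ⟨_, star_eta_mul_mem q hy⟩
    | algebraMap r =>
      rintro y ⟨n, hy⟩
      refine ⟨n, ?_⟩
      rw [Algebra.algebraMap_eq_smul_one, smul_mul_assoc, one_mul]
      exact Submodule.smul_mem _ _ hy
    | add x y _ _ hx hy =>
      rintro w hw
      obtain ⟨n, hn⟩ := hx w hw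
      obtain ⟨m, hm⟩ := hy w hw
      refine ⟨max n m, ?_⟩
      rw [add_mul]
      exact add_mem (polyDeg_mono q (le_max_left _ _) hn) (polyDeg_mono q (le_max_right _ _) hm)
    | mul x y _ _ hx hy =>
      intro w hw
      rw [mul_assoc]
      exact hx _ (hy w hw)
  · rintro ⟨n, hn⟩
    rw [polyDeg_eq_span] at hn
    refine (Submodule.span_le (p := (polySph q).toSubalgebra.toSubmodule)).2 ?_ hn
    rintro _ ⟨p, rfl⟩
    exact sph_mem_polySph _ _

theorem polySph_eq_span {x : CS q} (hx : x ∈ polySph q) : x ∈ Submodule.span ℂ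
    {y | ∃ k i, i ≤ 2 * k ∧ y = sph q k i} := by
  obtain ⟨n, hn⟩ := mem_polySph_iff.1 hx
  rw [polyDeg_eq_span] at hn
  refine Submodule.span_mono ?_ hn
  rintro _ ⟨p, rfl⟩
  exact ⟨p.1.1, p.2.1, by omega, rfl⟩

theorem dense_polySph : Dense (polySph q : Set (CS q)) := by
  intro x
  have h := adjoin_gen_topologicalClosure (sphere q)
  have h2 : x ∈ (polySph q).topologicalClosure := by
    rw [polySph, h]; trivial
  exact h2

end Independence

open Presentation

/-! ### Invariance and orthogonality -/

section Orthogonality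

variable {q : ℝ} [hq : Fact (|q| < 1)] [NeZero q]

theorem one_sub_q_sq_mul_ne_zero (l : ℕ) : 1 - (q : ℂ) ^ 2 * ((q : ℂ) ^ l) ^ 2 ≠ 0 := by
  have h : (q ^ 2) ^ (l + 1) < 1 := pow_lt_one₀ (sq_nonneg q) (q_sq_lt_one q) (by omega)
  rw [show (q : ℂ) ^ 2 * ((q : ℂ) ^ l) ^ 2 = (((q ^ 2) ^ (l + 1) : ℝ) : ℂ) by push_cast; ring]
  exact_mod_cast (sub_pos.2 h).ne'

/-- The highest weight vector has nonzero right degree. Every other basis vector times ξ is a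
nonzero multiple of a commutator with η*, so `haar_eq_zero_of_mul_xi` applies. -/
theorem haar_ψ_sph {k : ℕ} (hk : k ≠ 0) (l : ℕ) : haar q (ψ q (sph q k l)) = 0 := by
  rcases l with _ | l
  · exact haar_eq_zero_of_hasDeg (hasDeg_ψ_sph k 0) (by omega)
  · have h := haar_eq_zero_of_mul_xi (((q : ℂ) ^ k) ^ 2 • ψ q (sph q k l))
      (((q : ℂ) * (q : ℂ) ^ l * (1 - (q : ℂ) ^ 2 * ((q : ℂ) ^ l) ^ 2)) • ψ q (sph q k (l + 1))) ?_
    · rw [map_smul, smul_eq_mul] at h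
      exact (mul_eq_zero.1 h).resolve_left (mul_ne_zero (mul_ne_zero q_ne_zero
        (pow_ne_zero _ q_ne_zero)) (one_sub_q_sq_mul_ne_zero l))
    · have h := congrArg (ψ q) (sph_commutator (q := q) k l)
      rw [map_smul (ψ q), map_smul (ψ q), map_sub, map_mul, map_mul, map_mul] at h
      rw [smul_mul_assoc, ← h, mul_smul_comm, smul_mul_assoc, smul_sub]

theorem leftSlice_Δ_ψ_sph {k i : ℕ} (hi : i ≤ 2 * k) :
    leftSlice q (suq2 q) (Δ q (ψ q (sph q k i))) = haar q (ψ q (sph q k i)) • (1 : CG q) := by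
  rcases k with _ | k
  · obtain rfl : i = 0 := by omega
    rw [sph_zero_zero, map_one, map_one]
    simpa using leftSlice_tmul q (suq2 q) 1 1
  · rw [Δ_ψ_sph q _ i hi, map_sum, haar_ψ_sph (by omega), zero_smul]
    refine Finset.sum_eq_zero fun j _ => ?_
    rw [leftSlice_tmul, haar_ψ_sph (by omega), zero_smul]

/-- The Haar state is invariant on the sphere. -/
theorem leftSlice_Δ_ψ (a : CS q) :
    leftSlice q (suq2 q) (Δ q (ψ q a)) = haar q (ψ q a) • (1 : CG q) := by
  have h1 : Continuous fun a => leftSlice q (suq2 q) (Δ q (ψ q a)) :=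
    (leftSlice q (suq2 q)).continuous.comp
      ((continuous_starAlgHom (Δ q)).comp (continuous_starAlgHom (ψ q)))
  have h2 : Continuous fun a => haar q (ψ q a) • (1 : CG q) :=
    ((haar q).continuous.comp (continuous_starAlgHom (ψ q))).smul continuous_const
  refine congrFun (Continuous.ext_on dense_polySph h1 h2 fun x hx => ?_) a
  have hx' := polySph_eq_span hx
  clear hx
  induction hx' using Submodule.span_induction with
  | mem x h =>
    obtain ⟨k, i, hi, rfl⟩ := h
    exact leftSlice_Δ_ψ_sph hi
  | zero => simp
  | add x y _ _ hx hy =>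
    simp only [map_add, add_smul] at hx hy ⊢
    rw [hx, hy]
  | smul c x _ hx =>
    rw [map_smul (ψ q), map_smul (Δ q), map_smul, map_smul, hx, smul_smul, smul_eq_mul]

/-- Invariance for (ηᵏ)*ηˡ, with both factors expanded by `Δ_ψ_eta_pow`. The scalars of interest
appear as coefficients of products of monomials. -/
theorem sum_haar_star_sph_mul (k l : ℕ) :
    ∑ i ∈ Finset.range (2 * k + 1), ∑ j ∈ Finset.range (2 * l + 1),
      haar q (star (ψ q (sph q k i)) * ψ q (sph q l j)) •
        (star (mono q i (2 * k - i)) * mono q j (2 * l - j)) =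
      haar q (star (ψ q (sph q k 0)) * ψ q (sph q l 0)) • (1 : CG q) := by
  have h := leftSlice_Δ_ψ (q := q) (star (eta q ^ k) * eta q ^ l)
  rw [map_mul, map_mul, map_star (ψ q), map_star (Δ q), Δ_ψ_eta_pow, Δ_ψ_eta_pow,
    leftSlice_star_sum_mul_sum] at h
  rw [h, sph_zero_right, sph_zero_right]

/-- By degree only j = i + (l - k) is in question. For k < l the right side of
`sum_haar_star_sph_mul` is zero, and linear independence of the products of monomials makes each
coefficient vanish. -/
theorem haar_star_sph_mul_of_lt {k l i j : ℕ} (hkl : k < l) (hi : i ≤ 2 * k) :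
    haar q (star (ψ q (sph q k i)) * ψ q (sph q l j)) = 0 := by
  by_cases hd : k + j = l + i
  swap
  · exact haar_star_sph_mul_eq_zero hd
  obtain rfl : j = i + (l - k) := by omega
  refine eq_zero_of_sum_star_mono_mul_mono (q := q) (2 * k) (l - k)
    (fun i => haar q (star (ψ q (sph q k i)) * ψ q (sph q l (i + (l - k))))) ?_ i hi
  have h := sum_haar_star_sph_mul (q := q) k l
  rw [haar_star_sph_mul_eq_zero (k := k) (l := l) (i := 0) (j := 0) (by omega), zero_smul] at h
  rw [← h]
  refine Finset.sum_congr rfl fun m hm => ?_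
  have hm' := Finset.mem_range.1 hm
  rw [Finset.sum_eq_single_of_mem (m + (l - k)) (Finset.mem_range.2 (by omega))]
  · rw [show 2 * l - (m + (l - k)) = 2 * k - m + (l - k) by omega]
  · intro j _ hj
    rw [haar_star_sph_mul_eq_zero (by omega), zero_smul]

/-- The spin components are orthogonal, and so are the basis vectors of each. -/
theorem haar_star_sph_mul_of_ne {k l i j : ℕ} (h : k ≠ l ∨ i ≠ j) (hi : i ≤ 2 * k)
    (hj : j ≤ 2 * l) : haar q (star (ψ q (sph q k i)) * ψ q (sph q l j)) = 0 := by
  rcases lt_trichotomy k l with hkl | rfl | hkl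
  · exact haar_star_sph_mul_of_lt hkl hi
  · exact haar_star_sph_mul_eq_zero (by omega)
  · have := haar_star_sph_mul_of_lt (q := q) (j := i) hkl hj
    rw [← star_eq_zero, ← haar_star, star_mul, star_star]
    exact this

theorem ψ_xi_mul_u00 : ψ q (xi q) * u q 0 0 = ((q : ℂ) ^ 2)⁻¹ • (u q 0 0 * ψ q (xi q)) := by
  obtain ⟨-, -, -, -, h1, h2, -⟩ := (isSUq2_u q).facts
  rw [ψ_xi, ← mul_assoc, h2, smul_mul_assoc, mul_assoc (star (u q 1 0)) (u q 0 0), h1, mul_smul_comm, smul_smul, smul_smul,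
    mul_assoc (((q : ℂ) ^ 2)⁻¹), ← pow_two, inv_mul_cancel₀ (pow_ne_zero 2 q_ne_zero), one_smul,
    mul_assoc]

/-- `a*ⁿ⁺¹ aⁿ⁺¹ = a*ⁿ aⁿ (1 - q⁻²ⁿ ξ)`. -/
theorem star_u00_pow_mul_pow (n : ℕ) : star (u q 0 0 ^ (n + 1)) * u q 0 0 ^ (n + 1) =
    star (u q 0 0 ^ n) * u q 0 0 ^ n * (1 - (((q : ℂ) ^ 2)⁻¹) ^ n • ψ q (xi q)) := by
  obtain ⟨-, -, h, -⟩ := (isSUq2_u q).facts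
  rw [← ψ_xi] at h
  calc star (u q 0 0 ^ (n + 1)) * u q 0 0 ^ (n + 1)
      = star (u q 0 0 ^ n) * (star (u q 0 0) * u q 0 0) * u q 0 0 ^ n := by
        rw [pow_succ', star_mul]; simp only [mul_assoc]
    _ = _ := by
      rw [h, mul_sub, sub_mul, mul_one, mul_assoc _ (ψ q (xi q)),
        mul_pow_of_mul_eq_smul ψ_xi_mul_u00, mul_sub, mul_one, mul_smul_comm, mul_smul_comm, mul_assoc]

/-- Invariance of h is available on the sphere only. The element a*ⁿaⁿ belongs to it, being a
polynomial in ξ, although aⁿ need not. -/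
theorem exists_ψ_eq_star_u00_pow (n : ℕ) : ∃ y, ψ q y = star (u q 0 0 ^ n) * u q 0 0 ^ n := by
  induction n with
  | zero => exact ⟨1, by simp⟩
  | succ n ih =>
    obtain ⟨y, hy⟩ := ih
    refine ⟨y * (1 - (((q : ℂ) ^ 2)⁻¹) ^ n • xi q), ?_⟩
    rw [star_u00_pow_mul_pow, map_mul, hy, map_sub, map_one, map_smul (ψ q)]

/-- The counterpart of `sum_haar_star_sph_mul` for a*ⁿaⁿ; the off-diagonal terms drop out by degree.
-/
theorem sum_haar_star_tc_mul (n : ℕ) :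
    ∑ j ∈ Finset.range (n + 1), haar q (star (tc q n 0 j) * tc q n 0 j) •
      (star (mono q j (n - j)) * mono q j (n - j)) =
      haar q (star (tc q n 0 0) * tc q n 0 0) • (1 : CG q) := by
  obtain ⟨y, hy⟩ := exists_ψ_eq_star_u00_pow (q := q) n
  have h0 : tc q n 0 0 = u q 0 0 ^ n := by rw [tc_zero_right q n 0 (by omega), mono]; simp
  have h := leftSlice_Δ_ψ y
  rw [hy] at h
  rw [h0, ← h, map_mul, map_star (Δ q)]
  have h1 := Δ_mono q n 0 (by omega)
  rw [mono, pow_zero, one_mul, Nat.sub_zero] at h1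
  rw [h1, leftSlice_star_sum_mul_sum]
  refine Finset.sum_congr rfl fun i hi => ?_
  rw [Finset.sum_eq_single_of_mem i hi]
  intro j _ hj
  rw [haar_star_tc_mul_eq_zero hj.symm, zero_smul]

/-- The squared norms of the basis of the spin `k` component are proportional to those of the
matrix coefficients. -/
theorem haar_star_tc_mul_hwNorm {k j : ℕ} (hj : j ≤ 2 * k) :
    haar q (star (tc q (2 * k) 0 j) * tc q (2 * k) 0 j) * hwNorm q k =
      haar q (star (ψ q (sph q k j)) * ψ q (sph q k j)) *
        haar q (star (tc q (2 * k) 0 0) * tc q (2 * k) 0 0) := by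
  rw [← sub_eq_zero]
  refine eq_zero_of_sum_star_mono_mul_mono (q := q) (2 * k) 0 (fun j =>
    haar q (star (tc q (2 * k) 0 j) * tc q (2 * k) 0 j) * hwNorm q k -
      haar q (star (ψ q (sph q k j)) * ψ q (sph q k j)) *
        haar q (star (tc q (2 * k) 0 0) * tc q (2 * k) 0 0)) ?_ j hj
  -- After scaling, both identities have the same multiple of 1 on the right, so their difference is
  -- a vanishing combination of independent products of monomials.
  have h1 := congrArg (hwNorm q k • ·) (sum_haar_star_tc_mul (q := q) (2 * k))
  have h2 := congrArg (haar q (star (tc q (2 * k) 0 0) * tc q (2 * k) 0 0) • ·)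
    (sum_haar_star_sph_mul (q := q) k k)
  simp only [Finset.smul_sum, smul_smul] at h1 h2
  have h3 := h1.trans ((congrArg (· • (1 : CG q)) (mul_comm _ _)).trans h2.symm)
  rw [← sub_eq_zero, ← Finset.sum_sub_distrib] at h3
  rw [← h3]
  refine Finset.sum_congr rfl fun i hi => ?_
  rw [Finset.sum_eq_single_of_mem i hi, sub_smul, mul_comm _ (hwNorm q k),
    mul_comm _ (haar q (star (tc q (2 * k) 0 0) * tc q (2 * k) 0 0))]
  · rfl
  · intro j _ hj
    rw [haar_star_sph_mul_eq_zero (by omega), mul_zero, zero_smul]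

theorem haar_star_sph_mul_self_ne_zero {k j : ℕ} (hj : j ≤ 2 * k) :
    haar q (star (ψ q (sph q k j)) * ψ q (sph q k j)) ≠ 0 := fun h => by
  have := haar_star_tc_mul_hwNorm (q := q) hj
  rw [h, zero_mul] at this
  exact mul_ne_zero (haar_star_tc_mul_self_ne_zero hj) (hwNorm_ne_zero k) this

end Orthogonality

open Presentation

/-! ### The counit -/

section Counit

variable (q : ℝ) [NeZero q]

theorem isSUq2_one {B : Type} [Ring B] [StarRing B] [Algebra ℂ B] :
    IsSUq2 q (1 : Matrix (Fin 2) (Fin 2) B) := by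
  refine ⟨by simp, by simp, by simp, by simp, by simp, by simp⟩

/-- The slice map `ε ⊗ id` of the counit. -/
def counitSlice : CGG q →⋆ₐ[ℂ] CG q :=
  lift ((suq2 q).tensor (suq2 q)) (suq2 q)
    (Sum.elim (fun ij => (1 : Matrix (Fin 2) (Fin 2) (CG q)) ij.1 ij.2) (fun ij => (suq2 q).gen ij))
    (fun x => ⟨Sum.elim (fun ij => (1 : Matrix (Fin 2) (Fin 2) BddOp) ij.1 ij.2) x.1,
      isSUq2_one q, x.2, by
        rintro ⟨i, j⟩ k
        rcases eq_or_ne i j with rfl | h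
        · simp
        · simp [h]⟩)
    (by
      rintro (⟨i, j⟩ | ij) x
      · fin_cases i <;> fin_cases j <;> rfl
      · rfl)

variable {q}

theorem counitSlice_inl_u (i j : Fin 2) :
    counitSlice q (inl _ _ (u q i j)) = (1 : Matrix (Fin 2) (Fin 2) (CG q)) i j := by
  rw [u, Matrix.of_apply, inl_gen]
  exact lift_gen _ _ _ _ _ _

theorem counitSlice_inr (x : CG q) : counitSlice q (inr _ _ x) = x := by
  refine hom_ext (f := (counitSlice q).comp (inr _ _)) (g := StarAlgHom.id ℂ _) (fun i => ?_) x
  rfl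

theorem counitSlice_Δ (x : CG q) : counitSlice q (Δ q x) = x := by
  refine hom_ext (f := (counitSlice q).comp (Δ q)) (g := StarAlgHom.id ℂ _) (fun ij => ?_) x
  obtain ⟨i, j⟩ := ij
  change counitSlice q (Δ q (u q i j)) = u q i j
  rw [Δ_u, map_sum]
  simp only [map_mul, counitSlice_inl_u, counitSlice_inr]
  rw [← Matrix.mul_apply, one_mul]

theorem counit_xi : counitSlice q (inl _ _ (ψ q (xi q))) = 0 := by
  rw [ψ_xi, map_mul, map_mul, counitSlice_inl_u]
  simp

theorem counit_eta : counitSlice q (inl _ _ (ψ q (eta q))) = 0 := by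
  rw [ψ_eta, map_mul, map_mul, counitSlice_inl_u, counitSlice_inl_u]
  simp

theorem counit_zeta : counitSlice q (inl _ _ (ψ q (zeta q))) = 1 := by
  rw [zeta, map_sub, map_sub, map_sub, map_smul (ψ q), map_smul (inl _ _), map_smul (counitSlice q),
    counit_xi, smul_zero, sub_zero, map_one, map_one, map_one]

/-- The counit kills η and η* and sends ζ to 1, so only the ζ term of the recursion survives. It
raises k and l together, which leaves the zonal index l = k. -/
theorem counit_sph : ∀ k l : ℕ, ∃ γ : ℂ, (γ = 0 ↔ l ≠ k) ∧
    counitSlice q (inl _ _ (ψ q (sph q k l))) = γ • (1 : CG q)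
  | 0, 0 => ⟨1, by simp, by rw [sph]; simp⟩
  | 0, l + 1 => ⟨0, by simp, by rw [sph]; simp⟩
  | k + 1, 0 => ⟨0, by simp, by
      rw [sph, map_mul, map_mul, map_mul, counit_eta, zero_mul, zero_smul]⟩
  | k + 1, 1 => by
    obtain ⟨γ, h1, h2⟩ := counit_sph k 0
    refine ⟨(q : ℂ) * γ, ?_, ?_⟩
    · rw [mul_eq_zero, or_iff_right q_ne_zero, h1]; omega
    · rw [sph]
      simp only [map_add, map_smul, map_mul]
      rw [counit_eta, zero_mul, smul_zero, zero_add, counit_zeta, one_mul, h2, smul_smul]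
  | k + 1, l + 2 => by
    obtain ⟨γ, h1, h2⟩ := counit_sph k (l + 1)
    refine ⟨(q : ℂ) ^ (l + 2) * γ, ?_, ?_⟩
    · rw [mul_eq_zero, or_iff_right (pow_ne_zero _ q_ne_zero), h1]; omega
    · rw [sph]
      simp only [map_add, map_smul, map_mul, map_star]
      rw [counit_eta, star_zero, zero_mul, smul_zero, zero_mul, smul_zero, zero_add, add_zero,
        counit_zeta, one_mul, h2, smul_smul]

/-- Apply ε ⊗ id to `Δ_ψ_sph`: only the middle row j = k remains. Hence orthogonality on the sphere
also governs the matrix coefficients tc (2k) k i. -/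
theorem exists_ψ_sph_eq_tc [Fact (|q| < 1)] (k : ℕ) :
    ∃ γ : ℂ, γ ≠ 0 ∧ ∀ i ≤ 2 * k, ψ q (sph q k i) = γ • tc q (2 * k) k i := by
  obtain ⟨γ, h1, h2⟩ := counit_sph (q := q) k k
  refine ⟨γ, fun h => (h1.1 h) rfl, fun i hi => ?_⟩
  rw [← counitSlice_Δ (ψ q (sph q k i)), Δ_ψ_sph q k i hi, map_sum,
    Finset.sum_eq_single_of_mem k (Finset.mem_range.2 (by omega))]
  · rw [map_mul, h2, counitSlice_inr, smul_mul_assoc, one_mul]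
  · intro j _ hj
    obtain ⟨γ', h1', h2'⟩ := counit_sph (q := q) k j
    rw [map_mul, h2', h1'.2 hj, zero_smul, zero_mul]

end Counit

/-! ### The invariant state -/

section State

variable (q : ℝ) [hq : Fact (|q| < 1)] [NeZero q]

theorem haar_star_mul_self_nonneg (a : CG q) : 0 ≤ haar q (star a * a) := by
  rw [haar_star_mul, inner_self_eq_norm_sq_to_K (𝕜 := ℂ)]
  exact (Complex.zero_le_real.2 (sq_nonneg ‖reg q a (vac q)‖)).trans_eq (Complex.ofReal_pow _ _)

/-- The invariant state. -/
def hState : CS q →ₚ[ℂ] ℂ :=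
  PositiveLinearMap.mk₀ ((haar q).toLinearMap ∘ₗ (ψ q).toAlgHom.toLinearMap) (by
    intro x hx
    obtain ⟨b, rfl⟩ := CStarAlgebra.nonneg_iff_eq_star_mul_self.1 hx
    change 0 ≤ haar q (ψ q (star b * b))
    rw [map_mul, map_star (ψ q)]
    exact haar_star_mul_self_nonneg q _)

theorem hState_apply (a : CS q) : hState q a = haar q (ψ q a) := rfl

theorem isInvariantState_hState : IsInvariantState (hState q) := by
  refine ⟨?_, (leftSlice q (suq2 q)).comp ⟨(ψid q : _ →ₗ[ℂ] _), continuous_starAlgHom _⟩, ?_, ?_⟩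
  · rw [hState_apply, map_one, haar_one]
  · intro a g
    change leftSlice q (suq2 q) (ψid q _) = _
    rw [map_mul, ψid_inl, ψid_inr, leftSlice_tmul, hState_apply]
  · intro a
    change leftSlice q (suq2 q) (ψid q _) = _
    rw [ψid_comp_τ, leftSlice_Δ_ψ, hState_apply]

variable {q}

/-- Apply the invariance to ηᵏ and pair with the monomial of index i. That monomial is orthogonal to
1 and to the other monomials, but not to itself. -/
theorem IsInvariantState.apply_sph {ρ : CS q →ₚ[ℂ] ℂ} (h : IsInvariantState ρ) {k i : ℕ}
    (hk : k ≠ 0) (hi : i ≤ 2 * k) : ρ (sph q k i) = 0 := by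
  obtain ⟨-, S, h1, h2⟩ := h
  have h3 := congrArg (fun y => haar q (star (mono q i (2 * k - i)) * y)) (h2 (eta q ^ k))
  rw [τ_eta_pow, map_sum, Finset.mul_sum, map_sum,
    Finset.sum_eq_single_of_mem i (Finset.mem_range.2 (by omega)), h1, mul_smul_comm, mul_smul_comm,
    map_smul, map_smul, haar_star_mul_eq_zero (hasDeg_mono _ _) HasDeg.one (by omega), smul_zero,
    smul_eq_mul] at h3
  · exact (mul_eq_zero.1 h3).resolve_right (haar_star_mono_mul_self_ne_zero _ _)
  · intro j _ hj
    rw [h1, mul_smul_comm, map_smul, haar_star_mono_mul_eq_zero (Or.inl hj.symm), smul_zero]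

theorem IsInvariantState.eq_hState {ρ : CS q →ₚ[ℂ] ℂ} (h : IsInvariantState ρ) : ρ = hState q := by
  have h1 : Continuous ρ := map_continuous ρ
  have h2 : Continuous (hState q) := map_continuous (hState q)
  refine DFunLike.coe_injective (Continuous.ext_on dense_polySph h1 h2 fun x hx => ?_)
  have hx' := polySph_eq_span hx
  clear hx
  induction hx' using Submodule.span_induction with
  | mem x hx =>
    obtain ⟨k, i, hi, rfl⟩ := hx
    rcases eq_or_ne k 0 with rfl | hk
    · obtain rfl : i = 0 := by omega
      rw [sph_zero_zero, h.1, (isInvariantState_hState q).1]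
    · rw [h.apply_sph hk hi, (isInvariantState_hState q).apply_sph hk hi]
  | zero => rw [map_zero, map_zero]
  | add x y _ _ hx hy => rw [map_add, map_add, hx, hy]
  | smul c x _ hx => rw [map_smul, map_smul, hx]

end State

open Presentation

/-! ### The GNS space and the slices of the unitary representation -/

section GNSSpace

variable (q : ℝ) [hq : Fact (|q| < 1)] [NeZero q]

/-- The GNS space of the invariant state. -/
abbrev HS : Type := (hState q).GNS

/-- The canonical map to the GNS space, as a linear map. -/
def gnsLin : CS q →ₗ[ℂ] HS q :=
  (UniformSpace.Completion.toComplₗᵢ (𝕜 := ℂ) (E := (hState q).PreGNS)).toLinearMap ∘ₗ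
    (hState q).toPreGNS.toLinearMap

theorem gnsVec_eq (a : CS q) : gnsVec (hState q) a = gnsLin q a := rfl

variable {q}

theorem inner_gnsLin (a b : CS q) : ⟪gnsLin q a, gnsLin q b⟫_ℂ = haar q (star (ψ q a) * ψ q b) := by
  have h : ⟪gnsLin q a, gnsLin q b⟫_ℂ = hState q (star a * b) :=
    UniformSpace.Completion.inner_coe (𝕜 := ℂ) (E := (hState q).PreGNS) _ _
  rw [h, hState_apply, map_mul, map_star (ψ q)]

theorem norm_gnsLin_sq (a : CS q) : ((‖gnsLin q a‖ ^ 2 : ℝ) : ℂ) = haar q (star (ψ q a) * ψ q a) := by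
  rw [← inner_gnsLin, inner_self_eq_norm_sq_to_K (𝕜 := ℂ)]
  exact Complex.ofReal_pow _ _

theorem gnsStarAlgHom_gnsLin (a b : CS q) :
    (hState q).gnsStarAlgHom a (gnsLin q b) = gnsLin q (a * b) :=
  (hState q).gnsNonUnitalStarAlgHom_apply_coe

theorem dense_range_gnsLin : DenseRange (gnsLin q) := by
  have h : DenseRange ((↑) : (hState q).PreGNS → (hState q).GNS) :=
    UniformSpace.Completion.denseRange_coe
  exact h

theorem continuous_gnsLin : Continuous (gnsLin q) := by
  have h : ⇑(gnsLin q) = fun a => (hState q).gnsStarAlgHom a (gnsLin q 1) := by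
    ext a
    rw [gnsStarAlgHom_gnsLin, mul_one]
  rw [h]
  exact (continuous_starAlgHom (hState q).gnsStarAlgHom).clm_apply continuous_const

theorem ext_inner_gnsLin {x y : HS q} (h : ∀ b, ⟪gnsLin q b, x⟫_ℂ = ⟪gnsLin q b, y⟫_ℂ) : x = y := by
  refine ext_inner_left ℂ fun v => ?_
  refine congrFun (Continuous.ext_on (f := fun v => ⟪v, x⟫_ℂ) (g := fun v => ⟪v, y⟫_ℂ)
    dense_range_gnsLin ?_ ?_ ?_) v
  · fun_prop
  · fun_prop
  · rintro _ ⟨b, rfl⟩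
    exact h b

/-- Matrix coefficients of the slices of the unitary representation. -/
theorem inner_sliceOp {ω : CG q →L[ℂ] ℂ} {S : CSG q →L[ℂ] CS q}
    (hS : ∀ (a : CS q) (g : CG q), S (inl _ _ a * inr _ _ g) = ω g • a) (a b : CS q) :
    ⟪gnsLin q b, gnsLin q (S (τ q a))⟫_ℂ =
      ω (leftSlice q (suq2 q) (inl _ _ (star (ψ q b)) * Δ q (ψ q a))) := by
  rw [inner_gnsLin, ← ψid_comp_τ]
  let ψL : CS q →L[ℂ] CG q := ⟨(ψ q : _ →ₗ[ℂ] _), continuous_starAlgHom _⟩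
  let ψidL : CSG q →L[ℂ] CGG q := ⟨(ψid q : _ →ₗ[ℂ] _), continuous_starAlgHom _⟩
  refine tensor_clm_ext
    (f := (haar q).comp ((ContinuousLinearMap.mul ℂ _ (star (ψ q b))).comp (ψL.comp S)))
    (g := ω.comp ((leftSlice q (suq2 q)).comp
      ((ContinuousLinearMap.mul ℂ _ (inl _ _ (star (ψ q b)))).comp ψidL))) (fun a g => ?_) (τ q a)
  change haar q (star (ψ q b) * ψ q (S _)) = ω (leftSlice q (suq2 q) (_ * ψid q _))
  rw [hS, map_smul (ψ q), mul_smul_comm, map_smul, map_mul (ψid q), ψid_inl, ψid_inr, ← mul_assoc,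
    ← map_mul, leftSlice_tmul, map_smul, smul_eq_mul, smul_eq_mul, mul_comm]

/-- Invariance says that (h ⊗ h)Δ = h on the sphere, so applying Δψ(a) to the product vacuum
preserves the GNS norm. -/
theorem norm_biReg_Δ_ψ (a : CS q) : ‖biReg q (Δ q (ψ q a)) (biVac q)‖ = ‖gnsLin q a‖ := by
  rw [← sq_eq_sq₀ (norm_nonneg _) (norm_nonneg _)]
  have h := haar_leftSlice_star_mul q (Δ q (ψ q a)) (Δ q (ψ q a))
  rw [inner_self_eq_norm_sq_to_K (𝕜 := ℂ), ← map_star (Δ q), ← map_mul, ← map_star (ψ q), ← map_mul,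
    leftSlice_Δ_ψ, map_smul, haar_one, smul_eq_mul, mul_one, map_mul, map_star (ψ q),
    ← norm_gnsLin_sq] at h
  exact (Complex.ofReal_injective (h.trans (Complex.ofReal_pow _ _).symm)).symm

theorem norm_biReg_tmul (b : CS q) (y : CG q) :
    ‖biReg q (inl _ _ (ψ q b) * inr _ _ y) (biVac q)‖ = ‖gnsLin q b‖ * ‖reg q y (vac q)‖ := by
  rw [← sq_eq_sq₀ (norm_nonneg _) (by positivity)]
  have h := haar_leftSlice_star_mul q (inl _ _ (ψ q b) * inr _ _ y) (inl _ _ (ψ q b) * inr _ _ y)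
  rw [inner_self_eq_norm_sq_to_K (𝕜 := ℂ), star_tmul, tmul_mul_tmul, leftSlice_tmul, map_smul,
    haar_star_mul q y, inner_self_eq_norm_sq_to_K (𝕜 := ℂ), smul_eq_mul, ← norm_gnsLin_sq] at h
  rw [mul_pow]
  refine (Complex.ofReal_injective ?_).symm
  push_cast
  push_cast at h
  exact h

/-- Makes the slice bounded on the GNS space. With b the sliced element, ‖b‖² is the inner product
of (b ⊗ y)Ω and Δψ(a)Ω for the product vacuum Ω, and Cauchy–Schwarz bounds it by ‖b‖ ‖yΩ‖ ‖a‖. -/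
theorem norm_gnsLin_rightSlice_le (y : CG q) (a : CS q) :
    ‖gnsLin q (rightSlice q (sphere q) y (τ q a))‖ ≤ ‖reg q y (vac q)‖ * ‖gnsLin q a‖ := by
  set b := rightSlice q (sphere q) y (τ q a) with hb
  have h1 : ⟪gnsLin q b, gnsLin q b⟫_ℂ = ⟪biReg q (inl _ _ (ψ q b) * inr _ _ y) (biVac q),
      biReg q (Δ q (ψ q a)) (biVac q)⟫_ℂ := by
    rw [← haar_leftSlice_star_mul, star_tmul, mul_assoc]
    have h2 := inner_sliceOp (ω := (haar q).comp (ContinuousLinearMap.mul ℂ _ (star y)))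
      (S := rightSlice q (sphere q) y) (fun a g => rightSlice_tmul q (sphere q) y a g) a b
    rw [← hb] at h2
    rw [h2]
    change haar q (star y * leftSlice q (suq2 q) _) = _
    congr 1
    let ML : CG q → CG q →L[ℂ] CG q := fun z => ContinuousLinearMap.mul ℂ _ z
    let ML2 : CGG q → CGG q →L[ℂ] CGG q := fun z => ContinuousLinearMap.mul ℂ _ z
    refine tensor_clm_ext
      (f := (ML (star y)).comp ((leftSlice q (suq2 q)).comp (ML2 (inl _ _ (star (ψ q b))))))
      (g := (leftSlice q (suq2 q)).comp ((ML2 (inl _ _ (star (ψ q b)))).comp (ML2 (inr _ _ (star y)))))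
      (fun a g => ?_) (Δ q (ψ q a))
    change star y * leftSlice q (suq2 q) (_ * _) = leftSlice q (suq2 q) (_ * (_ * _))
    rw [inr_mul_tmul, ← mul_assoc, ← mul_assoc, ← map_mul, leftSlice_tmul, leftSlice_tmul,
      mul_smul_comm]
  have h3 : ‖gnsLin q b‖ * ‖gnsLin q b‖ ≤ (‖reg q y (vac q)‖ * ‖gnsLin q a‖) * ‖gnsLin q b‖ := by
    calc ‖gnsLin q b‖ * ‖gnsLin q b‖ = ‖⟪gnsLin q b, gnsLin q b⟫_ℂ‖ := by
          rw [inner_self_eq_norm_sq_to_K (𝕜 := ℂ), norm_pow, RCLike.norm_ofReal, abs_norm, sq]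
      _ ≤ _ := by
          rw [h1]
          refine (norm_inner_le_norm (𝕜 := ℂ) _ _).trans_eq ?_
          rw [norm_biReg_tmul, norm_biReg_Δ_ψ]
          ring
  rcases (norm_nonneg (gnsLin q b)).eq_or_lt with h | h
  · rw [← h]; positivity
  · exact le_of_mul_le_mul_right h3 h

/-- The slice `id ⊗ h(y* ·)` of the unitary representation. -/
def sliceOp (y : CG q) : HS q →L[ℂ] HS q :=
  (LinearMap.mkContinuous ((hState q).toPreGNS.toLinearMap ∘ₗ
    (rightSlice q (sphere q) y).toLinearMap ∘ₗ (τ q).toAlgHom.toLinearMap ∘ₗ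
      (hState q).ofPreGNS.toLinearMap) ‖reg q y (vac q)‖ (by
    intro a
    have h := norm_gnsLin_rightSlice_le y ((hState q).ofPreGNS a)
    have e : ∀ b : CS q, ‖gnsLin q b‖ = ‖(hState q).toPreGNS b‖ := fun b =>
      UniformSpace.Completion.norm_coe (E := (hState q).PreGNS) _
    rw [e, e] at h
    exact h)).completion

theorem sliceOp_gnsLin (y : CG q) (a : CS q) :
    sliceOp y (gnsLin q a) = gnsLin q (rightSlice q (sphere q) y (τ q a)) :=
  ContinuousLinearMap.completion_apply_coe _ _

theorem sliceOp_mem (y : CG q) : sliceOp y ∈ sliceOps (hState q) :=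
  ⟨(haar q).comp (ContinuousLinearMap.mul ℂ _ (star y)), rightSlice q (sphere q) y,
    fun a g => rightSlice_tmul q (sphere q) y a g, fun a => sliceOp_gnsLin y a⟩

/-- The functional ω enters only through the matrix coefficients, so every slice maps each block
into itself. -/
theorem sliceOps_apply_sph {ω : CG q →L[ℂ] ℂ} {S : CSG q →L[ℂ] CS q}
    (hS : ∀ (a : CS q) (g : CG q), S (inl _ _ a * inr _ _ g) = ω g • a) {k i : ℕ} (hi : i ≤ 2 * k) :
    gnsLin q (S (τ q (sph q k i))) =
      ∑ j ∈ Finset.range (2 * k + 1), ω (tc q (2 * k) j i) • gnsLin q (sph q k j) := by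
  refine ext_inner_gnsLin fun b => ?_
  rw [inner_sliceOp hS, Δ_ψ_sph q k i hi, leftSlice_inl_mul_sum, map_sum, inner_sum]
  refine Finset.sum_congr rfl fun j _ => ?_
  rw [map_smul, inner_smul_right, inner_gnsLin, smul_eq_mul, mul_comm]

theorem sliceOp_sph (y : CG q) {k i : ℕ} (hi : i ≤ 2 * k) :
    sliceOp y (gnsLin q (sph q k i)) =
      ∑ j ∈ Finset.range (2 * k + 1), haar q (star y * tc q (2 * k) j i) • gnsLin q (sph q k j) := by
  rw [sliceOp_gnsLin, sliceOps_apply_sph (ω := (haar q).comp (ContinuousLinearMap.mul ℂ _ (star y)))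
    (fun a g => rightSlice_tmul q (sphere q) y a g) hi]
  rfl

end GNSSpace

open Presentation

/-! ### The spin blocks -/

section Blocks

variable {q : ℝ} [hq : Fact (|q| < 1)] [NeZero q]

theorem inner_gnsLin_sph_of_ne {k l i j : ℕ} (h : k ≠ l ∨ i ≠ j) (hi : i ≤ 2 * k) (hj : j ≤ 2 * l) :
    ⟪gnsLin q (sph q k i), gnsLin q (sph q l j)⟫_ℂ = 0 := by
  rw [inner_gnsLin, haar_star_sph_mul_of_ne h hi hj]

theorem gnsLin_sph_ne_zero {k i : ℕ} (hi : i ≤ 2 * k) : gnsLin q (sph q k i) ≠ 0 := by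
  intro h
  have h1 := inner_gnsLin (sph q k i) (sph q k i)
  rw [h, inner_zero_left] at h1
  exact haar_star_sph_mul_self_ne_zero hi h1.symm

/-- The index set of the orthonormal basis of the GNS space. -/
abbrev SphIdx : Type := Σ k : ℕ, Fin (2 * k + 1)

theorem SphIdx.le (p : SphIdx) : (p.2 : ℕ) ≤ 2 * p.1 := Nat.lt_succ_iff.1 p.2.2

theorem dense_span_sph : (Submodule.span ℂ
    (Set.range fun p : SphIdx => gnsLin q (sph q p.1 p.2))).topologicalClosure = ⊤ := by
  set V := (Submodule.span ℂ (Set.range fun p : SphIdx => gnsLin q (sph q p.1 p.2))).topologicalClosure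
    with hV
  have hc : IsClosed (V : Set (HS q)) := Submodule.isClosed_topologicalClosure _
  have h1 : ∀ x ∈ polySph q, gnsLin q x ∈ V := by
    intro x hx
    have h2 : Submodule.span ℂ {y | ∃ k i, i ≤ 2 * k ∧ y = sph q k i} ≤ V.comap (gnsLin q) := by
      refine Submodule.span_le.2 ?_
      rintro _ ⟨k, i, hi, rfl⟩
      exact Submodule.le_topologicalClosure _
        (Submodule.subset_span ⟨⟨k, ⟨i, Nat.lt_succ_iff.2 hi⟩⟩, rfl⟩)
    exact h2 (polySph_eq_span hx)
  have h3 : ∀ x, gnsLin q x ∈ V := fun x =>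
    (hc.preimage continuous_gnsLin).closure_subset_iff.2 h1 (dense_polySph x)
  refine top_unique fun x _ => ?_
  refine hc.closure_subset_iff.2 ?_ (dense_range_gnsLin x)
  rintro _ ⟨y, rfl⟩
  exact h3 y

theorem clm_ext_sph {E : Type} [NormedAddCommGroup E] [NormedSpace ℂ E] {f g : HS q →L[ℂ] E}
    (h : ∀ k i, i ≤ 2 * k → f (gnsLin q (sph q k i)) = g (gnsLin q (sph q k i))) : f = g := by
  refine ContinuousLinearMap.ext_on (s := Set.range fun p : SphIdx => gnsLin q (sph q p.1 p.2)) ?_ ?_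
  · rw [dense_iff_closure_eq, ← Submodule.topologicalClosure_coe, dense_span_sph]
    rfl
  · rintro _ ⟨p, rfl⟩
    exact h _ _ p.le

/-- The normalized basis vectors. -/
def sphVec (q : ℝ) [Fact (|q| < 1)] [NeZero q] (p : SphIdx) : HS q :=
  ((‖gnsLin q (sph q p.1 p.2)‖ : ℂ)⁻¹) • gnsLin q (sph q p.1 p.2)

theorem gnsLin_sph (p : SphIdx) :
    gnsLin q (sph q p.1 p.2) = (‖gnsLin q (sph q p.1 p.2)‖ : ℂ) • sphVec q p := by
  rw [sphVec, smul_smul, mul_inv_cancel₀, one_smul]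
  exact Complex.ofReal_ne_zero.2 (norm_ne_zero_iff.2 (gnsLin_sph_ne_zero p.le))

theorem orthonormal_sphVec : Orthonormal ℂ (sphVec q) := by
  constructor
  · intro p
    rw [sphVec, norm_smul, norm_inv, Complex.norm_real, norm_norm, inv_mul_cancel₀]
    exact norm_ne_zero_iff.2 (gnsLin_sph_ne_zero p.le)
  · rintro ⟨k, i⟩ ⟨l, j⟩ h
    rw [sphVec, sphVec, inner_smul_left, inner_smul_right, inner_gnsLin_sph_of_ne, mul_zero, mul_zero]
    · by_contra! h'
      obtain ⟨rfl, h2⟩ := h'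
      obtain rfl : i = j := Fin.ext h2
      exact h rfl
    · exact SphIdx.le ⟨k, i⟩
    · exact SphIdx.le ⟨l, j⟩

theorem span_sphVec : (Submodule.span ℂ (Set.range (sphVec q))).topologicalClosure = ⊤ := by
  refine top_unique ?_
  rw [← dense_span_sph (q := q)]
  refine Submodule.topologicalClosure_mono (Submodule.span_le.2 ?_)
  rintro _ ⟨p, rfl⟩
  rw [SetLike.mem_coe]
  beta_reduce
  rw [gnsLin_sph]
  exact Submodule.smul_mem _ _ (Submodule.subset_span ⟨p, rfl⟩)

/-- The orthonormal basis of the GNS space. -/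
def sphBasis (q : ℝ) [Fact (|q| < 1)] [NeZero q] : HilbertBasis SphIdx ℂ (HS q) :=
  HilbertBasis.mk orthonormal_sphVec span_sphVec.ge

theorem sphBasis_apply (p : SphIdx) : sphBasis q p = sphVec q p := by
  rw [sphBasis, HilbertBasis.coe_mk]

/-- The span of the basis vectors of spin `k`. -/
def block (q : ℝ) [Fact (|q| < 1)] [NeZero q] (k : ℕ) : Submodule ℂ (HS q) :=
  Submodule.span ℂ (Set.range fun i : Fin (2 * k + 1) => gnsLin q (sph q k i))

theorem gnsLin_sph_mem_block {k i : ℕ} (hi : i ≤ 2 * k) : gnsLin q (sph q k i) ∈ block q k :=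
  Submodule.subset_span ⟨⟨i, Nat.lt_succ_iff.2 hi⟩, rfl⟩

theorem block_le {k : ℕ} {V : Submodule ℂ (HS q)} (h : ∀ i ≤ 2 * k, gnsLin q (sph q k i) ∈ V) :
    block q k ≤ V := by
  refine Submodule.span_le.2 ?_
  rintro _ ⟨i, rfl⟩
  exact h _ (Nat.lt_succ_iff.1 i.2)

theorem linearIndependent_gnsLin_sph (k : ℕ) :
    LinearIndependent ℂ fun i : Fin (2 * k + 1) => gnsLin q (sph q k i) := by
  refine linearIndependent_of_ne_zero_of_inner_eq_zero
    (fun i => gnsLin_sph_ne_zero (Nat.lt_succ_iff.1 i.2)) fun i j h => ?_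
  exact inner_gnsLin_sph_of_ne (Or.inr fun h' => h (Fin.ext h')) (Nat.lt_succ_iff.1 i.2)
    (Nat.lt_succ_iff.1 j.2)

theorem finrank_block (k : ℕ) : Module.finrank ℂ (block q k) = 2 * k + 1 := by
  rw [block, finrank_span_eq_card (linearIndependent_gnsLin_sph k), Fintype.card_fin]

theorem inner_block {k l : ℕ} (h : k ≠ l) {x y : HS q} (hx : x ∈ block q k) (hy : y ∈ block q l) :
    ⟪x, y⟫_ℂ = 0 := by
  have h1 : block q k ≤ (block q l)ᗮ := by
    refine block_le fun i hi => ?_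
    rw [Submodule.mem_orthogonal']
    intro y hy
    have h2 : block q l ≤ (ℂ ∙ gnsLin q (sph q k i))ᗮ := by
      refine block_le fun j hj => ?_
      rw [Submodule.mem_orthogonal_singleton_iff_inner_right]
      exact inner_gnsLin_sph_of_ne (Or.inl h) hi hj
    exact Submodule.mem_orthogonal_singleton_iff_inner_right.1 (h2 hy)
  exact Submodule.inner_left_of_mem_orthogonal hy (h1 hx)

theorem exists_inner_sph_ne_zero {x : HS q} (hx : x ≠ 0) :
    ∃ k i, i ≤ 2 * k ∧ ⟪gnsLin q (sph q k i), x⟫_ℂ ≠ 0 := by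
  by_contra! h
  refine hx ?_
  have h1 : innerSL ℂ x = 0 := by
    refine clm_ext_sph fun k i hi => ?_
    rw [innerSL_apply_apply, ← inner_conj_symm, h k i hi, map_zero]
    rfl
  have h2 := congrArg (fun f => f x) h1
  simpa using h2

/-- Slices along coefficients of the zonal vector are of rank one. -/
theorem exists_sliceOp_ψ_sph (k : ℕ) : ∃ c : ℂ, c ≠ 0 ∧ ∀ i ≤ 2 * k, ∀ x : HS q,
    sliceOp (ψ q (sph q k i)) x = (c * ⟪gnsLin q (sph q k i), x⟫_ℂ) • gnsLin q (sph q k k) := by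
  obtain ⟨γ, hγ, h⟩ := exists_ψ_sph_eq_tc (q := q) k
  refine ⟨γ⁻¹, inv_ne_zero hγ, fun i hi x => ?_⟩
  have H : sliceOp (ψ q (sph q k i)) =
      (γ⁻¹ • innerSL ℂ (gnsLin q (sph q k i))).smulRight (gnsLin q (sph q k k)) := by
    -- Left degrees leave only the multiple of sph l l. Its coefficient is, up to a constant, the
    -- inner product of sph k i and sph l j.
    refine clm_ext_sph fun l j hj => ?_
    rw [sliceOp_sph _ hj, ContinuousLinearMap.smulRight_apply, smul_apply,
      innerSL_apply_apply, smul_eq_mul]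
    rw [Finset.sum_eq_single_of_mem l (Finset.mem_range.2 (by omega))]
    · obtain ⟨γ', hγ', h'⟩ := exists_ψ_sph_eq_tc (q := q) l
      have e : tc q (2 * l) l j = γ'⁻¹ • ψ q (sph q l j) := by
        rw [h' j hj, smul_smul, inv_mul_cancel₀ hγ', one_smul]
      by_cases hkl : k = l ∧ i = j
      · obtain ⟨rfl, rfl⟩ := hkl
        have e' : tc q (2 * k) k i = γ⁻¹ • ψ q (sph q k i) := by
          rw [h i hj, smul_smul, inv_mul_cancel₀ hγ, one_smul]
        rw [e', mul_smul_comm, map_smul, inner_gnsLin, smul_eq_mul]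
      · rw [e, mul_smul_comm, map_smul, haar_star_sph_mul_of_ne (by tauto) hi hj,
          inner_gnsLin_sph_of_ne (by tauto) hi hj, smul_zero, mul_zero, zero_smul, zero_smul]
    · intro m hm hml
      have hm' := Finset.mem_range.1 hm
      rw [haar_star_mul_eq_zero (hasDeg_ψ_sph k i) (hasDeg_tc (2 * l) m (by omega) j) (by omega),
        zero_smul]
  rw [H]
  rfl

/-- Slices along the top row carry the block to the highest weight vector. -/
theorem sliceOp_tc_sph {k m j : ℕ} (hm : m ≤ 2 * k) (hj : j ≤ 2 * k) :
    sliceOp (tc q (2 * k) 0 m) (gnsLin q (sph q k j)) =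
      haar q (star (tc q (2 * k) 0 m) * tc q (2 * k) 0 j) • gnsLin q (sph q k 0) := by
  rw [sliceOp_sph _ hj, Finset.sum_eq_single_of_mem 0 (Finset.mem_range.2 (by omega))]
  intro i hi hi0
  have hi' := Finset.mem_range.1 hi
  rw [haar_star_mul_eq_zero (hasDeg_tc (2 * k) 0 (by omega) m) (hasDeg_tc (2 * k) i (by omega) j)
    (by omega), zero_smul]

/-- Slices along the first column, which consists of the monomials, lead from the highest weight
vector back to each basis vector. -/
theorem sliceOp_mono_sph {k i : ℕ} (hi : i ≤ 2 * k) :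
    sliceOp (mono q i (2 * k - i)) (gnsLin q (sph q k 0)) =
      haar q (star (mono q i (2 * k - i)) * mono q i (2 * k - i)) • gnsLin q (sph q k i) := by
  rw [sliceOp_sph _ (by omega), Finset.sum_eq_single_of_mem i (Finset.mem_range.2 (by omega)),
    tc_zero_right q _ _ hi]
  intro j hj hji
  have hj' := Finset.mem_range.1 hj
  rw [tc_zero_right q _ _ (by omega), haar_star_mono_mul_eq_zero (Or.inl hji.symm), zero_smul]

theorem isInvariantSubspace_block (k : ℕ) : IsInvariantSubspace (hState q) (block q k) := by
  rintro U ⟨ω, S, hS, hU⟩ x hx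
  have : block q k ≤ (block q k).comap U.toLinearMap := by
    refine block_le fun i hi => ?_
    change U (gnsVec (hState q) (sph q k i)) ∈ block q k
    rw [hU, gnsVec_eq, sliceOps_apply_sph hS hi]
    refine Submodule.sum_mem _ fun j hj => ?_
    have hj' := Finset.mem_range.1 hj
    exact Submodule.smul_mem _ _ (gnsLin_sph_mem_block (by omega))
  exact this hx

theorem sliceOp_tc_of_mem_block {k m : ℕ} (hm : m ≤ 2 * k) : ∃ c : ℂ, c ≠ 0 ∧ ∀ x ∈ block q k,
    sliceOp (tc q (2 * k) 0 m) x = (c * ⟪gnsLin q (sph q k m), x⟫_ℂ) • gnsLin q (sph q k 0) := by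
  refine ⟨haar q (star (tc q (2 * k) 0 m) * tc q (2 * k) 0 m) /
    haar q (star (ψ q (sph q k m)) * ψ q (sph q k m)), div_ne_zero (haar_star_tc_mul_self_ne_zero hm)
    (haar_star_sph_mul_self_ne_zero hm), fun x hx => ?_⟩
  have : block q k ≤ LinearMap.eqLocus (sliceOp (tc q (2 * k) 0 m)).toLinearMap
      (((haar q (star (tc q (2 * k) 0 m) * tc q (2 * k) 0 m) /
        haar q (star (ψ q (sph q k m)) * ψ q (sph q k m))) •
          innerSL ℂ (gnsLin q (sph q k m))).smulRight (gnsLin q (sph q k 0))).toLinearMap := by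
    refine block_le fun j hj => ?_
    change sliceOp (tc q (2 * k) 0 m) (gnsLin q (sph q k j)) =
      (_ * ⟪gnsLin q (sph q k m), gnsLin q (sph q k j)⟫_ℂ) • gnsLin q (sph q k 0)
    rw [sliceOp_tc_sph hm hj]
    congr 1
    rcases eq_or_ne m j with rfl | h
    · rw [inner_gnsLin, div_mul_cancel₀ _ (haar_star_sph_mul_self_ne_zero hm)]
    · rw [haar_star_tc_mul_eq_zero h, inner_gnsLin_sph_of_ne (Or.inr h) hm hj, mul_zero]
  exact this hx

/-- A nonzero vector has a nonzero coordinate. The top row slice at that coordinate produces the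
highest weight vector, and the monomial slices produce the whole basis from it. -/
theorem isIrreducibleSubspace_block (k : ℕ) : IsIrreducibleSubspace (hState q) (block q k) := by
  refine ⟨isInvariantSubspace_block k, ?_, fun W hW hinv => ?_⟩
  · intro h
    have := finrank_block (q := q) k
    rw [h, finrank_bot] at this
    omega
  · refine or_iff_not_imp_left.2 fun hW0 => le_antisymm hW (block_le fun i hi => ?_)
    obtain ⟨x, hx, hx0⟩ := Submodule.exists_mem_ne_zero_of_ne_bot hW0
    obtain ⟨l, m, hm, hlm⟩ := exists_inner_sph_ne_zero hx0
    obtain rfl : l = k := by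
      by_contra h
      exact hlm (inner_block h (gnsLin_sph_mem_block hm) (hW hx))
    obtain ⟨c, hc, h⟩ := sliceOp_tc_of_mem_block (q := q) hm
    have h1 := hinv _ (sliceOp_mem (tc q (2 * l) 0 m)) x hx
    rw [h x (hW hx)] at h1
    have h2 := (Submodule.smul_mem_iff _ (mul_ne_zero hc hlm)).1 h1
    have h3 := hinv _ (sliceOp_mem (mono q i (2 * l - i))) _ h2
    rw [sliceOp_mono_sph hi] at h3
    exact (Submodule.smul_mem_iff _ (haar_star_mono_mul_self_ne_zero _ _)).1 h3

theorem IsInvariantSubspace.inf {ρ : CS q →ₚ[ℂ] ℂ} {V W : Submodule ℂ ρ.GNS}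
    (hV : IsInvariantSubspace ρ V) (hW : IsInvariantSubspace ρ W) : IsInvariantSubspace ρ (V ⊓ W) :=
  fun U hU x hx => ⟨hV U hU x hx.1, hW U hU x hx.2⟩

/-- A slice of rank one takes a nonzero vector of V to a nonzero multiple of some zonal vector sph k
k. So V meets a block, and irreducibility of both forces equality. -/
theorem exists_eq_block {V : Submodule ℂ (HS q)} (hV : IsIrreducibleSubspace (hState q) V) :
    ∃ k, V = block q k := by
  obtain ⟨x, hx, hx0⟩ := Submodule.exists_mem_ne_zero_of_ne_bot hV.2.1
  obtain ⟨k, i, hi, h⟩ := exists_inner_sph_ne_zero hx0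
  obtain ⟨c, hc, hc'⟩ := exists_sliceOp_ψ_sph (q := q) k
  have h1 := hV.1 _ (sliceOp_mem (ψ q (sph q k i))) x hx
  rw [hc' i hi] at h1
  have h2 := (Submodule.smul_mem_iff _ (mul_ne_zero hc h)).1 h1
  have h3 : V ⊓ block q k ≠ ⊥ := fun h4 =>
    gnsLin_sph_ne_zero (q := q) (k := k) (i := k) (by omega)
      ((Submodule.eq_bot_iff _).1 h4 _ ⟨h2, gnsLin_sph_mem_block (by omega)⟩)
  have h4 := hV.1.inf (isInvariantSubspace_block k)
  refine ⟨k, ?_⟩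
  rw [← (hV.2.2 _ inf_le_left h4).resolve_left h3,
    ((isIrreducibleSubspace_block k).2.2 _ inf_le_right h4).resolve_left h3]

theorem spinBlock_eq (k : ℕ) : spinBlock (hState q) k = block q k := by
  refine le_antisymm (sSup_le ?_) (le_sSup ⟨isIrreducibleSubspace_block k, finrank_block k⟩)
  rintro V ⟨hV, hk⟩
  obtain ⟨l, rfl⟩ := exists_eq_block hV
  rw [finrank_block] at hk
  obtain rfl : l = k := by omega
  exact le_rfl

theorem orthogonalFamily_spinBlock : OrthogonalFamily ℂ (fun k => spinBlock (hState q) k)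
    (fun k => (spinBlock (hState q) k).subtypeₗᵢ) := by
  intro k l h x y
  exact inner_block h ((spinBlock_eq k).le x.2) ((spinBlock_eq l).le y.2)

theorem iSup_spinBlock : (⨆ k, spinBlock (hState q) k).topologicalClosure = ⊤ := by
  refine top_unique ?_
  rw [← dense_span_sph (q := q)]
  refine Submodule.topologicalClosure_mono (Submodule.span_le.2 ?_)
  rintro _ ⟨p, rfl⟩
  refine Submodule.mem_iSup_of_mem p.1 ?_
  rw [spinBlock_eq]
  exact gnsLin_sph_mem_block p.le

end Blocks

open Presentation

/-! ### Diagonal operators -/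

section Diagonal

variable {ι H : Type} [NormedAddCommGroup H] [InnerProductSpace ℂ H] [CompleteSpace H]

theorem hilbertBasis_ext (b : HilbertBasis ι ℂ H) {x y : H} (h : ∀ i, ⟪b i, x⟫_ℂ = ⟪b i, y⟫_ℂ) :
    x = y := by
  apply b.repr.injective
  ext i
  rw [b.repr_apply_apply, b.repr_apply_apply, h i]

theorem hasSum_norm_inner_sq (b : HilbertBasis ι ℂ H) (x : H) :
    HasSum (fun i => ‖⟪b i, x⟫_ℂ‖ ^ 2) (‖x‖ ^ 2) := by
  have h := (b.hasSum_inner_mul_inner x x).mapL Complex.reCLM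
  rw [inner_self_eq_norm_sq_to_K (𝕜 := ℂ)] at h
  have e : Complex.reCLM ((RCLike.ofReal ‖x‖ : ℂ) ^ 2) = ‖x‖ ^ 2 := by
    change ((‖x‖ : ℂ) ^ 2).re = _
    rw [← Complex.ofReal_pow, Complex.ofReal_re]
  rw [e] at h
  refine h.congr_fun ?_
  intro i
  rw [← inner_conj_symm x (b i)]
  change _ = (starRingEnd ℂ ⟪b i, x⟫_ℂ * ⟪b i, x⟫_ℂ).re
  rw [← Complex.normSq_eq_conj_mul_self, Complex.ofReal_re, Complex.normSq_eq_norm_sq]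

theorem sum_norm_inner_sq_le (b : HilbertBasis ι ℂ H) (x : H) (s : Finset ι) :
    ∑ i ∈ s, ‖⟪b i, x⟫_ℂ‖ ^ 2 ≤ ‖x‖ ^ 2 :=
  sum_le_hasSum s (fun _ _ => sq_nonneg _) (hasSum_norm_inner_sq b x)

/-- A bounded operator from its coordinate functionals. -/
theorem exists_clm_of_coord (b : HilbertBasis ι ℂ H) (φ : ι → H →L[ℂ] ℂ) {C : ℝ} (hC : 0 ≤ C)
    (h : ∀ (x : H) (s : Finset ι), ∑ i ∈ s, ‖φ i x‖ ^ 2 ≤ (C * ‖x‖) ^ 2) :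
    ∃ B : H →L[ℂ] H, ‖B‖ ≤ C ∧ ∀ x i, ⟪b i, B x⟫_ℂ = φ i x := by
  have h2 : (2 : ℝ≥0∞).toReal = (2 : ℕ) := by norm_num
  have h' : ∀ (x : H) (s : Finset ι),
      ∑ i ∈ s, ‖φ i x‖ ^ (2 : ℝ≥0∞).toReal ≤ (C * ‖x‖) ^ (2 : ℝ≥0∞).toReal := by
    intro x s
    simp only [h2, Real.rpow_natCast]
    exact h x s
  let L : H →ₗ[ℂ] lp (fun _ : ι => ℂ) 2 :=
    { toFun := fun x => ⟨fun i => φ i x, memℓp_gen' (h' x)⟩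
      map_add' := fun x y => by ext i; exact map_add (φ i) x y
      map_smul' := fun c x => by ext i; exact map_smul (φ i) c x }
  have hL : ∀ x, ‖L x‖ ≤ C * ‖x‖ := fun x =>
    lp.norm_le_of_forall_sum_le (by norm_num) (by positivity) (h' x)
  refine ⟨b.repr.symm.toLinearIsometry.toContinuousLinearMap.comp (L.mkContinuous C hL), ?_, ?_⟩
  · refine ContinuousLinearMap.opNorm_le_bound _ hC fun x => ?_
    change ‖b.repr.symm (L x)‖ ≤ _
    rw [LinearIsometryEquiv.norm_map]
    exact hL x
  · intro x i
    change ⟪b i, b.repr.symm (L x)⟫_ℂ = _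
    rw [← b.repr_apply_apply, LinearIsometryEquiv.apply_symm_apply]
    rfl

theorem exists_diag (b : HilbertBasis ι ℂ H) (c : ι → ℂ) {C : ℝ} (hC : 0 ≤ C) (h : ∀ i, ‖c i‖ ≤ C) :
    ∃ R : H →L[ℂ] H, ‖R‖ ≤ C ∧ ∀ x i, ⟪b i, R x⟫_ℂ = c i * ⟪b i, x⟫_ℂ := by
  refine exists_clm_of_coord b (fun i => c i • innerSL ℂ (b i)) hC fun x s => ?_
  calc ∑ i ∈ s, ‖c i * ⟪b i, x⟫_ℂ‖ ^ 2 ≤ ∑ i ∈ s, C ^ 2 * ‖⟪b i, x⟫_ℂ‖ ^ 2 := by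
        refine Finset.sum_le_sum fun i _ => ?_
        rw [norm_mul, mul_pow]
        have := h i
        gcongr
    _ ≤ _ := by
        rw [← Finset.mul_sum, mul_pow]
        exact mul_le_mul_of_nonneg_left (sum_norm_inner_sq_le b x s) (sq_nonneg _)

/-- `D` is the maximal diagonal operator with the given eigenvalues. -/
def IsDiag (b : HilbertBasis ι ℂ H) (μ : ι → ℝ) (D : H →ₗ.[ℂ] H) : Prop :=
  ∀ x z, (x, z) ∈ D.graph ↔ ∀ i, ⟪b i, z⟫_ℂ = μ i * ⟪b i, x⟫_ℂ

variable {b : HilbertBasis ι ℂ H} {μ : ι → ℝ} {D : H →ₗ.[ℂ] H}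

theorem mem_graph_iff_exists {x z : H} : (x, z) ∈ D.graph ↔ ∃ h : x ∈ D.domain, D ⟨x, h⟩ = z := by
  rw [LinearPMap.mem_graph_iff]
  constructor
  · rintro ⟨⟨y, hy⟩, rfl, h⟩
    exact ⟨hy, h⟩
  · rintro ⟨h, h'⟩
    exact ⟨⟨x, h⟩, rfl, h'⟩

theorem mem_graph_iff_of_isSelfAdjoint (hD : IsSelfAdjoint D) {x z : H} :
    (x, z) ∈ D.graph ↔ ∀ v w, (v, w) ∈ D.graph → ⟪w, x⟫_ℂ = ⟪v, z⟫_ℂ := by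
  have h := LinearPMap.adjoint_graph_eq_graph_adjoint hD.dense_domain
  rw [LinearPMap.isSelfAdjoint_def.1 hD] at h
  nth_rewrite 1 [h]
  rw [Submodule.mem_adjoint_iff]
  simp only [sub_eq_zero]

theorem inner_eq_of_coord {v w x z : H} (h1 : ∀ i, ⟪b i, w⟫_ℂ = μ i * ⟪b i, v⟫_ℂ)
    (h2 : ∀ i, ⟪b i, z⟫_ℂ = μ i * ⟪b i, x⟫_ℂ) : ⟪w, x⟫_ℂ = ⟪v, z⟫_ℂ := by
  rw [← b.tsum_inner_mul_inner w x, ← b.tsum_inner_mul_inner v z]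
  refine tsum_congr fun i => ?_
  rw [h2, ← inner_conj_symm w, ← inner_conj_symm v, h1, map_mul, Complex.conj_ofReal]
  ring

/-- Pairing with the basis vectors puts D inside the maximal diagonal operator. The two are formally
adjoint to each other, so the latter is contained in D* = D. -/
theorem isDiag_of_isSelfAdjoint (hD : IsSelfAdjoint D)
    (h : ∀ i, (b i, (μ i : ℂ) • b i) ∈ D.graph) : IsDiag b μ D := by
  have h1 : ∀ x z, (x, z) ∈ D.graph → ∀ i, ⟪b i, z⟫_ℂ = μ i * ⟪b i, x⟫_ℂ := by
    intro x z hxz i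
    have := (mem_graph_iff_of_isSelfAdjoint hD).1 hxz _ _ (h i)
    rw [inner_smul_left, Complex.conj_ofReal] at this
    exact this.symm
  exact fun x z => ⟨h1 x z, fun hxz => (mem_graph_iff_of_isSelfAdjoint hD).2
    fun v w hvw => inner_eq_of_coord (h1 v w hvw) hxz⟩

namespace IsDiag

theorem basis_mem (hD : IsDiag b μ D) (i : ι) : (b i, (μ i : ℂ) • b i) ∈ D.graph := by
  classical
  rw [hD]
  intro j
  rw [inner_smul_right]
  rcases eq_or_ne j i with rfl | h
  · rfl
  · rw [b.orthonormal.2 h, mul_zero, mul_zero]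

theorem unique {D' : H →ₗ.[ℂ] H} (hD : IsDiag b μ D) (hD' : IsDiag b μ D') : D = D' := by
  refine LinearPMap.eq_of_eq_graph ?_
  ext ⟨x, z⟩
  rw [hD, hD']

theorem dense_domain (hD : IsDiag b μ D) : Dense (D.domain : Set H) := by
  have h : Submodule.span ℂ (Set.range b) ≤ D.domain := by
    refine Submodule.span_le.2 ?_
    rintro _ ⟨i, rfl⟩
    exact (mem_graph_iff_exists.1 (hD.basis_mem i)).1
  have h2 : Dense (Submodule.span ℂ (Set.range b) : Set H) := by
    rw [dense_iff_closure_eq, ← Submodule.topologicalClosure_coe, b.dense_span]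
    rfl
  exact h2.mono h

theorem isSelfAdjoint (hD : IsDiag b μ D) : IsSelfAdjoint D := by
  rw [LinearPMap.isSelfAdjoint_def]
  refine LinearPMap.eq_of_eq_graph ?_
  rw [LinearPMap.adjoint_graph_eq_graph_adjoint hD.dense_domain]
  ext ⟨x, z⟩
  rw [Submodule.mem_adjoint_iff, hD]
  simp only [sub_eq_zero]
  constructor
  · intro h i
    have := h _ _ (hD.basis_mem i)
    rw [inner_smul_left, Complex.conj_ofReal] at this
    exact this.symm
  · intro h v w hvw
    exact inner_eq_of_coord ((hD v w).1 hvw) h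

/-- A bounded operator that implements the commutator on matrix coefficients. -/
theorem hasBoundedCommutator (hD : IsDiag b μ D) (T B : H →L[ℂ] H)
    (h : ∀ i j, ⟪b i, B (b j)⟫_ℂ = ((μ i : ℂ) - μ j) * ⟪b i, T (b j)⟫_ℂ) :
    HasBoundedCommutator D T := by
  -- Checking coordinates against the graph yields at once that T preserves the domain and that B is
  -- the commutator there.
  have key : ∀ x : D.domain, (T x, T (D x) + B x) ∈ D.graph := by
    intro x
    rw [hD]
    intro i
    have hx := (hD _ _).1 (D.mem_graph x)
    have hexp : ∀ (A : H →L[ℂ] H) (y : H), HasSum (fun j => ⟪b j, y⟫_ℂ * ⟪b i, A (b j)⟫_ℂ)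
        ⟪b i, A y⟫_ℂ := by
      intro A y
      have h1 := b.hasSum_inner_mul_inner (ContinuousLinearMap.adjoint A (b i)) y
      rw [ContinuousLinearMap.adjoint_inner_left] at h1
      refine h1.congr_fun fun j => ?_
      rw [ContinuousLinearMap.adjoint_inner_left, mul_comm]
    have h1 := (hexp T (D x)).add (hexp B x)
    rw [← inner_add_right] at h1
    have h2 := (hexp T x).mul_left (μ i : ℂ)
    refine h1.unique (h2.congr_fun fun j => ?_)
    rw [hx, h]
    ring
  refine ⟨‖B‖, fun x => ?_⟩
  obtain ⟨h1, h2⟩ := mem_graph_iff_exists.1 (key x)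
  refine ⟨h1, ?_⟩
  rw [h2, add_sub_cancel_left]
  exact B.le_opNorm _

theorem commutesWith (hD : IsDiag b μ D) (U : H →L[ℂ] H)
    (h : ∀ i j, μ i ≠ μ j → ⟪b i, U (b j)⟫_ℂ = 0) : CommutesWith D U := by
  intro x
  have key : (U x, U (D x)) ∈ D.graph := by
    rw [hD]
    intro i
    have hx := (hD _ _).1 (D.mem_graph x)
    have hexp : ∀ (y : H), HasSum (fun j => ⟪b j, y⟫_ℂ * ⟪b i, U (b j)⟫_ℂ) ⟪b i, U y⟫_ℂ := by
      intro y
      have h1 := b.hasSum_inner_mul_inner (ContinuousLinearMap.adjoint U (b i)) y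
      rw [ContinuousLinearMap.adjoint_inner_left] at h1
      refine h1.congr_fun fun j => ?_
      rw [ContinuousLinearMap.adjoint_inner_left, mul_comm]
    refine (hexp (D x)).unique (((hexp x).mul_left (μ i : ℂ)).congr_fun fun j => ?_)
    rw [hx]
    by_cases hij : μ i = μ j
    · rw [hij]; ring
    · rw [h i j hij, mul_zero, mul_zero, mul_zero]
  exact mem_graph_iff_exists.1 key

end IsDiag

variable (b μ) in
theorem exists_isDiag : ∃ D : H →ₗ.[ℂ] H, IsDiag b μ D := by
  let g : Submodule ℂ (H × H) :=
    { carrier := {p | ∀ i, ⟪b i, p.2⟫_ℂ = μ i * ⟪b i, p.1⟫_ℂ}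
      zero_mem' := fun i => by simp
      add_mem' := fun {p p'} h h' i => by
        change ⟪b i, p.2 + p'.2⟫_ℂ = μ i * ⟪b i, p.1 + p'.1⟫_ℂ
        rw [inner_add_right, inner_add_right, h i, h' i, mul_add]
      smul_mem' := fun c p h i => by
        change ⟪b i, c • p.2⟫_ℂ = μ i * ⟪b i, c • p.1⟫_ℂ
        rw [inner_smul_right, inner_smul_right, h i]
        ring }
  have hg : ∀ p ∈ g, p.1 = 0 → p.2 = 0 := by
    intro p hp h0
    refine hilbertBasis_ext b fun i => ?_
    rw [hp i, h0, inner_zero_right, mul_zero]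
  refine ⟨g.toLinearPMap, fun x z => ?_⟩
  rw [Submodule.toLinearPMap_graph_eq g hg]
  rfl

/-- Diagonal operators with entries tending to zero are compact. -/
theorem isCompactOperator_of_diag (b : HilbertBasis ι ℂ H) (c : ι → ℂ) (R : H →L[ℂ] H)
    (hR : ∀ x i, ⟪b i, R x⟫_ℂ = c i * ⟪b i, x⟫_ℂ) (hc : ∀ ε > 0, {i | ε ≤ ‖c i‖}.Finite) :
    IsCompactOperator R := by
  classical
  have hcl : IsClosed {T : H →L[ℂ] H | IsCompactOperator T} := isClosed_setOfPred_isCompactOperator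
  refine hcl.closure_subset (Metric.mem_closure_iff.2 fun ε hε => ?_)
  set F := (hc (ε / 2) (half_pos hε)).toFinset with hF
  refine ⟨∑ i ∈ F, c i • (innerSL ℂ (b i)).smulRight (b i), ?_, ?_⟩
  · refine Submodule.sum_mem (compactOperator (RingHom.id ℂ) H H) fun i _ => Submodule.smul_mem _ _ ?_
    change IsCompactOperator ((innerSL ℂ (b i)).smulRight (b i))
    have : IsCompactOperator (innerSL ℂ (b i) : H →L[ℂ] ℂ) :=
      isCompactOperator_of_locallyCompactSpace_dom _
    exact this.clm_comp (ContinuousLinearMap.toSpanSingleton ℂ (b i))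
  · obtain ⟨R', h1, h2⟩ := exists_diag b (fun i => if i ∈ F then 0 else c i) (half_pos hε).le (by
      intro i
      split_ifs with h
      · rw [norm_zero]; exact (half_pos hε).le
      · rw [hF, Set.Finite.mem_toFinset] at h
        exact (not_le.1 h).le)
    have h3 : R - ∑ i ∈ F, c i • (innerSL ℂ (b i)).smulRight (b i) = R' := by
      ext x
      refine hilbertBasis_ext b fun i => ?_
      rw [h2, sub_apply, inner_sub_right, hR, sum_apply, inner_sum]
      have h4 : ∀ j ∈ F, ⟪b i, (c j • (innerSL ℂ (b j)).smulRight (b j)) x⟫_ℂ =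
          if i = j then c i * ⟪b i, x⟫_ℂ else 0 := by
        intro j _
        change ⟪b i, c j • (⟪b j, x⟫_ℂ • b j)⟫_ℂ = _
        rw [inner_smul_right, inner_smul_right, orthonormal_iff_ite.1 b.orthonormal]
        split_ifs with h
        · rw [h, mul_one]
        · rw [mul_zero, mul_zero]
      rw [Finset.sum_congr rfl h4, Finset.sum_ite_eq]
      split_ifs <;> simp
    rw [dist_eq_norm, h3]
    exact h1.trans_lt (half_lt_self hε)

/-- The resolvent is taken at i, where |μ - i| is at least 1 and at least |μ|: it is bounded, and
its entries tend to zero because only finitely many eigenvalues are below each bound. -/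
theorem IsDiag.hasCompactResolvent (hD : IsDiag b μ D) (h : ∀ C, {i | |μ i| ≤ C}.Finite) :
    HasCompactResolvent D := by
  have hne : ∀ i, (μ i : ℂ) - Complex.I ≠ 0 := by
    intro i h
    have := congrArg Complex.im h
    simp at this
  have hn : ∀ i, 1 ≤ ‖(μ i : ℂ) - Complex.I‖ := by
    intro i
    have := Complex.abs_im_le_norm ((μ i : ℂ) - Complex.I)
    simpa using this
  have hn' : ∀ i, |μ i| ≤ ‖(μ i : ℂ) - Complex.I‖ := by
    intro i
    have := Complex.abs_re_le_norm ((μ i : ℂ) - Complex.I)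
    simpa using this
  obtain ⟨R, -, hR⟩ := exists_diag b (fun i => ((μ i : ℂ) - Complex.I)⁻¹) zero_le_one (by
    intro i
    rw [norm_inv]
    exact inv_le_one_of_one_le₀ (hn i))
  refine ⟨Complex.I, R, isCompactOperator_of_diag b _ R hR ?_, ?_, ?_⟩
  · intro ε hε
    refine (h ε⁻¹).subset fun i hi => ?_
    rw [Set.mem_ofPred_eq, norm_inv] at hi
    rw [Set.mem_ofPred_eq]
    exact (hn' i).trans ((le_inv_comm₀ hε (zero_lt_one.trans_le (hn i))).1 hi)
  · intro x
    have : (R x, x + Complex.I • R x) ∈ D.graph := by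
      rw [hD]
      intro i
      rw [inner_add_right, inner_smul_right, hR]
      have := hne i
      field_simp
      ring
    obtain ⟨h1, h2⟩ := mem_graph_iff_exists.1 this
    exact ⟨h1, by rw [h2, add_sub_cancel_right]⟩
  · intro x
    refine hilbertBasis_ext b fun i => ?_
    rw [hR, inner_sub_right, inner_smul_right, (hD _ _).1 (D.mem_graph x) i, ← sub_mul, ← mul_assoc,
      inv_mul_cancel₀ (hne i), one_mul]

/-- Functional calculus on eigenvectors. -/
theorem cfc_apply_eigenvector {R : H →L[ℂ] H} (hR : IsSelfAdjoint R) {v : H} {r : ℝ}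
    (hv : R v = (r : ℂ) • v) {f : ℝ → ℝ} (hf : Continuous f) : cfc f R v = (f r : ℂ) • v := by
  rcases eq_or_ne v 0 with rfl | hv0
  · simp
  have hr : r ∈ spectrum ℝ R := by
    intro hu
    obtain ⟨U, hU⟩ := hu
    refine hv0 ?_
    have h1 : (algebraMap ℝ (H →L[ℂ] H) r - R) v = 0 := by
      rw [sub_apply, hv, Algebra.algebraMap_eq_smul_one]
      change r • v - _ = 0
      rw [Complex.coe_smul, sub_self]
    have h2 : (U.inv * U.val) v = v := by rw [U.inv_val]; rfl
    rw [← h2, hU]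
    change U.inv ((algebraMap ℝ (H →L[ℂ] H) r - R) v) = 0
    rw [h1, map_zero]
  rw [cfc_apply f R hR hf.continuousOn]
  have key : ∀ g : C(spectrum ℝ R, ℝ), cfcHom hR g v = (g ⟨r, hr⟩ : ℂ) • v := by
    intro g
    induction g using ContinuousMap.induction_on_of_compact with
    | const c =>
      have h : cfcHom hR (.const _ c) = algebraMap ℝ (H →L[ℂ] H) c :=
        AlgHomClass.commutes (cfcHom hR) c
      rw [h, Algebra.algebraMap_eq_smul_one]
      exact (Complex.coe_smul c v).symm
    | id => rw [cfcHom_id hR, hv]; rfl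
    | star_id => rw [map_star, cfcHom_id hR, hR.star_eq, hv]; rfl
    | add f g hf hg => rw [map_add, add_apply, hf, hg, ← add_smul, ContinuousMap.add_apply,
        Complex.ofReal_add]
    | mul f g hf hg =>
      rw [map_mul, mul_apply_eq_comp, hg, map_smul, hf, smul_smul, mul_comm, ContinuousMap.mul_apply,
        Complex.ofReal_mul]
    | frequently f hf =>
      have hcl : IsClosed {f : C(spectrum ℝ R, ℝ) | cfcHom hR f v = (f ⟨r, hr⟩ : ℂ) • v} := by
        refine isClosed_eq ((cfcHom_continuous hR).clm_apply continuous_const) ?_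
        exact (Complex.continuous_ofReal.comp (continuous_eval_const _)).smul continuous_const
      exact isClosed_iff_frequently.1 hcl f hf
  exact key _

theorem isSelfAdjoint_of_diag (R : H →L[ℂ] H) (hR : ∀ x i, ⟪b i, R x⟫_ℂ = μ i * ⟪b i, x⟫_ℂ) :
    IsSelfAdjoint R := by
  refine (ContinuousLinearMap.isSelfAdjoint_iff').2
    ((ContinuousLinearMap.eq_adjoint_iff _ _).2 fun x y => ?_).symm
  exact inner_eq_of_coord (hR x) (hR y)

theorem IsDiag.isPSummable (hD : IsDiag b μ D) {p : ℝ} (hp : 0 < p)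
    (h : Summable fun i => ((1 + μ i ^ 2)⁻¹) ^ (p / 2)) : IsPSummable D p := by
  have hpos : ∀ i, 0 < 1 + μ i ^ 2 := fun i => by positivity
  obtain ⟨R, -, hR⟩ := exists_diag b (fun i => (((1 + μ i ^ 2)⁻¹ : ℝ) : ℂ)) zero_le_one (by
    intro i
    rw [Complex.norm_real, Real.norm_of_nonneg (inv_pos.2 (hpos i)).le]
    exact inv_le_one_of_one_le₀ (by nlinarith [sq_nonneg (μ i)]))
  obtain ⟨S, -, hS⟩ := exists_diag b (fun i => ((μ i * (1 + μ i ^ 2)⁻¹ : ℝ) : ℂ)) zero_le_one (by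
    intro i
    rw [Complex.norm_real, Real.norm_eq_abs, ← div_eq_mul_inv, abs_div, abs_of_pos (hpos i),
      div_le_one (hpos i)]
    nlinarith [sq_nonneg (|μ i| - 1), sq_abs (μ i), abs_nonneg (μ i)])
  have hRs := isSelfAdjoint_of_diag R hR
  have hSs := isSelfAdjoint_of_diag S hS
  -- With R = (1 + D²)⁻¹ and S = DR one has R = R² + S², a sum of squares of selfadjoint operators.
  have hR0 : 0 ≤ R := by
    have : R = star R * R + star S * S := by
      ext x
      refine hilbertBasis_ext b fun i => ?_
      rw [hRs.star_eq, hSs.star_eq, add_apply, mul_apply_eq_comp, mul_apply_eq_comp, inner_add_right,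
        hR, hR, hR, hS, hS]
      have := (hpos i).ne'
      push_cast
      have h' : (1 + (μ i : ℂ) ^ 2) ≠ 0 := by exact_mod_cast this
      field_simp
    rw [this]
    exact add_nonneg (star_mul_self_nonneg R) (star_mul_self_nonneg S)
  refine ⟨R, fun x => ?_, (ContinuousLinearMap.nonneg_iff_isPositive _).1 CFC.rpow_nonneg, ?_⟩
  · have h1 : (R x, S x) ∈ D.graph := by
      rw [hD]
      intro i
      rw [hR, hS]
      push_cast; ring
    have h2 : (S x, x - R x) ∈ D.graph := by
      rw [hD]
      intro i
      rw [inner_sub_right, hR, hS]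
      have h' : (1 + (μ i : ℂ) ^ 2) ≠ 0 := by exact_mod_cast (hpos i).ne'
      push_cast
      field_simp
      ring
    obtain ⟨h1, h1'⟩ := mem_graph_iff_exists.1 h1
    obtain ⟨h2, h2'⟩ := mem_graph_iff_exists.1 h2
    refine ⟨h1, by rw [h1']; exact h2, ?_⟩
    have : D ⟨D ⟨R x, h1⟩, by rw [h1']; exact h2⟩ = D ⟨S x, h2⟩ := by
      congr 1
      exact Subtype.ext h1'
    rw [this, h2']
    abel
  · have hrange : Orthonormal ℂ (Subtype.val : Set.range b → H) := b.orthonormal.toSubtypeRange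
    refine ⟨Set.range b, HilbertBasis.mk hrange (by rw [Subtype.range_coe, b.dense_span]), ?_⟩
    have hinj : Function.Injective b := b.orthonormal.linearIndependent.injective
    rw [← (Equiv.ofInjective b hinj).summable_iff]
    refine h.congr fun i => ?_
    rw [Function.comp_apply, HilbertBasis.coe_mk, Equiv.ofInjective_apply, CFC.rpow_eq_cfc_real hR0,
      cfc_apply_eigenvector (r := (1 + μ i ^ 2)⁻¹) hRs ?_
        (Real.continuous_rpow_const (by positivity : 0 ≤ p / 2)), inner_smul_right,
      inner_self_eq_norm_sq_to_K (𝕜 := ℂ), b.orthonormal.1 i]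
    · simp
    · classical
      refine hilbertBasis_ext b fun j => ?_
      rw [hR, inner_smul_right]
      rcases eq_or_ne j i with rfl | hji
      · rfl
      · rw [b.orthonormal.2 hji, mul_zero, mul_zero]

end Diagonal

open Presentation

/-! ### Norm estimates -/

section Norms

variable {q : ℝ} [hq : Fact (|q| < 1)] [NeZero q]

theorem q_sq_pos : 0 < q ^ 2 := by have := NeZero.ne q; positivity

theorem q_sq_pow_lt_one (n : ℕ) : (q ^ 2) ^ (n + 1) < 1 :=
  pow_lt_one₀ (sq_nonneg q) (q_sq_lt_one q) (by omega)

theorem norm_reg_vac_sq (x : CG q) : ((‖reg q x (vac q)‖ ^ 2 : ℝ) : ℂ) = haar q (star x * x) := by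
  rw [haar_star_mul, inner_self_eq_norm_sq_to_K (𝕜 := ℂ)]
  exact Complex.ofReal_pow _ _

/-- The value h(a*ⁿ⁺¹aⁿ⁺¹) is computed twice: from a*a, and after moving a* around by the modular
relation, from aa*. Eliminating h(a*ⁿaⁿξ) leaves the recursion. -/
theorem haar_star_u00_pow_succ (n : ℕ) :
    (1 - ((q : ℂ) ^ 2) ^ (n + 2)) * haar q (star (u q 0 0 ^ (n + 1)) * u q 0 0 ^ (n + 1)) =
      (q : ℂ) ^ 2 * (1 - ((q : ℂ) ^ 2) ^ (n + 1)) * haar q (star (u q 0 0 ^ n) * u q 0 0 ^ n) := by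
  obtain ⟨-, -, -, h, -⟩ := (isSUq2_u q).facts
  rw [← ψ_xi] at h
  have h1 := congrArg (haar q) (star_u00_pow_mul_pow (q := q) n)
  rw [mul_sub, mul_one, mul_smul_comm, map_sub, map_smul, smul_eq_mul] at h1
  have h2 : haar q (star (u q 0 0 ^ (n + 1)) * u q 0 0 ^ (n + 1)) =
      (q : ℂ) ^ 2 * haar q (star (u q 0 0 ^ n) * u q 0 0 ^ n * (u q 0 0 * star (u q 0 0))) := by
    have e : star (u q 0 0 ^ (n + 1)) = star (u q 0 0) * star (u q 0 0 ^ n) := by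
      rw [pow_succ, star_mul]
    rw [e, mul_assoc, haar_star_u00_mul, pow_succ (u q 0 0) n]
    simp only [mul_assoc]
  rw [h, mul_sub, mul_one, mul_smul_comm, map_sub, map_smul, smul_eq_mul] at h2
  have hq2 : ((q : ℂ) ^ 2) ≠ 0 := pow_ne_zero 2 q_ne_zero
  have h3 : ((q : ℂ) ^ 2) ^ n * (((q : ℂ) ^ 2)⁻¹) ^ n = 1 := by
    rw [← mul_pow, mul_inv_cancel₀ hq2, one_pow]
  set P := (((q : ℂ) ^ 2)⁻¹) ^ n
  generalize haar q (star (u q 0 0 ^ n) * u q 0 0 ^ n * ψ q (xi q)) = B at *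
  generalize haar q (star (u q 0 0 ^ n) * u q 0 0 ^ n) = X at *
  generalize haar q (star (u q 0 0 ^ (n + 1)) * u q 0 0 ^ (n + 1)) = Y at *
  rw [pow_add, pow_add]
  linear_combination h2 - (q : ℂ) ^ 4 * ((q : ℂ) ^ 2) ^ n * h1 + (q : ℂ) ^ 4 * B * h3

theorem norm_u00_pow_vac_sq (n : ℕ) :
    (1 - (q ^ 2) ^ (n + 1)) * ‖reg q (u q 0 0 ^ n) (vac q)‖ ^ 2 = (q ^ 2) ^ n * (1 - q ^ 2) := by
  induction n with
  | zero => rw [pow_zero, pow_zero, map_one, one_apply_eq_self, norm_vac]; ring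
  | succ n ih =>
    have h := haar_star_u00_pow_succ (q := q) n
    rw [← norm_reg_vac_sq, ← norm_reg_vac_sq] at h
    have h' : (1 - (q ^ 2) ^ (n + 2)) * ‖reg q (u q 0 0 ^ (n + 1)) (vac q)‖ ^ 2 =
        q ^ 2 * (1 - (q ^ 2) ^ (n + 1)) * ‖reg q (u q 0 0 ^ n) (vac q)‖ ^ 2 := by exact_mod_cast h
    rw [h', mul_assoc, ih]
    ring

theorem norm_u00_pow_vac_sq_le (n : ℕ) :
    q ^ 4 * (1 - q ^ 2) * ‖reg q (u q 0 0 ^ n) (vac q)‖ ^ 2 ≤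
      ‖reg q (u q 0 0 ^ (n + 2)) (vac q)‖ ^ 2 := by
  have h1 := norm_u00_pow_vac_sq (q := q) n
  have h2 := norm_u00_pow_vac_sq (q := q) (n + 2)
  have h3 := q_sq_pow_lt_one (q := q) n
  have h4 := q_sq_pow_lt_one (q := q) (n + 2)
  have h5 : (q ^ 2) ^ (n + 1) ≤ q ^ 2 :=
    pow_le_of_le_one (sq_nonneg q) (q_sq_lt_one q).le (by omega)
  have h6 : 0 ≤ (q ^ 2) ^ (n + 3) := by positivity
  set X := ‖reg q (u q 0 0 ^ n) (vac q)‖ ^ 2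
  set Y := ‖reg q (u q 0 0 ^ (n + 2)) (vac q)‖ ^ 2
  have hX : 0 ≤ X := sq_nonneg _
  have hY : 0 ≤ Y := sq_nonneg _
  calc q ^ 4 * (1 - q ^ 2) * X ≤ q ^ 4 * ((1 - (q ^ 2) ^ (n + 1)) * X) := by
        rw [mul_assoc]
        gcongr
    _ = (1 - (q ^ 2) ^ (n + 3)) * Y := by rw [h1, h2]; ring
    _ ≤ Y := by nlinarith

theorem star_eta_pow_mul_pow (k : ℕ) : star (eta q ^ (k + 1)) * eta q ^ (k + 1) =
    star (eta q ^ k) * eta q ^ k * ((((q : ℂ) ^ 2)⁻¹) ^ k • xi q -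
      ((((q : ℂ) ^ 2)⁻¹) ^ k) ^ 2 • (xi q * xi q)) := by
  have h : xi q * eta q ^ k = (((q : ℂ) ^ 2)⁻¹) ^ k • (eta q ^ k * xi q) :=
    mul_pow_of_mul_eq_smul (xi_mul_eta q) k
  calc star (eta q ^ (k + 1)) * eta q ^ (k + 1)
      = star (eta q ^ k) * ((star (eta q) * eta q) * eta q ^ k) := by
        rw [pow_succ', star_mul]; simp only [mul_assoc]
    _ = _ := by
      rw [star_eta_mul_eta, sub_mul, mul_assoc (xi q), h, mul_smul_comm, ← mul_assoc (xi q), h,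
        smul_mul_assoc, smul_smul, ← pow_two]
      simp only [mul_sub, mul_smul_comm, mul_assoc]

/-- With W = ψ((ηᵏ)*ηᵏ), A = h(Wξ) and B = h(Wξ²), the squared norm of ηᵏ⁺¹ is expressed by A and B
through η*η and, by the modular relation, through ηη*. A third relation comes from the vanishing of
h when zξ is a commutator. Eliminating A and B gives the ratio. -/
theorem hwNorm_succ (k : ℕ) :
    (1 + ((q : ℂ) ^ 2) ^ (k + 1)) * (1 - ((q : ℂ) ^ 2) ^ (2 * k + 3)) * hwNorm q (k + 1) =
      ((q : ℂ) ^ 2) ^ (k + 2) * (1 - ((q : ℂ) ^ 2) ^ (k + 1)) * hwNorm q k := by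
  set W : CG q := ψ q (star (eta q ^ k) * eta q ^ k) with hW
  set A := haar q (W * ψ q (xi q)) with hA
  set B := haar q (W * (ψ q (xi q) * ψ q (xi q))) with hB
  have hN : ∀ k, hwNorm q k = haar q (ψ q (star (eta q ^ k) * eta q ^ k)) := by
    intro k
    rw [hwNorm, sph_zero_right, map_mul (ψ q), map_star (ψ q)]
  have hEE : ψ q (star (eta q ^ k) * eta q ^ k) * (ψ q (eta q) * ψ q (star (eta q))) =
      (q : ℂ) ^ 2 • (W * ψ q (xi q)) - (q : ℂ) ^ 4 • (W * (ψ q (xi q) * ψ q (xi q))) := by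
    rw [← map_mul, eta_mul_star_eta, map_sub, map_smul (ψ q), map_smul (ψ q), map_mul (ψ q) (xi q),
      mul_sub, mul_smul_comm, mul_smul_comm]
  have hE2 : ψ q (star (eta q ^ (k + 1)) * eta q ^ (k + 1)) =
      (((q : ℂ) ^ 2)⁻¹) ^ k • (W * ψ q (xi q)) -
        ((((q : ℂ) ^ 2)⁻¹) ^ k) ^ 2 • (W * (ψ q (xi q) * ψ q (xi q))) := by
    rw [star_eta_pow_mul_pow, map_mul, map_sub, map_smul (ψ q), map_smul (ψ q),
      map_mul (ψ q) (xi q), mul_sub, mul_smul_comm, mul_smul_comm]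
  have e : ψ q (star (eta q ^ (k + 1)) * eta q ^ (k + 1)) =
      ψ q (star (eta q)) * (ψ q (star (eta q ^ k) * eta q ^ k) * ψ q (eta q)) := by
    rw [← map_mul, ← map_mul, mul_assoc (star (eta q ^ k)), ← pow_succ, ← mul_assoc, ← star_mul,
      ← pow_succ]
  have h1 : hwNorm q (k + 1) = (((q : ℂ) ^ 2)⁻¹) ^ k * A - ((((q : ℂ) ^ 2)⁻¹) ^ k) ^ 2 * B := by
    rw [hN, hE2, map_sub, map_smul, map_smul, smul_eq_mul, smul_eq_mul]
  have h2 : hwNorm q (k + 1) = (q : ℂ) ^ 2 * ((q : ℂ) ^ 2 * A - (q : ℂ) ^ 4 * B) := by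
    rw [hN, e, haar_star_eta_mul, mul_assoc, hEE, map_sub, map_smul, map_smul, smul_eq_mul,
      smul_eq_mul]
  have h3 := haar_eq_zero_of_mul_xi (ψ q (star (eta q ^ k) * eta q ^ k) * ψ q (eta q))
    (((((q : ℂ) ^ 2)⁻¹) ^ k - (q : ℂ) ^ 2) • W -
      (((((q : ℂ) ^ 2)⁻¹) ^ k) ^ 2 - (q : ℂ) ^ 4) • (W * ψ q (xi q))) (by
    rw [← e, hE2, mul_assoc, hEE, sub_mul, smul_mul_assoc, smul_mul_assoc, mul_assoc]
    module)
  rw [map_sub, map_smul, map_smul, smul_eq_mul, smul_eq_mul, hW, ← hN] at h3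
  have hq2 : ((q : ℂ) ^ 2) ≠ 0 := pow_ne_zero 2 q_ne_zero
  have h4 : ((q : ℂ) ^ 2) ^ k * (((q : ℂ) ^ 2)⁻¹) ^ k = 1 := by
    rw [← mul_pow, mul_inv_cancel₀ hq2, one_pow]
  have h5 : 1 - (q : ℂ) ^ 2 * ((q : ℂ) ^ 2) ^ k ≠ 0 := by
    have := one_sub_q_sq_mul_ne_zero (q := q) k
    rwa [← pow_mul, mul_comm k 2, pow_mul] at this
  rw [show 2 * k + 3 = k + k + 3 by ring]
  simp only [pow_add, pow_one]
  set N := hwNorm q k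
  set N' := hwNorm q (k + 1)
  set P := (((q : ℂ) ^ 2)⁻¹) ^ k
  set Q := ((q : ℂ) ^ 2) ^ k
  set x := (q : ℂ) ^ 2 with hx
  rw [show (q : ℂ) ^ 4 = x ^ 2 by rw [hx]; ring] at h2 h3
  -- Division of h3 by P - x; since QP = 1, the number Q(P - x) = 1 - xQ is nonzero.
  have h6 : N = (P + x) * A := by
    have : (1 - x * Q) * (N - (P + x) * A) = 0 := by
      linear_combination Q * h3 + (-N + P * A + x * A) * h4
    exact sub_eq_zero.1 ((mul_eq_zero.1 this).resolve_left h5)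
  have h7 : N' * (P ^ 2 - x ^ 3) = x ^ 2 * P * A * (P - x) := by
    linear_combination P ^ 2 * h2 - x ^ 3 * h1
  have h8 : Q * N = (1 + Q * x) * A := by rw [h6]; linear_combination A * h4
  have h9 : N' * (1 - Q ^ 2 * x ^ 3) = x ^ 2 * (1 - Q * x) * A := by
    have : Q ^ 2 * P ^ 2 = 1 := by rw [← mul_pow, h4, one_pow]
    linear_combination Q ^ 2 * h7 + (x ^ 2 * A - N') * this - x ^ 3 * A * Q * h4
  linear_combination (1 + Q * x) * h9 - x ^ 2 * (1 - Q * x) * h8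

theorem norm_gnsLin_sph_zero_sq (k : ℕ) :
    ((‖gnsLin q (sph q k 0)‖ ^ 2 : ℝ) : ℂ) = hwNorm q k := norm_gnsLin_sq _

theorem norm_gnsLin_sph_zero_succ (k : ℕ) :
    (1 + (q ^ 2) ^ (k + 1)) * (1 - (q ^ 2) ^ (2 * k + 3)) * ‖gnsLin q (sph q (k + 1) 0)‖ ^ 2 =
      (q ^ 2) ^ (k + 2) * (1 - (q ^ 2) ^ (k + 1)) * ‖gnsLin q (sph q k 0)‖ ^ 2 := by
  have h := hwNorm_succ (q := q) k
  rw [← norm_gnsLin_sph_zero_sq, ← norm_gnsLin_sph_zero_sq] at h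
  exact_mod_cast h

/-- The factor 1 - q²ᵏ⁺² cancels because (1 + q²ᵏ⁺²)(1 - q⁴ᵏ⁺⁶) is at least as large. -/
theorem norm_gnsLin_sph_zero_succ_le (k : ℕ) :
    ‖gnsLin q (sph q (k + 1) 0)‖ ^ 2 ≤ (q ^ 2) ^ (k + 2) * ‖gnsLin q (sph q k 0)‖ ^ 2 := by
  have h := norm_gnsLin_sph_zero_succ (q := q) k
  have h1 := q_sq_pow_lt_one (q := q) k
  have h2 : (q ^ 2) ^ (2 * k + 3) ≤ (q ^ 2) ^ (k + 1) :=
    pow_le_pow_of_le_one (sq_nonneg q) (q_sq_lt_one q).le (by omega)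
  have h3 : 0 ≤ (q ^ 2) ^ (k + 1) := by positivity
  set X := ‖gnsLin q (sph q k 0)‖ ^ 2
  set Y := ‖gnsLin q (sph q (k + 1) 0)‖ ^ 2
  have hY : 0 ≤ Y := sq_nonneg _
  have h4 : (1 - (q ^ 2) ^ (k + 1)) * Y ≤ (1 - (q ^ 2) ^ (k + 1)) * ((q ^ 2) ^ (k + 2) * X) := by
    calc (1 - (q ^ 2) ^ (k + 1)) * Y ≤ (1 + (q ^ 2) ^ (k + 1)) * (1 - (q ^ 2) ^ (2 * k + 3)) * Y := by
          refine mul_le_mul_of_nonneg_right ?_ hY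
          nlinarith
      _ = _ := by rw [h]; ring
  exact le_of_mul_le_mul_left h4 (by linarith)

/-- The constant comes from 1 - q²ᵏ⁺² ≥ 1 - q² on one side and (1 + q²ᵏ⁺²)(1 - q⁴ᵏ⁺⁶) ≤ 2 on the
other. -/
theorem le_norm_gnsLin_sph_zero_succ (k : ℕ) :
    (q ^ 2) ^ (k + 2) * ((1 - q ^ 2) / 2) * ‖gnsLin q (sph q k 0)‖ ^ 2 ≤
      ‖gnsLin q (sph q (k + 1) 0)‖ ^ 2 := by
  have h := norm_gnsLin_sph_zero_succ (q := q) k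
  have h1 : (q ^ 2) ^ (k + 1) ≤ q ^ 2 :=
    pow_le_of_le_one (sq_nonneg q) (q_sq_lt_one q).le (by omega)
  have h2 : 0 ≤ (q ^ 2) ^ (2 * k + 3) := by positivity
  have h3 := q_sq_pow_lt_one (q := q) k
  have h4 := q_sq_pow_lt_one (q := q) (2 * k + 2)
  have h5 : 0 ≤ (q ^ 2) ^ (k + 1) := by positivity
  set X := ‖gnsLin q (sph q k 0)‖ ^ 2
  set Y := ‖gnsLin q (sph q (k + 1) 0)‖ ^ 2
  have hX : 0 ≤ X := sq_nonneg _
  have hY : 0 ≤ Y := sq_nonneg _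
  have h6 : (q ^ 2) ^ (k + 2) * (1 - q ^ 2) * X ≤ 2 * Y := by
    calc (q ^ 2) ^ (k + 2) * (1 - q ^ 2) * X ≤ (q ^ 2) ^ (k + 2) * (1 - (q ^ 2) ^ (k + 1)) * X := by
          gcongr
      _ = _ := h.symm
      _ ≤ _ := by
          refine mul_le_mul_of_nonneg_right ?_ hY
          nlinarith
  linarith

end Norms

/-! ### Norm of the spin-raising part of multiplication. -/

section Raising

variable {q : ℝ} [hq : Fact (|q| < 1)] [NeZero q]

/-- Both sides are continuous in y and agree on the spin basis by orthogonality. So `highSlice k`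
sees the spin-k component only. -/
theorem highSlice_eq (k : ℕ) (y : CS q) : highSlice q k y = ∑ j ∈ Finset.range (2 * k + 1),
    (⟪gnsLin q (sph q k j), gnsLin q y⟫_ℂ * (hwNorm q k / ⟪gnsLin q (sph q k j), gnsLin q (sph q k j)⟫_ℂ)) •
      tc q (2 * k) 0 j := by
  have h1 : Continuous fun y => highSlice q k y := by
    simp only [highSlice_apply]
    exact (leftSlice q (suq2 q)).continuous.comp (continuous_const.mul
      ((continuous_starAlgHom (Δ q)).comp (continuous_starAlgHom (ψ q))))
  have h2 : Continuous fun y => ∑ j ∈ Finset.range (2 * k + 1),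
      (⟪gnsLin q (sph q k j), gnsLin q y⟫_ℂ * (hwNorm q k / ⟪gnsLin q (sph q k j), gnsLin q (sph q k j)⟫_ℂ)) •
        tc q (2 * k) 0 j := by
    have := continuous_gnsLin (q := q)
    fun_prop
  refine congrFun (Continuous.ext_on dense_polySph h1 h2 fun x hx => ?_) y
  have hx' := polySph_eq_span hx
  clear hx
  induction hx' using Submodule.span_induction with
  | mem x hx =>
    obtain ⟨l, i, hi, rfl⟩ := hx
    rcases eq_or_ne k l with rfl | hkl
    · rw [highSlice_sph_self hi, Finset.sum_eq_single_of_mem i (Finset.mem_range.2 (by omega))]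
      · rw [mul_div_cancel₀]
        exact inner_self_ne_zero.2 (gnsLin_sph_ne_zero hi)
      · intro j hj hji
        have hj' := Finset.mem_range.1 hj
        rw [inner_gnsLin_sph_of_ne (Or.inr hji) (by omega) hi, zero_mul, zero_smul]
    · rw [highSlice_apply, Δ_ψ_sph q l i hi, leftSlice_inl_mul_sum]
      trans (0 : CG q)
      · refine Finset.sum_eq_zero fun j hj => ?_
        have hj' := Finset.mem_range.1 hj
        rw [haar_star_sph_mul_of_ne (Or.inl hkl) (by omega) (by omega), zero_smul]
      · refine (Finset.sum_eq_zero fun j hj => ?_).symm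
        have hj' := Finset.mem_range.1 hj
        rw [inner_gnsLin_sph_of_ne (Or.inl hkl) (by omega) hi, zero_mul, zero_smul]
  | zero => simp
  | add x y _ _ hx hy =>
    simp only [map_add, inner_add_right, add_mul, add_smul, Finset.sum_add_distrib] at hx hy ⊢
    rw [hx, hy]
  | smul c x _ hx =>
    rw [map_smul, hx, Finset.smul_sum]
    refine Finset.sum_congr rfl fun j _ => ?_
    rw [map_smul, inner_smul_right, smul_smul, mul_assoc]

theorem norm_reg_sum_tc_sq (n : ℕ) (c : ℕ → ℂ) :
    ‖reg q (∑ j ∈ Finset.range (n + 1), c j • tc q n 0 j) (vac q)‖ ^ 2 =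
      ∑ j ∈ Finset.range (n + 1), ‖c j‖ ^ 2 * ‖reg q (tc q n 0 j) (vac q)‖ ^ 2 := by
  apply Complex.ofReal_injective
  rw [norm_reg_vac_sq, star_sum, Finset.sum_mul_sum, map_sum, Complex.ofReal_sum]
  refine Finset.sum_congr rfl fun i hi => ?_
  rw [map_sum, Finset.sum_eq_single_of_mem i hi]
  · rw [star_smul, smul_mul_smul_comm, map_smul, ← norm_reg_vac_sq, smul_eq_mul, Complex.ofReal_mul]
    congr 1
    rw [Complex.star_def, ← Complex.normSq_eq_conj_mul_self, Complex.normSq_eq_norm_sq]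
  · intro j _ hji
    rw [star_smul, smul_mul_smul_comm, map_smul, haar_star_tc_mul_eq_zero hji.symm, smul_zero]

theorem norm_tc_vac_sq {k j : ℕ} (hj : j ≤ 2 * k) :
    ‖reg q (tc q (2 * k) 0 j) (vac q)‖ ^ 2 * ‖gnsLin q (sph q k 0)‖ ^ 2 =
      ‖gnsLin q (sph q k j)‖ ^ 2 * ‖reg q (u q 0 0 ^ (2 * k)) (vac q)‖ ^ 2 := by
  have h := haar_star_tc_mul_hwNorm (q := q) hj
  have h0 : tc q (2 * k) 0 0 = u q 0 0 ^ (2 * k) := by rw [tc_zero_right q _ 0 (by omega), mono]; simp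
  rw [h0, ← norm_reg_vac_sq (tc q (2 * k) 0 j), ← norm_reg_vac_sq (u q 0 0 ^ _), ← norm_gnsLin_sph_zero_sq, ← norm_gnsLin_sq] at h
  exact_mod_cast h

/-- The entries tc (2k) 0 j are orthogonal for h, with norms proportional to those of sph k j.
Hence, on the vacuum, `highSlice k` is a fixed multiple of an isometry on the spin-k component. -/
theorem norm_highSlice_sq (k : ℕ) (y : CS q) : ‖reg q (highSlice q k y) (vac q)‖ ^ 2 =
    ‖gnsLin q (sph q k 0)‖ ^ 2 * ‖reg q (u q 0 0 ^ (2 * k)) (vac q)‖ ^ 2 *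
      ∑ i : Fin (2 * k + 1), ‖⟪sphVec q ⟨k, i⟩, gnsLin q y⟫_ℂ‖ ^ 2 := by
  rw [highSlice_eq, norm_reg_sum_tc_sq (2 * k) fun j => ⟪gnsLin q (sph q k j), gnsLin q y⟫_ℂ *
    (hwNorm q k / ⟪gnsLin q (sph q k j), gnsLin q (sph q k j)⟫_ℂ), Finset.sum_range, Finset.mul_sum]
  refine Finset.sum_congr rfl fun i _ => ?_
  have hi : (i : ℕ) ≤ 2 * k := Nat.lt_succ_iff.1 i.2
  have h1 := norm_tc_vac_sq (q := q) hi
  have h2 : ‖gnsLin q (sph q k i)‖ ≠ 0 := norm_ne_zero_iff.2 (gnsLin_sph_ne_zero hi)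
  rw [sphVec, inner_smul_left, inner_self_eq_norm_sq_to_K (𝕜 := ℂ), ← norm_gnsLin_sph_zero_sq,
    norm_mul, norm_mul, norm_div, norm_pow, Complex.norm_real, RCLike.norm_ofReal, RCLike.norm_conj,
    norm_inv, Complex.norm_real, norm_norm, abs_norm, norm_pow, norm_norm]
  dsimp only
  generalize ‖reg q (tc q (2 * k) 0 i) (vac q)‖ ^ 2 = X at *
  generalize ‖reg q (u q 0 0 ^ (2 * k)) (vac q)‖ ^ 2 = Y at *
  generalize ‖gnsLin q (sph q k i)‖ = n at *
  generalize ‖gnsLin q (sph q k 0)‖ = N at *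
  field_simp
  linear_combination ‖⟪gnsLin q (sph q k i), gnsLin q y⟫_ℂ‖ ^ 2 * N ^ 2 * h1

/-- In Δψ(sph 1 j · a) only the product of the two highest weight vectors has the degree of spin
k+1, and that product is the highest weight vector of spin k+1. Raising the spin thus becomes left
multiplication by the fixed element tc 2 0 j. -/
theorem highSlice_sph_mul {j : ℕ} (hj : j ≤ 2) {k : ℕ} {a : CS q}
    (ha : a ∈ Submodule.span ℂ (Set.range fun i : Fin (2 * k + 1) => sph q k i)) :
    highSlice q (k + 1) (sph q 1 j * a) =
      (hwNorm q (k + 1) / hwNorm q k) • (tc q 2 0 j * highSlice q k a) := by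
  induction ha using Submodule.span_induction with
  | mem x hx =>
    obtain ⟨i, rfl⟩ := hx
    have hi : (i : ℕ) ≤ 2 * k := Nat.lt_succ_iff.1 i.2
    rw [highSlice_sph_self hi, mul_smul_comm, smul_smul, div_mul_cancel₀ _ (hwNorm_ne_zero k),
      highSlice_apply, map_mul (ψ q), map_mul (Δ q), Δ_ψ_sph q 1 j hj, Δ_ψ_sph q k i hi, Finset.sum_mul_sum,
      Finset.mul_sum, map_sum]
    have hterm : ∀ m n, leftSlice q (suq2 q) (inl _ _ (star (ψ q (sph q (k + 1) 0))) *
        (inl _ _ (ψ q (sph q 1 m)) * inr _ _ (tc q (2 * 1) m j) *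
          (inl _ _ (ψ q (sph q k n)) * inr _ _ (tc q (2 * k) n i)))) =
        haar q (star (ψ q (sph q (k + 1) 0)) * (ψ q (sph q 1 m) * ψ q (sph q k n))) •
          (tc q (2 * 1) m j * tc q (2 * k) n i) := by
      intro m n
      rw [tmul_mul_tmul, ← mul_assoc, ← map_mul, leftSlice_tmul]
    have hdeg : ∀ m n, 0 < m + n →
        haar q (star (ψ q (sph q (k + 1) 0)) * (ψ q (sph q 1 m) * ψ q (sph q k n))) = 0 := by
      intro m n h
      exact haar_star_mul_eq_zero (hasDeg_ψ_sph _ _) ((hasDeg_ψ_sph 1 m).mul (hasDeg_ψ_sph k n))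
        (by push_cast; omega)
    rw [Finset.sum_eq_single_of_mem 0 (Finset.mem_range.2 (by omega)), Finset.mul_sum, map_sum,
      Finset.sum_eq_single_of_mem 0 (Finset.mem_range.2 (by omega)), hterm, hwNorm, ← map_mul]
    · rfl
    · intro n _ hn
      rw [hterm, hdeg 0 n (by omega), zero_smul]
    · intro m _ hm
      rw [Finset.mul_sum, map_sum]
      refine Finset.sum_eq_zero fun n _ => ?_
      rw [hterm, hdeg m n (by omega), zero_smul]
  | zero => simp
  | add x y _ _ hx hy => rw [mul_add, map_add, hx, hy, map_add, mul_add, smul_add]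
  | smul c x _ hx => rw [mul_smul_comm, map_smul, hx, map_smul, mul_smul_comm, smul_comm]

/-- The main estimate. Left multiplication by tc 2 0 j is bounded independently of k, so the decay
q²ᵏ comes from the ratio of the norms of the highest weight vectors. -/
theorem sum_inner_sph_mul_le {j : ℕ} (hj : j ≤ 2) {k : ℕ} {a : CS q}
    (ha : a ∈ Submodule.span ℂ (Set.range fun i : Fin (2 * k + 1) => sph q k i)) :
    ∑ i : Fin (2 * (k + 1) + 1), ‖⟪sphVec q ⟨k + 1, i⟩, gnsLin q (sph q 1 j * a)⟫_ℂ‖ ^ 2 ≤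
      ‖reg q (tc q 2 0 j)‖ ^ 2 / (1 - q ^ 2) * (q ^ 2) ^ k * ‖gnsLin q a‖ ^ 2 := by
  have h1 := norm_highSlice_sq (q := q) (k + 1) (sph q 1 j * a)
  have h2 := norm_highSlice_sq (q := q) k a
  rw [highSlice_sph_mul hj ha, map_smul (reg q), smul_apply, norm_smul, norm_div,
    ← norm_gnsLin_sph_zero_sq, ← norm_gnsLin_sph_zero_sq, Complex.norm_real, Complex.norm_real,
    norm_pow, norm_pow, norm_norm, norm_norm, map_mul, mul_apply_eq_comp] at h1
  have h3 := (reg q (tc q 2 0 j)).le_opNorm (reg q (highSlice q k a) (vac q))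
  have h4 : ∑ i : Fin (2 * k + 1), ‖⟪sphVec q ⟨k, i⟩, gnsLin q a⟫_ℂ‖ ^ 2 ≤ ‖gnsLin q a‖ ^ 2 := by
    have := sum_norm_inner_sq_le (sphBasis q) (gnsLin q a)
      (Finset.univ.map ⟨fun i : Fin (2 * k + 1) => (⟨k, i⟩ : SphIdx), sigma_mk_injective (β := fun k => Fin (2 * k + 1))⟩)
    rw [Finset.sum_map] at this
    simp only [sphBasis_apply] at this
    exact this
  have h5 := norm_gnsLin_sph_zero_succ_le (q := q) k
  have h6 := norm_u00_pow_vac_sq_le (q := q) (2 * k)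
  have h7 := q_sq_lt_one q
  have h8 : 0 < ‖gnsLin q (sph q k 0)‖ := norm_pos_iff.2 (gnsLin_sph_ne_zero (by omega))
  have h9 : 0 < ‖gnsLin q (sph q (k + 1) 0)‖ := norm_pos_iff.2 (gnsLin_sph_ne_zero (by omega))
  have h10 : 0 < ‖reg q (u q 0 0 ^ (2 * k)) (vac q)‖ ^ 2 := by
    have h := norm_u00_pow_vac_sq (q := q) (2 * k)
    have h' := q_sq_pow_lt_one (q := q) (2 * k)
    have h'' : 0 < (q ^ 2) ^ (2 * k) * (1 - q ^ 2) := mul_pos (pow_pos q_sq_pos _) (by linarith)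
    rw [← h] at h''
    exact (mul_pos_iff_of_pos_left (by linarith)).1 h''
  rw [show 2 * k + 2 = 2 * (k + 1) by ring] at h6
  have hq4 : 0 < q ^ 4 := by have := NeZero.ne q; positivity
  set M := ‖reg q (tc q 2 0 j)‖
  set N := ‖gnsLin q (sph q k 0)‖
  set N' := ‖gnsLin q (sph q (k + 1) 0)‖
  set X := ‖reg q (u q 0 0 ^ (2 * k)) (vac q)‖ ^ 2
  set X' := ‖reg q (u q 0 0 ^ (2 * (k + 1))) (vac q)‖ ^ 2
  set Z := ‖reg q (highSlice q k a) (vac q)‖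
  set Z' := ‖reg q (tc q 2 0 j) (reg q (highSlice q k a) (vac q))‖
  set S := ∑ i : Fin (2 * k + 1), ‖⟪sphVec q ⟨k, i⟩, gnsLin q a⟫_ℂ‖ ^ 2
  set S' := ∑ i : Fin (2 * (k + 1) + 1), ‖⟪sphVec q ⟨k + 1, i⟩, gnsLin q (sph q 1 j * a)⟫_ℂ‖ ^ 2
  have hM : 0 ≤ M := norm_nonneg _
  have hZ' : 0 ≤ Z' := norm_nonneg _
  have hS' : 0 ≤ S' := Finset.sum_nonneg fun _ _ => sq_nonneg _
  -- The ratio N'²/N² enters squared on the right and cancels once. What remains is at most q²⁽ᵏ⁺²⁾,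
  -- and X' ≥ q⁴(1 - q²)X absorbs the two surplus powers of q².
  have e1 : N' ^ 2 * X' * S' ≤ (N' ^ 2 / N ^ 2) ^ 2 * (M ^ 2 * (N ^ 2 * X * ‖gnsLin q a‖ ^ 2)) := by
    rw [← h1, mul_pow]
    refine mul_le_mul_of_nonneg_left ?_ (sq_nonneg _)
    calc Z' ^ 2 ≤ (M * Z) ^ 2 := by gcongr
      _ = M ^ 2 * (N ^ 2 * X * S) := by rw [mul_pow, h2]
      _ ≤ _ := by gcongr
  have e2 : X' * S' ≤ N' ^ 2 / N ^ 2 * (M ^ 2 * (X * ‖gnsLin q a‖ ^ 2)) := by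
    have : N' ^ 2 * (X' * S') ≤ N' ^ 2 * (N' ^ 2 / N ^ 2 * (M ^ 2 * (X * ‖gnsLin q a‖ ^ 2))) := by
      rw [← mul_assoc]
      refine e1.trans_eq ?_
      field_simp
    exact le_of_mul_le_mul_left this (by positivity)
  have e3 : N' ^ 2 / N ^ 2 ≤ (q ^ 2) ^ (k + 2) := by
    rw [div_le_iff₀ (by positivity)]
    exact h5
  have e4 : q ^ 4 * (1 - q ^ 2) * X * S' ≤ (q ^ 2) ^ (k + 2) * (M ^ 2 * (X * ‖gnsLin q a‖ ^ 2)) := by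
    calc q ^ 4 * (1 - q ^ 2) * X * S' ≤ X' * S' := by gcongr
      _ ≤ _ := e2
      _ ≤ _ := by gcongr
  have e5 : (q ^ 4 * X) * ((1 - q ^ 2) * S') ≤ (q ^ 4 * X) * (M ^ 2 * (q ^ 2) ^ k * ‖gnsLin q a‖ ^ 2) := by
    calc _ = q ^ 4 * (1 - q ^ 2) * X * S' := by ring
      _ ≤ _ := e4
      _ = _ := by ring
  have e6 := le_of_mul_le_mul_left e5 (by positivity)
  rw [div_mul_eq_mul_div, div_mul_eq_mul_div, le_div_iff₀ (by linarith)]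
  linarith

end Raising

open Presentation

/-! ### Equivariant operators -/

section Equivariant

variable {q : ℝ} [hq : Fact (|q| < 1)] [NeZero q]

theorem sphVec_mem_block (p : SphIdx) : sphVec q p ∈ block q p.1 :=
  Submodule.smul_mem _ _ (gnsLin_sph_mem_block p.le)

theorem IsBlockScalar.isDiag {d : ℕ → ℝ} {D : HS q →ₗ.[ℂ] HS q} (h : IsBlockScalar (hState q) d D) :
    IsDiag (sphBasis q) (fun p => d p.1) D := by
  refine isDiag_of_isSelfAdjoint h.1 fun p => ?_
  rw [sphBasis_apply]
  exact mem_graph_iff_exists.2 (h.2 p.1 _ ((spinBlock_eq p.1).ge (sphVec_mem_block p)))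

theorem IsDiag.isBlockScalar {d : ℕ → ℝ} {D : HS q →ₗ.[ℂ] HS q}
    (h : IsDiag (sphBasis q) (fun p => d p.1) D) : IsBlockScalar (hState q) d D := by
  refine ⟨h.isSelfAdjoint, fun k x hx => mem_graph_iff_exists.1 ((h _ _).2 fun p => ?_)⟩
  rw [inner_smul_right]
  rcases eq_or_ne p.1 k with rfl | hp
  · rfl
  · rw [sphBasis_apply, inner_block hp (sphVec_mem_block p) ((spinBlock_eq k).le hx), mul_zero, mul_zero]

theorem existsUnique_isBlockScalar (d : ℕ → ℝ) :
    ∃! D : HS q →ₗ.[ℂ] HS q, IsBlockScalar (hState q) d D := by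
  obtain ⟨D, hD⟩ := exists_isDiag (sphBasis q) fun p => d p.1
  exact ⟨D, hD.isBlockScalar, fun D' hD' => hD'.isDiag.unique hD⟩

theorem IsBlockScalar.isEquivariant {d : ℕ → ℝ} {D : HS q →ₗ.[ℂ] HS q}
    (h : IsBlockScalar (hState q) d D) : IsEquivariant (hState q) D := by
  intro U hU
  refine h.isDiag.commutesWith U fun p p' hp => ?_
  rw [sphBasis_apply, sphBasis_apply]
  refine inner_block (fun h => hp (by rw [h])) (sphVec_mem_block p) ?_
  exact isInvariantSubspace_block p'.1 U hU _ (sphVec_mem_block p')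

/-- Commutation with the slices of rank one makes the zonal vector z an eigenvector and gives ⟪sph k
i, Dx⟫ = r⟪sph k i, x⟫ on the domain. Selfadjointness then puts each sph k i into the domain with
eigenvalue r. -/
theorem IsEquivariant.exists_eigenvalue {D : HS q →ₗ.[ℂ] HS q} (hD : IsSelfAdjoint D)
    (h : IsEquivariant (hState q) D) (k : ℕ) : ∃ r : ℝ, ∀ i ≤ 2 * k,
      (gnsLin q (sph q k i), (r : ℂ) • gnsLin q (sph q k i)) ∈ D.graph := by
  obtain ⟨c, hc, hU⟩ := exists_sliceOp_ψ_sph (q := q) k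
  set z := gnsLin q (sph q k k) with hz
  have hz0 : z ≠ 0 := gnsLin_sph_ne_zero (by omega)
  have hgr : ∀ i ≤ 2 * k, ∀ x w, (x, w) ∈ D.graph →
      (⟪gnsLin q (sph q k i), x⟫_ℂ • z, ⟪gnsLin q (sph q k i), w⟫_ℂ • z) ∈ D.graph := by
    intro i hi x w hxw
    obtain ⟨hx, rfl⟩ := mem_graph_iff_exists.1 hxw
    have h1 := mem_graph_iff_exists.2 (h _ (sliceOp_mem (ψ q (sph q k i))) ⟨x, hx⟩)
    rw [hU i hi, hU i hi] at h1
    have h2 := Submodule.smul_mem _ c⁻¹ h1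
    rw [Prod.smul_mk, smul_smul, smul_smul, inv_mul_cancel_left₀ hc, inv_mul_cancel_left₀ hc] at h2
    exact h2
  -- The domain is dense, so it is not orthogonal to z; the slice at such an x puts a multiple of z
  -- into the domain.
  obtain ⟨x, hx, hzx⟩ : ∃ x ∈ D.domain, ⟪z, x⟫_ℂ ≠ 0 := by
    by_contra! h'
    exact hz0 (hD.dense_domain.eq_zero_of_inner_left ℂ h')
  have h1 := hgr k (by omega) x _ (D.mem_graph ⟨x, hx⟩)
  rw [← hz] at h1
  have h2 := Submodule.smul_mem _ (⟪z, x⟫_ℂ)⁻¹ h1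
  rw [Prod.smul_mk, smul_smul, smul_smul, inv_mul_cancel₀ hzx, one_smul] at h2
  set r := (⟪z, x⟫_ℂ)⁻¹ * ⟪z, D ⟨x, hx⟩⟫_ℂ
  have hr : (r.re : ℂ) = r := by
    have h3 := (mem_graph_iff_of_isSelfAdjoint hD).1 h2 _ _ h2
    rw [inner_smul_left, inner_smul_right] at h3
    exact Complex.conj_eq_iff_re.1 (mul_right_cancel₀ (inner_self_ne_zero.2 hz0) h3)
  refine ⟨r.re, fun i hi => (mem_graph_iff_of_isSelfAdjoint hD).2 fun v w hvw => ?_⟩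
  have h3 := hgr i hi v w hvw
  have h4 := Submodule.smul_mem _ (⟪gnsLin q (sph q k i), v⟫_ℂ) h2
  rw [Prod.smul_mk, smul_smul] at h4
  obtain ⟨h5, h6⟩ := mem_graph_iff_exists.1 h3
  obtain ⟨h7, h8⟩ := mem_graph_iff_exists.1 h4
  have h9 := smul_left_injective ℂ hz0 (h6.symm.trans h8)
  rw [inner_smul_right, hr, ← inner_conj_symm w, h9, map_mul, inner_conj_symm, ← hr,
    Complex.conj_ofReal, mul_comm]

theorem IsEquivariant.exists_isBlockScalar {D : HS q →ₗ.[ℂ] HS q} (hD : IsSelfAdjoint D)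
    (h : IsEquivariant (hState q) D) : ∃ d : ℕ → ℝ, IsBlockScalar (hState q) d D := by
  choose d hd using h.exists_eigenvalue hD
  refine ⟨d, IsDiag.isBlockScalar (isDiag_of_isSelfAdjoint hD fun p => ?_)⟩
  have h1 := Submodule.smul_mem _ ((‖gnsLin q (sph q p.1 p.2)‖ : ℂ)⁻¹) (hd p.1 p.2 p.le)
  rw [Prod.smul_mk, smul_comm] at h1
  rw [sphBasis_apply]
  exact h1

end Equivariant

/-! ### Bounded commutators -/

section Commutators

section Algebra

variable {H : Type} [NormedAddCommGroup H] [InnerProductSpace ℂ H] [CompleteSpace H]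
  {D : H →ₗ.[ℂ] H}

theorem hasBoundedCommutator_iff {T : H →L[ℂ] H} : HasBoundedCommutator D T ↔
    ∃ C : ℝ, ∀ x z, (x, z) ∈ D.graph → ∃ w, (T x, w) ∈ D.graph ∧ ‖w - T z‖ ≤ C * ‖x‖ := by
  constructor
  · rintro ⟨C, h⟩
    refine ⟨C, fun x z hxz => ?_⟩
    obtain ⟨hx, rfl⟩ := mem_graph_iff_exists.1 hxz
    obtain ⟨h1, h2⟩ := h ⟨x, hx⟩
    exact ⟨_, mem_graph_iff_exists.2 ⟨h1, rfl⟩, h2⟩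
  · rintro ⟨C, h⟩
    refine ⟨C, fun x => ?_⟩
    obtain ⟨w, h1, h2⟩ := h _ _ (D.mem_graph x)
    obtain ⟨h3, rfl⟩ := mem_graph_iff_exists.1 h1
    exact ⟨h3, h2⟩

theorem HasBoundedCommutator.add {T S : H →L[ℂ] H} (hT : HasBoundedCommutator D T)
    (hS : HasBoundedCommutator D S) : HasBoundedCommutator D (T + S) := by
  rw [hasBoundedCommutator_iff] at *
  obtain ⟨C, hC⟩ := hT
  obtain ⟨C', hC'⟩ := hS
  refine ⟨C + C', fun x z hxz => ?_⟩
  obtain ⟨w, h1, h2⟩ := hC x z hxz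
  obtain ⟨w', h1', h2'⟩ := hC' x z hxz
  refine ⟨w + w', add_mem h1 h1', ?_⟩
  rw [add_apply, add_sub_add_comm, add_mul]
  exact norm_add_le_of_le h2 h2'

theorem HasBoundedCommutator.smul {T : H →L[ℂ] H} (hT : HasBoundedCommutator D T) (c : ℂ) :
    HasBoundedCommutator D (c • T) := by
  rw [hasBoundedCommutator_iff] at *
  obtain ⟨C, hC⟩ := hT
  refine ⟨‖c‖ * C, fun x z hxz => ?_⟩
  obtain ⟨w, h1, h2⟩ := hC x z hxz
  refine ⟨c • w, Submodule.smul_mem _ c h1, ?_⟩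
  rw [smul_apply, ← smul_sub, norm_smul, mul_assoc]
  exact mul_le_mul_of_nonneg_left h2 (norm_nonneg c)

theorem HasBoundedCommutator.mul {T S : H →L[ℂ] H} (hT : HasBoundedCommutator D T)
    (hS : HasBoundedCommutator D S) : HasBoundedCommutator D (T * S) := by
  rw [hasBoundedCommutator_iff] at *
  obtain ⟨C, hC⟩ := hT
  obtain ⟨C', hC'⟩ := hS
  refine ⟨|C| * ‖S‖ + ‖T‖ * C', fun x z hxz => ?_⟩
  obtain ⟨w', h1', h2'⟩ := hC' x z hxz
  obtain ⟨w, h1, h2⟩ := hC (S x) w' h1'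
  refine ⟨w, h1, ?_⟩
  rw [mul_apply_eq_comp, add_mul, show w - T (S z) = (w - T w') + T (w' - S z) by rw [map_sub]; abel]
  refine norm_add_le_of_le (h2.trans ?_) ((T.le_opNorm _).trans ?_)
  · rw [mul_assoc]
    exact mul_le_mul (le_abs_self C) (S.le_opNorm x) (norm_nonneg _) (abs_nonneg C)
  · rw [mul_assoc]
    exact mul_le_mul_of_nonneg_left h2' (norm_nonneg T)

theorem HasBoundedCommutator.one : HasBoundedCommutator D 1 :=
  hasBoundedCommutator_iff.2 ⟨0, fun x z hxz => ⟨z, hxz, by simp⟩⟩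

end Algebra

variable {q : ℝ} [hq : Fact (|q| < 1)] [NeZero q]

/-- The projection onto the spin-`k` block. -/
def blockProj (q : ℝ) [Fact (|q| < 1)] [NeZero q] (k : ℕ) : HS q →L[ℂ] HS q :=
  ∑ i : Fin (2 * k + 1), (innerSL ℂ (sphVec q ⟨k, i⟩)).smulRight (sphVec q ⟨k, i⟩)

theorem blockProj_apply (k : ℕ) (x : HS q) :
    blockProj q k x = ∑ i : Fin (2 * k + 1), ⟪sphVec q ⟨k, i⟩, x⟫_ℂ • sphVec q ⟨k, i⟩ := by
  rw [blockProj, sum_apply]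
  rfl

theorem blockProj_mem (k : ℕ) (x : HS q) : blockProj q k x ∈ block q k := by
  rw [blockProj_apply]
  exact Submodule.sum_mem _ fun i _ => Submodule.smul_mem _ _ (sphVec_mem_block ⟨k, i⟩)

theorem norm_blockProj_sq (k : ℕ) (x : HS q) :
    ‖blockProj q k x‖ ^ 2 = ∑ i : Fin (2 * k + 1), ‖⟪sphVec q ⟨k, i⟩, x⟫_ℂ‖ ^ 2 := by
  have ho : Orthonormal ℂ fun i : Fin (2 * k + 1) => sphVec q ⟨k, i⟩ :=
    orthonormal_sphVec.comp _ (sigma_mk_injective (β := fun k => Fin (2 * k + 1)))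
  apply Complex.ofReal_injective
  have h := inner_self_eq_norm_sq_to_K (𝕜 := ℂ) (blockProj q k x)
  rw [blockProj_apply, ho.inner_sum] at h
  rw [blockProj_apply, Complex.ofReal_pow, Complex.ofReal_sum]
  refine h.symm.trans (Finset.sum_congr rfl fun i _ => ?_)
  rw [Complex.conj_mul', Complex.ofReal_pow]

theorem blockProj_sphVec (k : ℕ) (p : SphIdx) :
    blockProj q k (sphVec q p) = if p.1 = k then sphVec q p else 0 := by
  rw [blockProj_apply]
  split_ifs with h
  · obtain ⟨k', i⟩ := p
    obtain rfl : k' = k := h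
    rw [Finset.sum_eq_single_of_mem i (Finset.mem_univ i), inner_self_eq_norm_sq_to_K (𝕜 := ℂ),
      orthonormal_sphVec.1]
    · simp
    · intro j _ hj
      rw [orthonormal_sphVec.2, zero_smul]
      exact fun h => hj (sigma_mk_injective (β := fun k => Fin (2 * k + 1)) h)
  · refine Finset.sum_eq_zero fun i _ => ?_
    rw [orthonormal_sphVec.2, zero_smul]
    rintro rfl
    exact h rfl

theorem sum_range_norm_blockProj_sq_le (n : ℕ) (x : HS q) :
    ∑ k ∈ Finset.range n, ‖blockProj q k x‖ ^ 2 ≤ ‖x‖ ^ 2 := by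
  have h := sum_norm_inner_sq_le (sphBasis q) x ((Finset.range n).sigma fun _ => Finset.univ)
  rw [Finset.sum_sigma] at h
  simp only [sphBasis_apply] at h
  simp only [norm_blockProj_sq]
  exact h

/-- `T` raises the spin by at most one, with rapidly decreasing norm. -/
def IsRaising (T : HS q →L[ℂ] HS q) : Prop :=
  (∃ K : ℝ, 0 ≤ K ∧ ∀ k, ∀ y ∈ block q k,
    ∑ i : Fin (2 * (k + 1) + 1), ‖⟪sphVec q ⟨k + 1, i⟩, T y⟫_ℂ‖ ^ 2 ≤ K * (q ^ 2) ^ k * ‖y‖ ^ 2) ∧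
  ∀ p p' : SphIdx, p'.1 + 1 < p.1 → ⟪sphVec q p, T (sphVec q p')⟫_ℂ = 0

/-- The blocks from spin k to spin k+1 have mutually orthogonal sources and mutually orthogonal
targets, so it suffices to bound each one, and the growth of d is compensated by the decay of the
block. -/
theorem IsRaising.exists_clm {T : HS q →L[ℂ] HS q} (hT : IsRaising T) {d : ℕ → ℝ} {M : ℝ}
    (hM : 0 ≤ M) (hd : ∀ k, (d k - d (k + 1)) ^ 2 * (q ^ 2) ^ k ≤ M) :
    ∃ B : HS q →L[ℂ] HS q, ∀ p p' : SphIdx, ⟪sphVec q p, B (sphVec q p')⟫_ℂ =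
      if p.1 = p'.1 + 1 then ((d p.1 : ℂ) - d p'.1) * ⟪sphVec q p, T (sphVec q p')⟫_ℂ else 0 := by
  obtain ⟨⟨K, hK0, hK⟩, -⟩ := hT
  let φ : SphIdx → HS q →L[ℂ] ℂ := fun p => if p.1 = 0 then 0 else
    ((d p.1 : ℂ) - d (p.1 - 1)) • ((innerSL ℂ (sphVec q p)).comp (T.comp (blockProj q (p.1 - 1))))
  have hφ : ∀ (k : ℕ) (x : HS q),
      ∑ i : Fin (2 * (k + 1) + 1), ‖φ ⟨k + 1, i⟩ x‖ ^ 2 ≤ M * K * ‖blockProj q k x‖ ^ 2 := by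
    intro k x
    have h1 : ∀ i, ‖φ ⟨k + 1, i⟩ x‖ ^ 2 =
        (d k - d (k + 1)) ^ 2 * ‖⟪sphVec q ⟨k + 1, i⟩, T (blockProj q k x)⟫_ℂ‖ ^ 2 := by
      intro i
      change ‖((d (k + 1) : ℂ) - d k) * ⟪sphVec q ⟨k + 1, i⟩, T (blockProj q k x)⟫_ℂ‖ ^ 2 = _
      rw [norm_mul, mul_pow, ← Complex.ofReal_sub, Complex.norm_real, Real.norm_eq_abs, sq_abs]
      ring
    rw [Finset.sum_congr rfl fun i _ => h1 i, ← Finset.mul_sum]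
    calc _ ≤ (d k - d (k + 1)) ^ 2 * (K * (q ^ 2) ^ k * ‖blockProj q k x‖ ^ 2) :=
          mul_le_mul_of_nonneg_left (hK k _ (blockProj_mem k x)) (sq_nonneg _)
      _ = ((d k - d (k + 1)) ^ 2 * (q ^ 2) ^ k) * (K * ‖blockProj q k x‖ ^ 2) := by ring
      _ ≤ M * (K * ‖blockProj q k x‖ ^ 2) := by
          have := hd k
          gcongr
      _ = _ := by ring
  have hn : ∀ (n : ℕ) (x : HS q),
      ∑ k ∈ Finset.range n, ∑ i : Fin (2 * k + 1), ‖φ ⟨k, i⟩ x‖ ^ 2 ≤ M * K * ‖x‖ ^ 2 := by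
    intro n x
    rcases n with _ | n
    · rw [Finset.sum_range_zero]; positivity
    · rw [Finset.sum_range_succ']
      have h0 : ∑ i : Fin (2 * 0 + 1), ‖φ ⟨0, i⟩ x‖ ^ 2 = 0 := by
        refine Finset.sum_eq_zero fun i _ => ?_
        simp [φ]
      rw [h0, add_zero]
      calc _ ≤ ∑ k ∈ Finset.range n, M * K * ‖blockProj q k x‖ ^ 2 :=
            Finset.sum_le_sum fun k _ => hφ k x
        _ ≤ _ := by
            rw [← Finset.mul_sum]
            exact mul_le_mul_of_nonneg_left (sum_range_norm_blockProj_sq_le n x) (by positivity)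
  obtain ⟨B, -, hB⟩ := exists_clm_of_coord (sphBasis q) φ (Real.sqrt_nonneg (M * K)) (by
    intro x s
    rw [mul_pow, Real.sq_sqrt (by positivity)]
    refine le_trans ?_ (hn ((s.sup Sigma.fst) + 1) x)
    rw [Finset.sum_sigma' (Finset.range _) (fun _ => Finset.univ) fun k i => ‖φ ⟨k, i⟩ x‖ ^ 2]
    refine Finset.sum_le_sum_of_subset_of_nonneg (fun p hp => ?_) fun _ _ _ => sq_nonneg _
    rw [Finset.mem_sigma, Finset.mem_range]
    exact ⟨Nat.lt_succ_iff.2 (Finset.le_sup (f := Sigma.fst) hp), Finset.mem_univ _⟩)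
  refine ⟨B, fun p p' => ?_⟩
  rw [← sphBasis_apply p, hB]
  by_cases h0 : p.1 = 0
  · rw [if_neg (by omega)]
    simp [φ, h0]
  · have h1 : φ p (sphVec q p') = ((d p.1 : ℂ) - d (p.1 - 1)) *
        ⟪sphVec q p, T (blockProj q (p.1 - 1) (sphVec q p'))⟫_ℂ := by
      simp only [φ, if_neg h0]
      rfl
    rw [h1, blockProj_sphVec, sphBasis_apply]
    by_cases h2 : p.1 = p'.1 + 1
    · rw [if_pos h2, if_pos (by omega), h2, Nat.add_sub_cancel]
    · rw [if_neg h2, if_neg (by omega), map_zero, inner_zero_right, mul_zero]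

/-- The commutator has no diagonal blocks. Its raising blocks form B; its lowering blocks are minus
the adjoint of the raising blocks built from T*. -/
theorem IsRaising.hasBoundedCommutator {T : HS q →L[ℂ] HS q} (hT : IsRaising T)
    (hT' : IsRaising (ContinuousLinearMap.adjoint T)) {d : ℕ → ℝ} {M : ℝ} (hM : 0 ≤ M)
    (hd : ∀ k, (d k - d (k + 1)) ^ 2 * (q ^ 2) ^ k ≤ M) {D : HS q →ₗ.[ℂ] HS q}
    (hD : IsDiag (sphBasis q) (fun p => d p.1) D) : HasBoundedCommutator D T := by
  obtain ⟨B, hB⟩ := hT.exists_clm hM hd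
  obtain ⟨B', hB'⟩ := hT'.exists_clm hM hd
  refine hD.hasBoundedCommutator T (B - ContinuousLinearMap.adjoint B') fun p p' => ?_
  have h1 : ⟪sphVec q p, ContinuousLinearMap.adjoint B' (sphVec q p')⟫_ℂ =
      if p'.1 = p.1 + 1 then ((d p'.1 : ℂ) - d p.1) * ⟪sphVec q p, T (sphVec q p')⟫_ℂ else 0 := by
    rw [ContinuousLinearMap.adjoint_inner_right, ← inner_conj_symm, hB']
    split_ifs
    · rw [map_mul, map_sub, Complex.conj_ofReal, Complex.conj_ofReal, inner_conj_symm,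
        ContinuousLinearMap.adjoint_inner_left]
    · rw [map_zero]
  rw [sphBasis_apply, sphBasis_apply, sub_apply, inner_sub_right, hB, h1]
  rcases lt_trichotomy p.1 p'.1 with h | h | h
  · rw [if_neg (by omega)]
    split_ifs with h'
    · ring
    · have := hT'.2 p' p (by omega)
      rw [ContinuousLinearMap.adjoint_inner_right, ← inner_conj_symm, map_eq_zero] at this
      rw [this]; ring
  · rw [if_neg (by omega), if_neg (by omega), h]; ring
  · rw [if_neg (by omega : ¬ p'.1 = p.1 + 1)]
    split_ifs with h'
    · ring
    · rw [hT.2 p p' (by omega)]; ring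

theorem IsRaising.smul {T : HS q →L[ℂ] HS q} (hT : IsRaising T) (c : ℂ) : IsRaising (c • T) := by
  obtain ⟨⟨K, hK0, hK⟩, h⟩ := hT
  refine ⟨⟨‖c‖ ^ 2 * K, by positivity, fun k y hy => ?_⟩, fun p p' hp => ?_⟩
  · calc _ = ‖c‖ ^ 2 * ∑ i : Fin (2 * (k + 1) + 1), ‖⟪sphVec q ⟨k + 1, i⟩, T y⟫_ℂ‖ ^ 2 := by
          rw [Finset.mul_sum]
          refine Finset.sum_congr rfl fun i _ => ?_
          rw [smul_apply, inner_smul_right, norm_mul, mul_pow]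
      _ ≤ ‖c‖ ^ 2 * (K * (q ^ 2) ^ k * ‖y‖ ^ 2) := mul_le_mul_of_nonneg_left (hK k y hy) (sq_nonneg _)
      _ = _ := by ring
  · rw [smul_apply, inner_smul_right, h p p' hp, mul_zero]

/-- A spin-one factor raises the polynomial degree by at most one, and degree at most n means spins
at most n. -/
theorem gnsLin_sph_one_mul (j : ℕ) (p : SphIdx) {l : ℕ} (hl : p.1 + 1 < l) {y : HS q}
    (hy : y ∈ block q l) (hj : j ≤ 2) : ⟪y, gnsLin q (sph q 1 j * sph q p.1 p.2)⟫_ℂ = 0 := by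
  have h1 : sph q 1 j * sph q p.1 p.2 ∈ polyDeg q (p.1 + 1) := by
    have hp := sph_mem_polyDeg q p.1 p.2
    interval_cases j
    · rw [sph_zero_right, pow_one]
      exact eta_mul_mem q hp
    · have : sph q 1 1 = (q : ℂ) • zeta q := by simp [sph]
      rw [this, smul_mul_assoc]
      exact Submodule.smul_mem _ _ (zeta_mul_mem q hp)
    · have : sph q 1 2 = (-(q : ℂ)) • star (eta q) := by simp [sph]
      rw [this, smul_mul_assoc]
      exact Submodule.smul_mem _ _ (star_eta_mul_mem q hp)
  rw [polyDeg_eq_span] at h1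
  generalize sph q 1 j * sph q p.1 p.2 = x at h1 ⊢
  induction h1 using Submodule.span_induction with
  | mem x hx =>
    obtain ⟨p', rfl⟩ := hx
    exact inner_block (by have := p'.1.2; omega) hy (gnsLin_sph_mem_block (by have := p'.2.2; omega))
  | zero => rw [map_zero, inner_zero_right]
  | add x y _ _ hx hy => rw [map_add, inner_add_right, hx, hy, add_zero]
  | smul c x _ hx => rw [map_smul, inner_smul_right, hx, mul_zero]

theorem isRaising_sph_one {j : ℕ} (hj : j ≤ 2) :
    IsRaising ((hState q).gnsStarAlgHom (sph q 1 j)) := by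
  have hq2 := q_sq_lt_one q
  refine ⟨⟨‖reg q (tc q 2 0 j)‖ ^ 2 / (1 - q ^ 2), div_nonneg (sq_nonneg _) (by linarith),
    fun k y hy => ?_⟩, fun p p' hp => ?_⟩
  · have h1 : block q k = (Submodule.span ℂ (Set.range fun i : Fin (2 * k + 1) => sph q k i)).map
        (gnsLin q) := by
      rw [Submodule.map_span, ← Set.range_comp]
      rfl
    rw [h1] at hy
    obtain ⟨a, ha, rfl⟩ := hy
    rw [gnsStarAlgHom_gnsLin]
    exact sum_inner_sph_mul_le hj ha
  · change ⟪sphVec q p, (hState q).gnsStarAlgHom (sph q 1 j) (_ • gnsLin q (sph q p'.1 p'.2))⟫_ℂ = 0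
    rw [map_smul, gnsStarAlgHom_gnsLin, inner_smul_right,
      gnsLin_sph_one_mul j p' hp (sphVec_mem_block p) hj, mul_zero]

end Commutators

open Presentation

/-! ### The growth condition and bounded commutators. -/

section Growth

variable {q : ℝ} [hq : Fact (|q| < 1)] [NeZero q]

/-- Squaring removes the sign of q and matches the norm estimates; on ℕ the eventual bound holds for
all k after enlarging the constant. -/
theorem isBigO_inv_pow_iff {d : ℕ → ℝ} :
    ((fun k => |d k - d (k + 1)|) =O[Filter.atTop] fun k : ℕ => (q⁻¹) ^ k) ↔
      ∃ M : ℝ, 0 ≤ M ∧ ∀ k, (d k - d (k + 1)) ^ 2 * (q ^ 2) ^ k ≤ M := by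
  have hq0 : q ≠ 0 := NeZero.ne q
  constructor
  · intro h
    obtain ⟨C, hC, h⟩ := Asymptotics.bound_of_isBigO_nat_atTop h
    refine ⟨C ^ 2, sq_nonneg _, fun k => ?_⟩
    have h1 := h (x := k) (pow_ne_zero _ (inv_ne_zero hq0))
    rw [Real.norm_eq_abs, abs_abs, norm_pow, norm_inv, Real.norm_eq_abs, inv_pow,
      ← div_eq_mul_inv, le_div_iff₀ (by positivity)] at h1
    calc _ = (|d k - d (k + 1)| * |q| ^ k) ^ 2 := by
          rw [mul_pow, sq_abs, ← sq_abs q, ← pow_mul, ← pow_mul, mul_comm 2 k]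
      _ ≤ C ^ 2 := pow_le_pow_left₀ (by positivity) h1 2
  · rintro ⟨M, hM, h⟩
    refine Asymptotics.IsBigO.of_bound (√M) (Filter.Eventually.of_forall fun k => ?_)
    rw [Real.norm_eq_abs, abs_abs, norm_pow, norm_inv, Real.norm_eq_abs, inv_pow,
      ← div_eq_mul_inv, le_div_iff₀ (by positivity)]
    refine Real.le_sqrt_of_sq_le ?_
    calc _ = (d k - d (k + 1)) ^ 2 * (q ^ 2) ^ k := by
          rw [mul_pow, sq_abs, ← sq_abs q, ← pow_mul, ← pow_mul, mul_comm 2 k]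
      _ ≤ M := h k

theorem star_sph_one {j : ℕ} (hj : j ≤ 2) : ∃ (c : ℂ) (i : ℕ), i ≤ 2 ∧ star (sph q 1 j) = c • sph q 1 i := by
  have h1 : sph q 1 1 = (q : ℂ) • zeta q := by simp [sph]
  have h2 : sph q 1 2 = (-(q : ℂ)) • star (eta q) := by simp [sph]
  have h0 : sph q 1 0 = eta q := by simp [sph]
  interval_cases j
  · refine ⟨-(q : ℂ)⁻¹, 2, le_rfl, ?_⟩
    rw [h0, h2, smul_smul, neg_mul_neg, inv_mul_cancel₀ (q_ne_zero (q := q)), one_smul]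
  · refine ⟨1, 1, by omega, ?_⟩
    have : star (zeta q) = zeta q := by
      rw [zeta, star_sub, star_one, star_smul, star_xi]
      simp
    rw [h1, star_smul, this, one_smul]
    simp
  · refine ⟨-(q : ℂ), 0, by omega, ?_⟩
    rw [h2, h0, star_smul, star_star]
    simp

theorem hasBoundedCommutator_sph_one {j : ℕ} (hj : j ≤ 2) {d : ℕ → ℝ} {M : ℝ} (hM : 0 ≤ M)
    (hd : ∀ k, (d k - d (k + 1)) ^ 2 * (q ^ 2) ^ k ≤ M) {D : HS q →ₗ.[ℂ] HS q}
    (hD : IsBlockScalar (hState q) d D) :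
    HasBoundedCommutator D ((hState q).gnsStarAlgHom (sph q 1 j)) := by
  refine (isRaising_sph_one hj).hasBoundedCommutator ?_ hM hd hD.isDiag
  obtain ⟨c, i, hi, h⟩ := star_sph_one (q := q) hj
  rw [← ContinuousLinearMap.star_eq_adjoint, ← map_star, h, map_smul]
  exact (isRaising_sph_one hi).smul c

theorem hasBoundedCommutator_polySph {d : ℕ → ℝ} {D : HS q →ₗ.[ℂ] HS q}
    (hD : IsBlockScalar (hState q) d D)
    (hd : (fun k => |d k - d (k + 1)|) =O[Filter.atTop] fun k : ℕ => (q⁻¹) ^ k) {x : CS q}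
    (hx : x ∈ polySph q) : HasBoundedCommutator D ((hState q).gnsStarAlgHom x) := by
  obtain ⟨M, hM, hd⟩ := isBigO_inv_pow_iff.1 hd
  have h := fun {j : ℕ} (hj : j ≤ 2) => hasBoundedCommutator_sph_one (q := q) hj hM hd hD
  have heta : HasBoundedCommutator D ((hState q).gnsStarAlgHom (eta q)) := by
    simpa [sph] using h (j := 0) (by omega)
  have hse : HasBoundedCommutator D ((hState q).gnsStarAlgHom (star (eta q))) := by
    have : star (eta q) = (-(q : ℂ)⁻¹) • sph q 1 2 := by
      simp only [sph]
      rw [mul_zero, mul_zero, smul_zero, smul_zero, zero_add, zero_add, mul_one, smul_smul, neg_mul_neg,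
        inv_mul_cancel₀ (q_ne_zero (q := q)), one_smul]
    rw [this, map_smul]
    exact (h le_rfl).smul _
  have hxi : HasBoundedCommutator D ((hState q).gnsStarAlgHom (xi q)) := by
    have hne : (1 + (q : ℂ) ^ 2) ≠ 0 := by
      have : (0 : ℝ) < 1 + q ^ 2 := by positivity
      exact_mod_cast this.ne'
    have : xi q = (1 + (q : ℂ) ^ 2)⁻¹ • ((1 : CS q) + (-(q : ℂ)⁻¹) • sph q 1 1) := by
      have h1 : sph q 1 1 = (q : ℂ) • zeta q := by simp [sph]
      rw [h1, smul_smul, neg_mul, inv_mul_cancel₀ (q_ne_zero (q := q)), zeta, neg_one_smul, neg_sub,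
        add_sub_cancel, smul_smul, inv_mul_cancel₀ hne, one_smul]
    rw [this, map_smul, map_add, map_one, map_smul]
    exact (HasBoundedCommutator.one.add ((h (by omega)).smul _)).smul _
  have hx' : x ∈ Algebra.adjoin ℂ (Set.range (sphere q).gen ∪ star (Set.range (sphere q).gen)) := hx
  clear hx
  induction hx' using Algebra.adjoin_induction with
  | mem x h =>
    rcases h with ⟨i, rfl⟩ | ⟨i, hi⟩
    · fin_cases i
      exacts [hxi, heta]
    · obtain rfl : x = star ((sphere q).gen i) := by rw [hi, star_star]
      fin_cases i
      · change HasBoundedCommutator D ((hState q).gnsStarAlgHom (star (xi q)))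
        rw [star_xi]
        exact hxi
      · exact hse
  | algebraMap r =>
    rw [Algebra.algebraMap_eq_smul_one, map_smul, map_one]
    exact HasBoundedCommutator.one.smul r
  | add x y _ _ hx hy => rw [map_add]; exact hx.add hy
  | mul x y _ _ hx hy => rw [map_mul]; exact hx.mul hy

/-- On the highest weight vectors η acts by ηᵏ ↦ ηᵏ⁺¹, so the commutator multiplies ηᵏ⁺¹ by d(k+1) -
d(k). The lower bound for ‖ηᵏ⁺¹‖²/‖ηᵏ‖² turns boundedness into the growth condition. -/
theorem isBigO_of_hasBoundedCommutator_eta {d : ℕ → ℝ} {D : HS q →ₗ.[ℂ] HS q}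
    (hD : IsBlockScalar (hState q) d D)
    (h : HasBoundedCommutator D ((hState q).gnsStarAlgHom (eta q))) :
    (fun k => |d k - d (k + 1)|) =O[Filter.atTop] fun k : ℕ => (q⁻¹) ^ k := by
  obtain ⟨C, hC⟩ := hasBoundedCommutator_iff.1 h
  have hq0 := q_sq_pos (q := q)
  have hq1 : 0 < 1 - q ^ 2 := sub_pos.2 (q_sq_lt_one q)
  have hgr : ∀ k, (gnsLin q (sph q k 0), (d k : ℂ) • gnsLin q (sph q k 0)) ∈ D.graph := fun k =>
    mem_graph_iff_exists.2 (hD.2 k _ ((spinBlock_eq k).ge (gnsLin_sph_mem_block (by omega))))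
  refine isBigO_inv_pow_iff.2 ⟨C ^ 2 / ((q ^ 2) ^ 2 * ((1 - q ^ 2) / 2)), by positivity, fun k => ?_⟩
  obtain ⟨w, hw, hw'⟩ := hC _ _ (hgr k)
  rw [map_smul, gnsStarAlgHom_gnsLin, show eta q * sph q k 0 = sph q (k + 1) 0 from rfl] at hw'
  rw [gnsStarAlgHom_gnsLin, show eta q * sph q k 0 = sph q (k + 1) 0 from rfl] at hw
  -- The graph is single-valued, so w is d(k+1) times ηᵏ⁺¹.
  obtain rfl := D.mem_graph_snd_inj hw (hgr (k + 1)) rfl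
  rw [← sub_smul, norm_smul, ← Complex.ofReal_sub, Complex.norm_real, Real.norm_eq_abs] at hw'
  have h1 := pow_le_pow_left₀ (by positivity) hw' 2
  rw [mul_pow, mul_pow, sq_abs] at h1
  have h2 := le_norm_gnsLin_sph_zero_succ (q := q) k
  have h3 : 0 < ‖gnsLin q (sph q k 0)‖ ^ 2 := by
    have := norm_pos_iff.2 (gnsLin_sph_ne_zero (q := q) (k := k) (i := 0) (by omega))
    positivity
  rw [le_div_iff₀ (by positivity)]
  refine le_of_mul_le_mul_right ?_ h3
  calc _ = (d (k + 1) - d k) ^ 2 * ((q ^ 2) ^ (k + 2) * ((1 - q ^ 2) / 2) *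
        ‖gnsLin q (sph q k 0)‖ ^ 2) := by ring
    _ ≤ (d (k + 1) - d k) ^ 2 * ‖gnsLin q (sph q (k + 1) 0)‖ ^ 2 :=
        mul_le_mul_of_nonneg_left h2 (sq_nonneg _)
    _ ≤ _ := h1

end Growth

open Presentation

/-! ### The smooth subalgebra -/

section Smooth

variable {q : ℝ} [hq : Fact (|q| < 1)] [NeZero q]

/-- Needed to place the monomials in `polyAlg`. The entries u₁₂ and u₂₁ are nonzero of different
bidegree, so the first row of Tu = uT already forces T to be scalar. -/
theorem isIrreducibleRep_u : IsIrreducibleRep q (u q) where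
  unitary_left := (isSUq2_u q).unitary_left
  unitary_right := (isSUq2_u q).unitary_right
  comul i j := Δ_u q i j
  irreducible T hT := by
    obtain ⟨-, hb, -⟩ := (isSUq2_u q).facts
    have hcc : haar q (star (u q 1 0) * u q 1 0) ≠ 0 := by
      simpa [mono] using haar_star_mono_mul_self_ne_zero (q := q) 1 0
    have hc0 : u q 1 0 ≠ 0 := fun h => hcc (by rw [h, mul_zero, map_zero])
    have hb0 : u q 0 1 ≠ 0 := by
      rw [hb]
      exact smul_ne_zero (neg_ne_zero.2 q_ne_zero) (star_ne_zero.2 hc0)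
    have e00 := congrFun (congrFun hT 0) 0
    have e01 := congrFun (congrFun hT 0) 1
    simp only [Matrix.mul_apply, Fin.sum_univ_two, Matrix.map_apply, Algebra.algebraMap_eq_smul_one,
      smul_mul_assoc, mul_smul_comm, one_mul, mul_one] at e00 e01
    have h1 : T 0 1 • u q 1 0 = T 1 0 • u q 0 1 := add_left_cancel e00
    have h01 : T 0 1 = 0 := by
      have h2 := congrArg (fun x => haar q (star (u q 1 0) * x)) h1
      simp only [mul_smul_comm, map_smul] at h2
      rw [haar_star_mul_eq_zero (hasDeg_u10 (q := q)) (hasDeg_u01 (q := q)) (by omega), smul_zero] at h2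
      exact (smul_eq_zero.1 h2).resolve_right hcc
    have h10 : T 1 0 = 0 := by
      rw [h01, zero_smul] at h1
      exact (smul_eq_zero.1 h1.symm).resolve_right hb0
    have h11 : T 0 0 = T 1 1 := by
      rw [h01, zero_smul, zero_smul, add_zero, zero_add] at e01
      exact smul_left_injective ℂ hb0 e01
    refine ⟨T 0 0, ?_⟩
    ext i j
    fin_cases i <;> fin_cases j <;> simp [h01, h10, h11]

theorem mono_mem_polyAlg (i p : ℕ) : mono q i p ∈ polyAlg q :=
  have h : ∀ i j, u q i j ∈ polyAlg q := fun i j =>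
    StarAlgebra.subset_adjoin ℂ _ ⟨2, u q, i, j, isIrreducibleRep_u, rfl⟩
  mul_mem (pow_mem (h 1 0) i) (pow_mem (h 0 0) p)

theorem eta_mem_smoothAlg : eta q ∈ smoothAlg q := by
  have h := τ_eta_pow q 1
  rw [pow_one] at h
  change τ q (eta q) ∈ Submodule.span ℂ _
  rw [h]
  exact Submodule.sum_mem _ fun l _ => Submodule.subset_span ⟨_, _, mono_mem_polyAlg _ _, rfl⟩

/-- All slices id ⊗ ω of a finite sum ∑ bᵢ ⊗ gᵢ lie in the span of the bᵢ. -/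
theorem exists_finiteDimensional_sliceOp {a : CS q} (ha : a ∈ smoothAlg q) :
    ∃ W : Submodule ℂ (HS q), FiniteDimensional ℂ W ∧ ∀ y, sliceOp y (gnsLin q a) ∈ W := by
  suffices H : ∀ t ∈ Submodule.span ℂ {t | ∃ (b : CS q) (g : CG q), g ∈ polyAlg q ∧
      t = inl (sphere q) (suq2 q) b * inr (sphere q) (suq2 q) g},
      ∃ W : Submodule ℂ (HS q), FiniteDimensional ℂ W ∧
        ∀ y, gnsLin q (rightSlice q (sphere q) y t) ∈ W by
    obtain ⟨W, hW, h⟩ := H _ ha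
    exact ⟨W, hW, fun y => by rw [sliceOp_gnsLin]; exact h y⟩
  intro t ht
  induction ht using Submodule.span_induction with
  | mem t ht =>
    obtain ⟨b, g, -, rfl⟩ := ht
    refine ⟨Submodule.span ℂ {gnsLin q b}, inferInstance, fun y => ?_⟩
    rw [rightSlice_tmul, map_smul]
    exact Submodule.smul_mem _ _ (Submodule.mem_span_singleton_self _)
  | zero =>
    refine ⟨⊥, inferInstance, fun y => ?_⟩
    rw [map_zero, map_zero]
    exact zero_mem _
  | add s t _ _ hs ht =>
    obtain ⟨W, hW, h⟩ := hs
    obtain ⟨W', hW', h'⟩ := ht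
    refine ⟨W ⊔ W', inferInstance, fun y => ?_⟩
    rw [map_add, map_add]
    exact add_mem (Submodule.mem_sup_left (h y)) (Submodule.mem_sup_right (h' y))
  | smul c t _ ht =>
    obtain ⟨W, hW, h⟩ := ht
    refine ⟨W, hW, fun y => ?_⟩
    rw [map_smul, map_smul]
    exact Submodule.smul_mem _ _ (h y)

/-- If spin k occurs in a, a slice of rank one puts the zonal vector of spin k into the
finite-dimensional space of slices. These vectors are independent, so only finitely many k occur. -/
theorem finite_spins {a : CS q} (ha : a ∈ smoothAlg q) :
    {p : SphIdx | ⟪sphVec q p, gnsLin q a⟫_ℂ ≠ 0}.Finite := by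
  obtain ⟨W, hW, h⟩ := exists_finiteDimensional_sliceOp ha
  let K : Set ℕ := {k | sphVec q ⟨k, ⟨k, by omega⟩⟩ ∈ W}
  have hK : K.Finite := by
    have h1 : LinearIndependent ℂ fun k : K => (⟨sphVec q ⟨k.1, ⟨k.1, by omega⟩⟩, k.2⟩ : W) := by
      refine LinearIndependent.of_comp W.subtype ?_
      refine orthonormal_sphVec.linearIndependent.comp
        (fun k : K => (⟨k.1, ⟨k.1, by omega⟩⟩ : SphIdx)) fun k k' hk => ?_
      exact Subtype.ext (congrArg Sigma.fst hk)
    have := h1.finite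
    exact Set.toFinite K
  refine (hK.toFinset.sigma fun k => (Finset.univ : Finset (Fin (2 * k + 1)))).finite_toSet.subset ?_
  intro p hp
  rw [Finset.mem_coe, Finset.mem_sigma]
  refine ⟨hK.mem_toFinset.2 ?_, Finset.mem_univ _⟩
  obtain ⟨c, hc, hc'⟩ := exists_sliceOp_ψ_sph (q := q) p.1
  have h1 := h (ψ q (sph q p.1 p.2))
  rw [hc' _ (SphIdx.le p)] at h1
  have h2 : ⟪gnsLin q (sph q p.1 p.2), gnsLin q a⟫_ℂ ≠ 0 := by
    intro h0
    refine hp ?_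
    rw [sphVec, inner_smul_left, h0, mul_zero]
  exact Submodule.smul_mem _ _ ((Submodule.smul_mem_iff _ (mul_ne_zero hc h2)).1 h1)

theorem exists_gnsLin_eq_of_mem_smoothAlg {a : CS q} (ha : a ∈ smoothAlg q) :
    ∃ x ∈ polySph q, gnsLin q x = gnsLin q a := by
  have hf := finite_spins ha
  refine ⟨∑ p ∈ hf.toFinset, ⟪sphVec q p, gnsLin q a⟫_ℂ •
    ((‖gnsLin q (sph q p.1 p.2)‖ : ℂ)⁻¹ • sph q p.1 p.2), ?_, ?_⟩
  · exact sum_mem fun p _ => SMulMemClass.smul_mem _ (SMulMemClass.smul_mem _ (sph_mem_polySph _ _))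
  · refine hilbertBasis_ext (sphBasis q) fun p => ?_
    have h1 : gnsLin q (∑ p ∈ hf.toFinset, ⟪sphVec q p, gnsLin q a⟫_ℂ •
        ((‖gnsLin q (sph q p.1 p.2)‖ : ℂ)⁻¹ • sph q p.1 p.2)) =
        ∑ p ∈ hf.toFinset, ⟪sphVec q p, gnsLin q a⟫_ℂ • sphVec q p := by
      rw [map_sum]
      refine Finset.sum_congr rfl fun p _ => ?_
      rw [map_smul, map_smul]
      rfl
    rw [h1, sphBasis_apply]
    by_cases hp : p ∈ hf.toFinset
    · exact orthonormal_sphVec.inner_right_sum _ hp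
    · rw [inner_sum, Finset.sum_eq_zero]
      · by_contra h
        exact hp (hf.mem_toFinset.2 fun h' => h h'.symm)
      · intro p' hp'
        rw [inner_smul_right, orthonormal_sphVec.2 (by rintro rfl; exact hp hp'), mul_zero]

/-- The null space of a state is a left ideal. By the modular relations it is also stable under
right multiplication by ξ, η and η*; for example h((cη)*cη) = q² h(c*cηη*) = 0. -/
theorem gnsLin_mul_eq_zero {c : CS q} (hc : gnsLin q c = 0) {x : CS q} (hx : x ∈ polySph q) :
    gnsLin q (c * x) = 0 := by
  have key : ∀ c : CS q, gnsLin q c = 0 → ∀ y, haar q (star (ψ q c) * ψ q y) = 0 := fun c hc y => by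
    rw [← inner_gnsLin, hc, inner_zero_left]
  have key' : ∀ c : CS q, gnsLin q c = 0 → ∀ y, haar q (star (ψ q y) * ψ q c) = 0 := fun c hc y => by
    rw [← inner_gnsLin, hc, inner_zero_right]
  have hzero : ∀ c : CS q, haar q (star (ψ q c) * ψ q c) = 0 → gnsLin q c = 0 := fun c h => by
    rw [← inner_gnsLin] at h
    exact inner_self_eq_zero.1 h
  have hxi : ∀ c : CS q, gnsLin q c = 0 → gnsLin q (c * xi q) = 0 := by
    intro c hc
    refine hzero _ ?_
    have h1 := haar_mul_xi (star (ψ q c) * ψ q (c * xi q))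
    rw [mul_assoc, ← map_mul, key c hc] at h1
    rw [map_mul (ψ q), star_mul, ← map_star (ψ q) (xi q), star_xi, mul_assoc, ← map_mul]
    exact h1.symm
  have heta : ∀ c : CS q, gnsLin q c = 0 → gnsLin q (c * eta q) = 0 := by
    intro c hc
    refine hzero _ ?_
    rw [map_mul (ψ q), star_mul, ← map_star (ψ q) (eta q), mul_assoc, haar_star_eta_mul, mul_assoc,
      ← map_mul, ← map_mul, key c hc, mul_zero]
  have hse : ∀ c : CS q, gnsLin q c = 0 → gnsLin q (c * star (eta q)) = 0 := by
    intro c hc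
    refine hzero _ ?_
    -- The modular relation is used backwards, to bring the η* on the right to the front, where it
    -- is absorbed into the adjoint of c(η*η).
    have h1 := haar_star_eta_mul (ψ q (eta q) * (star (ψ q c) * ψ q c))
    have h2 : ψ q (star (eta q)) * (ψ q (eta q) * (star (ψ q c) * ψ q c)) =
        star (ψ q (c * (star (eta q) * eta q))) * ψ q c := by
      rw [map_mul, map_mul, star_mul, star_mul, ← map_star (ψ q) (star (eta q)), star_star,
        map_star (ψ q) (eta q)]
      simp only [mul_assoc]
    rw [h2, key' c hc] at h1
    have h3 := (mul_eq_zero.1 h1.symm).resolve_left (pow_ne_zero 2 q_ne_zero)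
    rw [map_mul (ψ q), star_mul, ← map_star (ψ q) (star (eta q)), star_star, mul_assoc, ← mul_assoc (star _)]
    simpa only [mul_assoc] using h3
  have hx' : x ∈ Algebra.adjoin ℂ (Set.range (sphere q).gen ∪ star (Set.range (sphere q).gen)) := hx
  clear hx
  induction hx' using Algebra.adjoin_induction generalizing c with
  | mem x h =>
    rcases h with ⟨i, rfl⟩ | ⟨i, hi⟩
    · fin_cases i
      exacts [hxi c hc, heta c hc]
    · obtain rfl : x = star ((sphere q).gen i) := by rw [hi, star_star]
      fin_cases i
      · change gnsLin q (c * star (xi q)) = 0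
        rw [star_xi]
        exact hxi c hc
      · exact hse c hc
  | algebraMap r =>
    rw [Algebra.algebraMap_eq_smul_one, mul_smul_comm, mul_one, map_smul, hc, smul_zero]
  | add x y _ _ hx hy => rw [mul_add, map_add, hx hc, hy hc, add_zero]
  | mul x y _ _ hx hy => rw [← mul_assoc]; exact hy (hx hc)

theorem gnsStarAlgHom_eq_zero {c : CS q} (hc : gnsLin q c = 0) : (hState q).gnsStarAlgHom c = 0 := by
  refine clm_ext_sph fun k i _ => ?_
  rw [gnsStarAlgHom_gnsLin, gnsLin_mul_eq_zero hc (sph_mem_polySph k i)]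
  rfl

/-- Only the represented operators are compared, so it suffices that a and x have the same GNS
vector; faithfulness of h on the sphere is not required. -/
theorem exists_gnsStarAlgHom_eq {a : CS q} (ha : a ∈ smoothAlg q) :
    ∃ x ∈ polySph q, (hState q).gnsStarAlgHom a = (hState q).gnsStarAlgHom x := by
  obtain ⟨x, hx, h⟩ := exists_gnsLin_eq_of_mem_smoothAlg ha
  refine ⟨x, hx, sub_eq_zero.1 ?_⟩
  rw [← map_sub]
  exact gnsStarAlgHom_eq_zero (by rw [map_sub, h, sub_self])

theorem hasBoundedCommutator_smoothAlg {d : ℕ → ℝ} {D : HS q →ₗ.[ℂ] HS q}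
    (hD : IsBlockScalar (hState q) d D)
    (hd : (fun k => |d k - d (k + 1)|) =O[Filter.atTop] fun k : ℕ => (q⁻¹) ^ k) {a : CS q}
    (ha : a ∈ smoothAlg q) : HasBoundedCommutator D ((hState q).gnsStarAlgHom a) := by
  obtain ⟨x, hx, h⟩ := exists_gnsStarAlgHom_eq ha
  rw [h]
  exact hasBoundedCommutator_polySph hD hd hx

end Smooth

open Presentation

/-! ### The operator with eigenvalues `q⁻ᵏ` -/

section Dirac

variable {q : ℝ} [hq : Fact (|q| < 1)] [NeZero q]

theorem isBigO_inv_pow_sub :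
    (fun k : ℕ => |(q⁻¹) ^ k - (q⁻¹) ^ (k + 1)|) =O[Filter.atTop] fun k : ℕ => (q⁻¹) ^ k := by
  refine Asymptotics.IsBigO.of_bound |1 - q⁻¹| (Filter.Eventually.of_forall fun k => ?_)
  rw [Real.norm_eq_abs, abs_abs, Real.norm_eq_abs, ← abs_mul]
  refine le_of_eq (congrArg _ ?_)
  ring

theorem finite_abs_inv_pow_le (C : ℝ) : {p : SphIdx | |(q⁻¹) ^ p.1| ≤ C}.Finite := by
  have h1 : 1 < |q⁻¹| := by
    rw [abs_inv]
    exact (one_lt_inv₀ (abs_pos.2 (NeZero.ne q))).2 hq.out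
  obtain ⟨n, hn⟩ := pow_unbounded_of_one_lt C h1
  refine ((Finset.range n).sigma fun k =>
    (Finset.univ : Finset (Fin (2 * k + 1)))).finite_toSet.subset fun p hp => ?_
  rw [Finset.mem_coe, Finset.mem_sigma, Finset.mem_range]
  refine ⟨?_, Finset.mem_univ _⟩
  by_contra! h
  have h2 : |(q⁻¹) ^ p.1| ≤ C := hp
  rw [abs_pow] at h2
  exact absurd ((pow_le_pow_right₀ h1.le h).trans h2) (not_le.2 hn)

theorem isEquivariantSpectralTriple_inv_pow {D : HS q →ₗ.[ℂ] HS q}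
    (hD : IsBlockScalar (hState q) (fun k => (q⁻¹) ^ k) D) :
    IsEquivariantSpectralTriple (hState q) D := by
  refine ⟨⟨hD.1, hD.isDiag.hasCompactResolvent finite_abs_inv_pow_le, ?_⟩, hD.isEquivariant⟩
  rintro _ ⟨a, ha, rfl⟩
  exact hasBoundedCommutator_smoothAlg hD isBigO_inv_pow_sub ha

theorem isPSummable_inv_pow {D : HS q →ₗ.[ℂ] HS q}
    (hD : IsBlockScalar (hState q) (fun k => (q⁻¹) ^ k) D) {p : ℝ} (hp : 0 < p) : IsPSummable D p := by
  refine hD.isDiag.isPSummable hp ?_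
  have hq0 := q_sq_pos (q := q)
  set r : ℝ := (q ^ 2) ^ (p / 2) with hr
  have hr0 : 0 < r := Real.rpow_pos_of_pos hq0 _
  have hr1 : r < 1 := Real.rpow_lt_one hq0.le (q_sq_lt_one q) (by positivity)
  have hbound : ∀ k : ℕ, ((1 + ((q⁻¹) ^ k) ^ 2)⁻¹) ^ (p / 2) ≤ r ^ k := by
    intro k
    have h1 : r ^ k = ((q ^ 2) ^ k) ^ (p / 2) := by
      rw [hr]
      generalize q ^ 2 = s at hq0
      rw [← Real.rpow_natCast, ← Real.rpow_natCast, ← Real.rpow_mul hq0.le, ← Real.rpow_mul hq0.le,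
        mul_comm]
    rw [h1]
    refine Real.rpow_le_rpow (by positivity) ?_ (by positivity)
    rw [inv_pow, inv_pow, ← pow_mul, mul_comm k, pow_mul]
    refine inv_le_of_inv_le₀ (by positivity) ?_
    linarith
  -- Grouped by spin, each eigenvalue is counted 2k+1 times, and the sum is dominated by ∑ (2k+1) rᵏ
  -- with r = |q|ᵖ.
  refine (summable_sigma_of_nonneg fun p => by positivity).2 ⟨fun k => Summable.of_finite, ?_⟩
  have h1 : Summable fun k : ℕ => (2 * (k : ℝ) + 1) * r ^ k := by
    have h2 := summable_pow_mul_geometric_of_norm_lt_one 1 (r := r)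
      (by rw [Real.norm_of_nonneg hr0.le]; exact hr1)
    refine ((h2.mul_left 2).add (summable_geometric_of_lt_one hr0.le hr1)).congr fun k => ?_
    ring
  refine h1.of_nonneg_of_le (fun k => tsum_nonneg fun i => by positivity) fun k => ?_
  rw [tsum_fintype]
  change ∑ _ : Fin (2 * k + 1), ((1 + ((q⁻¹) ^ k) ^ 2)⁻¹) ^ (p / 2) ≤ _
  rw [Finset.sum_const, Finset.card_univ, Fintype.card_fin, nsmul_eq_mul]
  push_cast
  exact mul_le_mul_of_nonneg_left (hbound k) (by positivity)

theorem spectralDimension_eq_zero : spectralDimension q = 0 := by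
  obtain ⟨D, hD, -⟩ := existsUnique_isBlockScalar (q := q) fun k => (q⁻¹) ^ k
  refine le_antisymm (ENNReal.le_of_forall_pos_le_add fun ε hε _ => ?_) bot_le
  rw [zero_add]
  exact sInf_le ⟨ε, hε, (ENNReal.ofReal_coe_nnreal).symm, hState q, isInvariantState_hState q, D,
    isEquivariantSpectralTriple_inv_pow hD, isPSummable_inv_pow hD hε⟩

end Dirac

end Podles
end

theorem mainTheorem5 (q : ℝ) [NeZero q] (hq : |q| < 1) :
    ∃ ρ : Podles.CS q →ₚ[ℂ] ℂ, Podles.IsInvariantState ρ ∧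
      (∀ ρ' : Podles.CS q →ₚ[ℂ] ℂ, Podles.IsInvariantState ρ' → ρ' = ρ) ∧
      -- the decomposition of the GNS space into spin blocks
      (∀ k, Podles.IsIrreducibleSubspace ρ (Podles.spinBlock ρ k) ∧
        Module.finrank ℂ (Podles.spinBlock ρ k) = 2 * k + 1) ∧
      OrthogonalFamily ℂ (fun k => Podles.spinBlock ρ k)
        (fun k => (Podles.spinBlock ρ k).subtypeₗᵢ) ∧
      (⨆ k, Podles.spinBlock ρ k).topologicalClosure = ⊤ ∧
      -- every sequence `d` defines exactly one operator, and these are the equivariant ones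
      (∀ d : ℕ → ℝ, ∃! D : ρ.GNS →ₗ.[ℂ] ρ.GNS, Podles.IsBlockScalar ρ d D) ∧
      (∀ D : ρ.GNS →ₗ.[ℂ] ρ.GNS, IsSelfAdjoint D →
        (Podles.IsEquivariant ρ D ↔ ∃ d : ℕ → ℝ, Podles.IsBlockScalar ρ d D)) ∧
      -- bounded commutators with `ξ` and `η`, and with all of `𝒜`
      (∀ (d : ℕ → ℝ) (D : ρ.GNS →ₗ.[ℂ] ρ.GNS), Podles.IsBlockScalar ρ d D →
        ((Podles.HasBoundedCommutator D (ρ.gnsStarAlgHom (Podles.xi q)) ∧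
            Podles.HasBoundedCommutator D (ρ.gnsStarAlgHom (Podles.eta q))) ↔
          (fun k => |d k - d (k + 1)|) =O[Filter.atTop] fun k : ℕ => (q⁻¹) ^ k) ∧
        ((∀ a ∈ Podles.smoothAlg q, Podles.HasBoundedCommutator D (ρ.gnsStarAlgHom a)) ↔
          (fun k => |d k - d (k + 1)|) =O[Filter.atTop] fun k : ℕ => (q⁻¹) ^ k)) ∧
      -- the operator with `d(k) = q⁻ᵏ`
      (∀ D : ρ.GNS →ₗ.[ℂ] ρ.GNS, Podles.IsBlockScalar ρ (fun k => (q⁻¹) ^ k) D →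
        Podles.IsEquivariantSpectralTriple ρ D ∧ ∀ p : ℝ, 0 < p → Podles.IsPSummable D p) ∧
      -- the spectral dimension
      Podles.spectralDimension q = 0 := by
  have : Fact (|q| < 1) := ⟨hq⟩
  refine ⟨Podles.hState q, Podles.isInvariantState_hState q, fun ρ' h => h.eq_hState, fun k => ?_,
    Podles.orthogonalFamily_spinBlock, Podles.iSup_spinBlock, Podles.existsUnique_isBlockScalar,
    fun D hD => ⟨fun h => h.exists_isBlockScalar hD, fun ⟨d, hd⟩ => hd.isEquivariant⟩,
    -- Necessity of the growth condition needs only η, and η lies in 𝒜.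
    fun d D hD => ⟨⟨fun h => Podles.isBigO_of_hasBoundedCommutator_eta hD h.2, fun h =>
      ⟨Podles.hasBoundedCommutator_polySph hD h (Podles.xi_mem_polySph),
        Podles.hasBoundedCommutator_polySph hD h (Podles.eta_mem_polySph)⟩⟩,
      fun h => Podles.isBigO_of_hasBoundedCommutator_eta hD (h _ Podles.eta_mem_smoothAlg),
      fun h a ha => Podles.hasBoundedCommutator_smoothAlg hD h ha⟩,
    fun D hD => ⟨Podles.isEquivariantSpectralTriple_inv_pow hD, fun p hp =>
      Podles.isPSummable_inv_pow hD hp⟩, Podles.spectralDimension_eq_zero⟩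
  rw [Podles.spinBlock_eq]
  exact ⟨Podles.isIrreducibleSubspace_block k, Podles.finrank_block k⟩
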